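/- **Setting.** Minkowski space is $\mathbb R^4$ with $\eta=\mathrm{diag}(1,-1,-1,-1)$, $x\cdot y=(x,\eta y)=x_0y_0-x_1y_1-x_2y_2-x_3y_3$, $x^2=x\cdot x$; $V_+=\{p:\ p^2\ge 0,\ p_0\ge 0\}$; the causal complement of $\mathcal O\subset\mathbb R^4$ is $\mathcal O'=\{x:\ (x-y)^2<0\ \forall y\in\mathcal O\}$. Fourier transforms are $\tilde f(p)=(2\pi)^{-2n}\int f(x)\,e^{-i\sum_j p_j\cdot x_j}\,d^{4n}x$ for $f\in\mathcal S(\mathbb R^{4n})$. Let $\phi_1,\dots,\phi_K$ be the field components of a Wightman theory on a Hilbert space $\mathcal H$: there are a strongly continuous unitary representation $U$ of $\mathbb R^4\rtimes SL(2,\mathbb C)$ whose translations $U(y,1)=e^{iP\cdot y}$ have joint spectrum in $V_+$, and a $U$-invariant unit vector $\Omega$; the operators $\phi_k(f)$, $f\in\mathcal S(\mathbb R^4)$, are linear in $f$ and defined on a common stable $U$-invariant domain containing $\Omega$, their matrix elements between vectors of this domain are tempered distributions, the set of fields is closed under adjoints, $\phi_k(f)^*\supset\phi_{\bar k}(\bar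 f)$, the vacuum $\Omega$ is cyclic, and the fields transform covariantly, $U(y,A)\phi_k(f)U(y,A)^{-1}=\sum_m D(A^{-1})_{km}\,\phi_m\big(f(\Lambda(A)^{-1}(\cdot-y))\big)$, with a $K$-dimensional representation $D$ of $SL(2,\mathbb C)$. Let $\Psi^n_{\boldsymbol k}:\mathcal S(\mathbb R^{4n})\to\mathcal H$, $\boldsymbol k\in\{1,\dots,K\}^n$, be the continuous linear map with $\Psi^n_{\boldsymbol k}(f_1\otimes\dots\otimes f_n)=\phi_{k_1}(f_1)\cdots\phi_{k_n}(f_n)\Omega$ (it exists by the nuclear theorem), and let $\mathcal D$ be the span of all vectors $\Psi^n_{\boldsymbol k}(g)$. For a real antisymmetric $4\times4$ matrix $\theta$ put $p\theta q=(p,\eta\theta\eta q)$. The Moyal tensor product of $f\in\mathcal S(\mathbb R^4)$ and $g\in\mathcal S(\mathbb R^{4n})$ is given by $\widetilde{f\otimes_\theta g}(p,q_1,\dots,q_n)=\prod_{r}e^{-\frac i2 p\theta q_r}\,\tilde f(p)\,\tilde g(q_1,\dots,q_n)$, and the $\theta$-deformed field operators on $\mathcal D$ are the linear operators with $\phi^\theta_k(f)\Psi^n_{\boldsymbol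 m}(g)=\Psi^{n+1}_{k\boldsymbol m}(f\otimes_\theta g)$. Let $\kappa_e,\kappa_m\in\mathbb R$, not both zero, and let $\Sigma$ be the set of all real antisymmetric $\theta=(\theta_{\mu\nu})$ with $\theta_{\mu\nu}\theta^{\mu\nu}=-2(\kappa_e^2-\kappa_m^2)$ and $\varepsilon_{\mu\nu\alpha\beta}\theta^{\mu\nu}\theta^{\alpha\beta}=-8\kappa_e\kappa_m$ (indices are raised with $\eta$, $\varepsilon_{0123}=1$); this is the orbit, under $\theta\mapsto\Lambda\theta\Lambda^T$ with $\Lambda$ in the proper orthochronous Lorentz group, of the matrix $\theta_1$ with $(\theta_1)_{01}=-(\theta_1)_{10}=\kappa_e$, $(\theta_1)_{23}=-(\theta_1)_{32}=\kappa_m$ and all other entries $0$. With $W_1=\{x:\ x_1>|x_0|\}$, the wedge of $\theta=\Lambda\theta_1\Lambda^T\in\Sigma$ is $W(\theta)=\Lambda W_1$ if $\kappa_e\ge0$ and $W(\theta)=-\Lambda W_1$ if $\kappa_e<0$. **Theorem ($\theta$-deformed quantum fields are wedge-local).** The maps $\Psi^n_{\boldsymbol k}$ and, for $\theta\in\Sigma$,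 the operators $\phi^\theta_k(f)$ are well defined. Write $[A,B]_\pm=AB\pm BA$ and suppose that, for some pair of indices $k,l$ and one choice of the sign, the undeformed fields (anti)commute at spacelike separation, i.e. $[\phi_k(f),\phi_l(g)]_\pm=0$ on the domain of the fields whenever $f,g\in\mathcal S(\mathbb R^4)$ and $\mathrm{supp} f\subset(\mathrm{supp} g)'$. Then, with the same sign, for all $\theta,\theta'\in\Sigma$, all $f_1,f_2\in\mathcal S(\mathbb R^4)$ with $$\mathrm{supp} f_1+W(\theta)\subset\big(\mathrm{supp} f_2+W(\theta')\big)'$$ and all $\Psi\in\mathcal D$, $$[\phi^\theta_k(f_1),\phi^{\theta'}_l(f_2)]_\pm\,\Psi=0 .$$ In this sense the field $\phi^\theta_k(x)$ is localized in the wedge $W(\theta)+x$. -/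

import Mathlib

open scoped SchwartzMap FourierTransform Pointwise

noncomputable section

namespace MoyalQFT

/-- Minkowski space `ℝ⁴`. The components `x 0, …, x 3` of a vector are the `x₀, …, x₃`; the Euclidean
structure of the type is only used for its topology and Lebesgue measure. -/
abbrev Spacetime : Type := EuclideanSpace ℝ (Fin 4)

/-- The space `ℝ⁴ⁿ` of `n`-tuples of points; `x (j, μ)` is the `μ`-th component of the `j`-th
point. -/
abbrev Points (n : ℕ) : Type := EuclideanSpace ℝ (Fin n × Fin 4)

/-- The `j`-th point `xⱼ` of `x = (x₁, …, xₙ)`. -/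
def Points.point {n : ℕ} (j : Fin n) : Points n →L[ℝ] Spacetime :=
  LinearMap.toContinuousLinearMap
    { toFun := fun x => WithLp.toLp 2 fun μ => x (j, μ)
      map_add' := fun x y => by ext μ; simp
      map_smul' := fun c x => by ext μ; simp }

/-- `(x₁, …, xₙ₊₁) ↦ (x₂, …, xₙ₊₁)`. -/
def Points.tail {n : ℕ} : Points (n + 1) →L[ℝ] Points n :=
  LinearMap.toContinuousLinearMap
    { toFun := fun x => WithLp.toLp 2 fun jμ => x (jμ.1.succ, jμ.2)
      map_add' := fun x y => by ext μ; simp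
      map_smul' := fun c x => by ext μ; simp }

@[simp]
theorem Points.point_apply {n : ℕ} (j : Fin n) (x : Points n) (μ : Fin 4) :
    Points.point j x μ = x (j, μ) := rfl

@[simp]
theorem Points.tail_apply {n : ℕ} (x : Points (n + 1)) (jμ : Fin n × Fin 4) :
    Points.tail x jμ = x (jμ.1.succ, jμ.2) := rfl

theorem Points.norm_le {n : ℕ} (x : Points (n + 1)) :
    ‖x‖ ≤ (1 + ‖Points.point 0 x‖) * (1 + ‖Points.tail x‖) := by
  have h : ‖x‖ ^ 2 = ‖Points.point 0 x‖ ^ 2 + ‖Points.tail x‖ ^ 2 := by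
    simp only [EuclideanSpace.norm_sq_eq, Fintype.sum_prod_type, Fin.sum_univ_succ,
      Points.point_apply, Points.tail_apply]
  have h1 := norm_nonneg (Points.point 0 x)
  have h2 := norm_nonneg (Points.tail x)
  have h3 := norm_nonneg x
  have h4 := mul_nonneg h1 h2
  nlinarith [sq_nonneg (‖Points.point 0 x‖ - ‖Points.tail x‖)]

theorem norm_iteratedFDeriv_comp_clm_le {D E : Type*} [NormedAddCommGroup D] [NormedSpace ℝ D]
    [NormedAddCommGroup E] [NormedSpace ℝ E] (L : D →L[ℝ] E) (f : 𝓢(E, ℂ)) (i : ℕ) (x : D) :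
    ‖iteratedFDeriv ℝ i (fun y => f (L y)) x‖ ≤ ‖iteratedFDeriv ℝ i f (L x)‖ * ‖L‖ ^ i := by
  have h := L.iteratedFDeriv_comp_right (f := f) (f.smooth ⊤) x (i := i) (by exact_mod_cast le_top)
  have h' : (fun y => f (L y)) = f ∘ L := rfl
  rw [h', h]
  refine (ContinuousMultilinearMap.norm_compContinuousLinearMap_le _ _).trans ?_
  simp

/-- The tensor product `(f ⊗ g)(x₁, …, xₙ₊₁) = f(x₁) g(x₂, …, xₙ₊₁)` of Schwartz functions. -/
def tensor {n : ℕ} (f : 𝓢(Spacetime, ℂ)) (g : 𝓢(Points n, ℂ)) : 𝓢(Points (n + 1), ℂ) where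
  toFun x := f (Points.point 0 x) * g (Points.tail x)
  smooth' := ((f.smooth ⊤).comp (Points.point 0).contDiff).mul
    ((g.smooth ⊤).comp Points.tail.contDiff)
  decay' k N := by
    set a : ℝ := ‖(Points.point (n := n + 1) 0)‖
    set b : ℝ := ‖(Points.tail (n := n))‖
    set S : ℝ := 2 ^ k * ((Finset.Iic (k, N)).sup fun m => SchwartzMap.seminorm ℝ m.1 m.2) f
    set R : ℝ := 2 ^ k * ((Finset.Iic (k, N)).sup fun m => SchwartzMap.seminorm ℝ m.1 m.2) g
    refine ⟨∑ i ∈ Finset.range (N + 1), (N.choose i : ℝ) * (S * a ^ i) * (R * b ^ (N - i)), ?_⟩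
    intro x
    have hmul := norm_iteratedFDeriv_mul_le (𝕜 := ℝ) (N := ((⊤ : ℕ∞) : WithTop ℕ∞))
      (f := fun x : Points (n + 1) => f (Points.point 0 x))
      (g := fun x : Points (n + 1) => g (Points.tail x))
      ((f.smooth ⊤).comp (Points.point 0).contDiff)
      ((g.smooth ⊤).comp Points.tail.contDiff) x (n := N) (by exact_mod_cast le_top)
    have hx : ‖x‖ ^ k ≤ (1 + ‖Points.point 0 x‖) ^ k * (1 + ‖Points.tail x‖) ^ k := by
      rw [← mul_pow]
      exact pow_le_pow_left₀ (norm_nonneg _) (Points.norm_le x) k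
    refine (mul_le_mul hx hmul (norm_nonneg _) (by positivity)).trans ?_
    rw [Finset.mul_sum]
    refine Finset.sum_le_sum fun i hi => ?_
    have hi' : i ≤ N := Nat.lt_succ_iff.mp (Finset.mem_range.mp hi)
    have h1 := norm_iteratedFDeriv_comp_clm_le (Points.point (n := n + 1) 0) f i x
    have h2 := norm_iteratedFDeriv_comp_clm_le (Points.tail (n := n)) g (N - i) x
    have h3 := SchwartzMap.one_add_le_sup_seminorm_apply (𝕜 := ℝ) (m := (k, N)) (k := k) (n := i)
      le_rfl hi' f (Points.point 0 x)
    have h4 := SchwartzMap.one_add_le_sup_seminorm_apply (𝕜 := ℝ) (m := (k, N)) (k := k)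
      (n := N - i) le_rfl (Nat.sub_le _ _) g (Points.tail x)
    calc (1 + ‖Points.point 0 x‖) ^ k * (1 + ‖Points.tail x‖) ^ k *
          ((N.choose i : ℝ) * ‖iteratedFDeriv ℝ i (fun y => f (Points.point 0 y)) x‖ *
            ‖iteratedFDeriv ℝ (N - i) (fun y => g (Points.tail y)) x‖)
        ≤ (1 + ‖Points.point 0 x‖) ^ k * (1 + ‖Points.tail x‖) ^ k *
          ((N.choose i : ℝ) * (‖iteratedFDeriv ℝ i f (Points.point 0 x)‖ * a ^ i) *
            (‖iteratedFDeriv ℝ (N - i) g (Points.tail x)‖ * b ^ (N - i))) := by gcongr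
      _ = (N.choose i : ℝ) *
          (((1 + ‖Points.point 0 x‖) ^ k * ‖iteratedFDeriv ℝ i f (Points.point 0 x)‖) * a ^ i) *
          (((1 + ‖Points.tail x‖) ^ k * ‖iteratedFDeriv ℝ (N - i) g (Points.tail x)‖)
            * b ^ (N - i)) := by ring
      _ ≤ _ := by gcongr

@[simp]
theorem tensor_apply {n : ℕ} (f : 𝓢(Spacetime, ℂ)) (g : 𝓢(Points n, ℂ)) (x : Points (n + 1)) :
    tensor f g x = f (Points.point 0 x) * g (Points.tail x) := rfl

theorem hasTemperateGrowth_exp_mul_I :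
    (fun t : ℝ => Complex.exp (t * Complex.I)).HasTemperateGrowth := by
  have hd : ∀ n : ℕ, iteratedDeriv n (fun t : ℝ => Complex.exp (t * Complex.I)) =
      fun t : ℝ => Complex.I ^ n * Complex.exp (t * Complex.I) := by
    intro n
    induction n with
    | zero => simp
    | succ n ih =>
      rw [iteratedDeriv_succ, ih]
      funext t
      have h0 : HasDerivAt (fun t : ℝ => (t : ℂ) * Complex.I) Complex.I t := by
        simpa using (Complex.ofRealCLM.hasDerivAt (x := t)).mul_const Complex.I
      have h := (h0.cexp).const_mul (Complex.I ^ n)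
      rw [h.deriv]
      ring
  refine ⟨?_, fun n => ⟨0, 1, fun x => ?_⟩⟩
  · exact Complex.contDiff_exp.comp (Complex.ofRealCLM.contDiff.mul contDiff_const)
  · rw [norm_iteratedFDeriv_eq_norm_iteratedDeriv, hd]
    simp [Complex.norm_exp]

/-- Minkowski inner product `x · y = x₀y₀ - x₁y₁ - x₂y₂ - x₃y₃`. -/
def minkowski (x y : Spacetime) : ℝ := x 0 * y 0 - x 1 * y 1 - x 2 * y 2 - x 3 * y 3

/-- The metric `η = diag(1, -1, -1, -1)`. -/
def metric : Matrix (Fin 4) (Fin 4) ℝ := Matrix.diagonal ![1, -1, -1, -1]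

/-- `p θ q = (p, η θ η q)`, with the Euclidean product `( , )`. -/
def thetaForm (θ : Matrix (Fin 4) (Fin 4) ℝ) (p q : Spacetime) : ℝ :=
  ∑ μ, ∑ ν, p μ * (metric * θ * metric) μ ν * q ν

/-- `f̃(p) = (2π)⁻² ∫ f(x) exp(-i p·x) d⁴x` for `f ∈ 𝓢(ℝ⁴)`. -/
def fourierOne (f : 𝓢(Spacetime, ℂ)) (p : Spacetime) : ℂ :=
  ((2 * Real.pi : ℂ) ^ 2)⁻¹ * ∫ x, Complex.exp (-(minkowski p x) * Complex.I) * f x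

/-- `f̃(p₁, …, pₙ) = (2π)⁻²ⁿ ∫ f(x) exp(-i ∑ⱼ pⱼ·xⱼ) d⁴ⁿx` for `f ∈ 𝓢(ℝ⁴ⁿ)`. -/
def fourierMulti {n : ℕ} (f : 𝓢(Points n, ℂ)) (p : Points n) : ℂ :=
  ((2 * Real.pi : ℂ) ^ (2 * n))⁻¹ *
    ∫ x, Complex.exp (-(∑ j, minkowski (Points.point j p) (Points.point j x) : ℝ) * Complex.I) * f x

/-- The phase `-½ ∑ᵣ p₁ θ pᵣ` of the Moyal tensor product, in terms of the variable
`ξ = η p / (2π)` of Mathlib's Fourier transform. -/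
def moyalPhase {n : ℕ} (θ : Matrix (Fin 4) (Fin 4) ℝ) (ξ : Points (n + 1)) : ℝ :=
  ∑ r : Fin n, ∑ μ, ∑ ν, (-2 * Real.pi ^ 2 * θ μ ν) * (ξ (0, μ) * ξ (r.succ, ν))

theorem hasTemperateGrowth_moyalPhase {n : ℕ} (θ : Matrix (Fin 4) (Fin 4) ℝ) :
    (fun ξ : Points (n + 1) => Complex.exp (moyalPhase θ ξ * Complex.I)).HasTemperateGrowth := by
  have hc : ∀ i : Fin (n + 1) × Fin 4,
      (fun ξ : Points (n + 1) => ξ i).HasTemperateGrowth := fun i =>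
    (EuclideanSpace.proj i : Points (n + 1) →L[ℝ] ℝ).hasTemperateGrowth
  have h : (fun ξ : Points (n + 1) => moyalPhase θ ξ).HasTemperateGrowth := by
    unfold moyalPhase
    refine Function.HasTemperateGrowth.sum fun r _ => Function.HasTemperateGrowth.sum fun μ _ =>
      Function.HasTemperateGrowth.sum fun ν _ => ?_
    exact (Function.HasTemperateGrowth.const _).mul ((hc _).mul (hc _))
  exact hasTemperateGrowth_exp_mul_I.comp h

/-- The Moyal tensor product `f ⊗_θ g` of `f ∈ 𝓢(ℝ⁴)` and `g ∈ 𝓢(ℝ⁴ⁿ)`, obtained by multiplying the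
tensor product of the Fourier transforms by a phase; see `fourierMulti_moyalTensor` for the formula
in terms of the Minkowski Fourier transforms. -/
def moyalTensor {n : ℕ} (θ : Matrix (Fin 4) (Fin 4) ℝ) (f : 𝓢(Spacetime, ℂ))
    (g : 𝓢(Points n, ℂ)) : 𝓢(Points (n + 1), ℂ) :=
  𝓕⁻ (SchwartzMap.smulLeftCLM ℂ
    (fun ξ : Points (n + 1) => Complex.exp (moyalPhase θ ξ * Complex.I)) (tensor (𝓕 f) (𝓕 g)))

/-- The variable `η p / (2π)` of Mathlib's Fourier transform. -/
def momentumOne (p : Spacetime) : Spacetime :=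
  WithLp.toLp 2 fun μ => (2 * Real.pi)⁻¹ * (metric μ μ * p μ)

/-- The variable `η p / (2π)` of Mathlib's Fourier transform, for `n` points. -/
def momentumMulti {n : ℕ} (p : Points n) : Points n :=
  WithLp.toLp 2 fun jμ => (2 * Real.pi)⁻¹ * (metric jμ.2 jμ.2 * p jμ)

theorem fourierOne_eq (f : 𝓢(Spacetime, ℂ)) (p : Spacetime) :
    fourierOne f p = ((2 * Real.pi : ℂ) ^ 2)⁻¹ * 𝓕 f (momentumOne p) := by
  rw [SchwartzMap.fourier_coe, Real.fourier_eq', fourierOne]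
  congr 2
  funext x
  rw [smul_eq_mul]
  congr 3
  rw [← Complex.ofReal_neg]
  congr 1
  simp [PiLp.inner_apply, Fin.sum_univ_four, minkowski, momentumOne, metric]
  field_simp
  ring

theorem fourierMulti_eq {n : ℕ} (f : 𝓢(Points n, ℂ)) (p : Points n) :
    fourierMulti f p = ((2 * Real.pi : ℂ) ^ (2 * n))⁻¹ * 𝓕 f (momentumMulti p) := by
  rw [SchwartzMap.fourier_coe, Real.fourier_eq', fourierMulti]
  congr 2
  funext x
  rw [smul_eq_mul]
  congr 3
  rw [← Complex.ofReal_neg]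
  congr 1
  simp only [PiLp.inner_apply, Fintype.sum_prod_type, Finset.mul_sum, ← Finset.sum_neg_distrib]
  refine Finset.sum_congr rfl fun j _ => ?_
  simp [Fin.sum_univ_four, minkowski, momentumMulti, metric]
  field_simp
  ring

/-- The momentum space formula for the Moyal tensor product:
`(f ⊗_θ g)~(p, q₁, …, qₙ) = ∏ᵣ exp(-(i/2) p θ qᵣ) · f̃(p) g̃(q₁, …, qₙ)`. -/
theorem fourierMulti_moyalTensor {n : ℕ} (θ : Matrix (Fin 4) (Fin 4) ℝ) (f : 𝓢(Spacetime, ℂ))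
    (g : 𝓢(Points n, ℂ)) (p : Points (n + 1)) :
    fourierMulti (moyalTensor θ f g) p =
      (∏ r : Fin n, Complex.exp (-(Complex.I / 2) *
        thetaForm θ (Points.point 0 p) (Points.point r.succ p))) *
        (fourierOne f (Points.point 0 p) * fourierMulti g (Points.tail p)) := by
  rw [fourierMulti_eq, fourierMulti_eq, fourierOne_eq, moyalTensor,
    FourierTransform.fourier_fourierInv_eq,
    SchwartzMap.smulLeftCLM_apply_apply (hasTemperateGrowth_moyalPhase θ), tensor_apply,
    ← Complex.exp_sum, smul_eq_mul]
  have h1 : Points.point 0 (momentumMulti p) = momentumOne (Points.point 0 p) := rfl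
  have h2 : Points.tail (momentumMulti p) = momentumMulti (Points.tail p) := rfl
  have h3 : ((moyalPhase θ (momentumMulti p) : ℝ) : ℂ) * Complex.I =
      ∑ r : Fin n, -(Complex.I / 2) *
        thetaForm θ (Points.point 0 p) (Points.point r.succ p) := by
    have h4 : moyalPhase θ (momentumMulti p) =
        ∑ r : Fin n, -(1 / 2) * thetaForm θ (Points.point 0 p) (Points.point r.succ p) := by
      unfold moyalPhase thetaForm
      refine Finset.sum_congr rfl fun r _ => ?_
      simp only [Finset.mul_sum]
      refine Finset.sum_congr rfl fun μ _ => Finset.sum_congr rfl fun ν _ => ?_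
      simp only [momentumMulti, metric, Matrix.diagonal_mul, Matrix.mul_diagonal,
        Matrix.diagonal_apply_eq, Points.point_apply]
      field_simp
    rw [h4]
    push_cast
    rw [Finset.sum_mul]
    refine Finset.sum_congr rfl fun r _ => ?_
    ring
  rw [h1, h2, h3]
  have h5 : ((2 * Real.pi : ℂ) ^ (2 * (n + 1)))⁻¹ =
      ((2 * Real.pi : ℂ) ^ 2)⁻¹ * ((2 * Real.pi : ℂ) ^ (2 * n))⁻¹ := by
    rw [← mul_inv]; congr 1; ring
  rw [h5]
  ring

/-! ### Lorentz group, wedges, noncommutativity parameters -/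

/-- The proper orthochronous Lorentz group, as a set of matrices. -/
def properLorentz : Set (Matrix (Fin 4) (Fin 4) ℝ) :=
  {Λ | Λ.transpose * metric * Λ = metric ∧ Λ.det = 1 ∧ 0 < Λ 0 0}

/-- The action of a matrix on Minkowski space. -/
def act (Λ : Matrix (Fin 4) (Fin 4) ℝ) (x : Spacetime) : Spacetime :=
  WithLp.toLp 2 fun μ => ∑ ν, Λ μ ν * x ν

/-- The closed forward light cone `V₊`. -/
def forwardCone : Set Spacetime := {p | 0 ≤ minkowski p p ∧ 0 ≤ p 0}

/-- The causal complement `O'` of a set `O`. -/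
def causalComplement (O : Set Spacetime) : Set Spacetime :=
  {x | ∀ y ∈ O, minkowski (x - y) (x - y) < 0}

/-- The standard wedge `W₁ = {x : x₁ > |x₀|}`. -/
def standardWedge : Set Spacetime := {x | |x 0| < x 1}

/-- The reference noncommutativity `θ₁`. -/
def thetaRef (κe κm : ℝ) : Matrix (Fin 4) (Fin 4) ℝ :=
  !![0, κe, 0, 0; -κe, 0, 0, 0; 0, 0, 0, κm; 0, 0, -κm, 0]

/-- The set `Σ` of all real antisymmetric `θ = (θ_{μν})` with
`θ_{μν} θ^{μν} = -2 (κe² - κm²)` and `ε_{μναβ} θ^{μν} θ^{αβ} = -8 κe κm`, where `ε_{0123} = 1` and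
`θ^{μν}` are the entries of `η θ η`. It contains `θ₁`. -/
def noncommutativities (κe κm : ℝ) : Set (Matrix (Fin 4) (Fin 4) ℝ) :=
  {θ | θ.transpose = -θ ∧
    ∑ μ, ∑ ν, θ μ ν * (metric * θ * metric) μ ν = -2 * (κe ^ 2 - κm ^ 2) ∧
    ∑ σ : Equiv.Perm (Fin 4), ((Equiv.Perm.sign σ : ℤ) : ℝ) *
      ((metric * θ * metric) (σ 0) (σ 1) * (metric * θ * metric) (σ 2) (σ 3)) = -8 * (κe * κm)}

/-- The wedge `W(θ)`, given by `W(Λ θ₁ Λᵀ) = ε(κe) Λ W₁` for proper orthochronous `Λ`, where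
`ε(κe) = 1` if `κe ≥ 0` and `ε(κe) = -1` otherwise. (For `(κe, κm) ≠ (0, 0)` the set `ε(κe) Λ W₁`
is the same for all `Λ` with `θ = Λ θ₁ Λᵀ`.) -/
def wedge (κe κm : ℝ) (θ : Matrix (Fin 4) (Fin 4) ℝ) : Set Spacetime :=
  {x | ∃ Λ ∈ properLorentz, θ = Λ * thetaRef κe κm * Λ.transpose ∧
    ∃ w ∈ standardWedge, x = (if 0 ≤ κe then (1 : ℝ) else -1) • act Λ w}

/-! ### Wightman theories -/

/-- The matrices `σ₀ = 1` and `σ₁, σ₂, σ₃` (Pauli). -/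
def pauli : Fin 4 → Matrix (Fin 2) (Fin 2) ℂ :=
  ![1, !![0, 1; 1, 0], !![0, -Complex.I; Complex.I, 0], !![1, 0; 0, -1]]

/-- The covering homomorphism `A ↦ Λ(A)` from `SL(2, ℂ)` to the Lorentz group:
`∑ (Λ(A)x)_μ σ_μ = A (∑ x_ν σ_ν) A*`. -/
def covering (A : Matrix.SpecialLinearGroup (Fin 2) ℂ) : Matrix (Fin 4) (Fin 4) ℝ :=
  Matrix.of fun μ ν =>
    (1 / 2 : ℝ) * ((pauli μ * (A.1 * pauli ν * A.1.conjTranspose)).trace).re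

/-- The complex conjugate of a test function. -/
def conjTest (f : 𝓢(Spacetime, ℂ)) : 𝓢(Spacetime, ℂ) :=
  SchwartzMap.postcompCLM (𝕜 := ℝ) (Complex.conjCLE : ℂ →L[ℝ] ℂ) f

/-- The vector `φ_{k₁}(f₁) ⋯ φ_{kₙ}(fₙ) Ω`. -/
def monomial {K : ℕ} {V : Type*} [AddCommGroup V] [Module ℂ V]
    (φ : Fin K → 𝓢(Spacetime, ℂ) →ₗ[ℂ] Module.End ℂ V) (Ω : V) :
    (n : ℕ) → (Fin n → Fin K) → (Fin n → 𝓢(Spacetime, ℂ)) → V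
  | 0, _, _ => Ω
  | n + 1, k, f => φ (k 0) (f 0) (monomial φ Ω n (Fin.tail k) (Fin.tail f))

/-- A Wightman theory of finitely many field components `φ₁, …, φ_K` on the Hilbert space `H`.
No locality is assumed here. -/
structure WightmanTheory (K : ℕ) (H : Type*) [NormedAddCommGroup H] [InnerProductSpace ℂ H]
    [CompleteSpace H] where
  /-- the unitary representation `U(y, A)` of the covering group `ℝ⁴ ⋊ SL(2, ℂ)` -/
  U : Spacetime → Matrix.SpecialLinearGroup (Fin 2) ℂ → (H ≃ₗᵢ[ℂ] H)
  U_mul : ∀ y A y' A' v, U y A (U y' A' v) = U (y + act (covering A) y') (A * A') v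
  U_continuous : ∀ v : H,
    Continuous fun g : Spacetime × Matrix.SpecialLinearGroup (Fin 2) ℂ => U g.1 g.2 v
  /-- The joint spectrum of the generators `P` of the translations `U(y, 1) = exp(i P·y)` lies in
  the closed forward light cone: the operator `∫ h(y) U(y, 1) dy`, which is the function
  `p ↦ ∫ h(y) exp(i p·y) dy` of `P`, vanishes if this function vanishes on the cone. -/
  spectrum_condition : ∀ h : 𝓢(Spacetime, ℂ),
    (∀ p ∈ forwardCone, ∫ y, Complex.exp ((minkowski p y : ℝ) * Complex.I) * h y = 0) →
    ∀ v : H, ∫ y, h y • U y 1 v = 0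
  /-- the common stable domain of the field operators -/
  dom : Submodule ℂ H
  /-- the vacuum vector -/
  vacuum : dom
  norm_vacuum : ‖(vacuum : H)‖ = 1
  U_vacuum : ∀ y A, U y A (vacuum : H) = (vacuum : H)
  U_dom : ∀ y A, ∀ v ∈ dom, U y A v ∈ dom
  /-- the field operators `φ_k(f)` -/
  φ : Fin K → 𝓢(Spacetime, ℂ) →ₗ[ℂ] Module.End ℂ dom
  tempered : ∀ (k : Fin K) (v w : dom), Continuous fun f => inner ℂ (v : H) (φ k f w : H)
  /-- the index `k̄` of the adjoint field: `φ_k(f)* = φ_{k̄}(f̄)` on the domain -/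
  bar : Fin K → Fin K
  adjoint : ∀ (k : Fin K) (f : 𝓢(Spacetime, ℂ)) (v w : dom),
    inner ℂ (v : H) (φ k f w : H) = inner ℂ (φ (bar k) (conjTest f) v : H) (w : H)
  /-- the vacuum is cyclic -/
  cyclic : Dense (Submodule.span ℂ
    {v : H | ∃ (n : ℕ) (k : Fin n → Fin K) (f : Fin n → 𝓢(Spacetime, ℂ)),
      v = ((monomial φ vacuum n k f : dom) : H)} : Set H)
  /-- the representation of `SL(2, ℂ)` that describes the transformation behaviour of the fields -/
  rep : Matrix.SpecialLinearGroup (Fin 2) ℂ →* Matrix (Fin K) (Fin K) ℂ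
  /-- `U(y, A) φ_k(f) U(y, A)⁻¹ = ∑ₘ D(A⁻¹)ₖₘ φₘ(f')` with `f'(x) = f(Λ(A)⁻¹(x - y))` -/
  covariant : ∀ y A (k : Fin K) (f f' : 𝓢(Spacetime, ℂ)),
    (∀ x, f' (act (covering A) x + y) = f x) → ∀ v : dom,
      U y A (φ k f v : H) = ∑ m, rep A⁻¹ k m • (φ m f' ⟨U y A v, U_dom y A v v.2⟩ : H)

/-- `[A, B]_± = A B ± B A`, where `s = ±1` is the sign. -/
def bracket {V : Type*} [AddCommGroup V] [Module ℂ V] (s : ℤˣ) (A B : Module.End ℂ V) :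
    Module.End ℂ V :=
  A * B + s • (B * A)

namespace WightmanTheory

variable {K : ℕ} {H : Type*} [NormedAddCommGroup H] [InnerProductSpace ℂ H] [CompleteSpace H]

/-- The fields `φ_k`, `φ_l` commute (`s = -1`) or anticommute (`s = 1`) at spacelike separation. -/
def SpacelikeCommute (T : WightmanTheory K H) (s : ℤˣ) (k l : Fin K) : Prop :=
  ∀ f g : 𝓢(Spacetime, ℂ), tsupport f ⊆ causalComplement (tsupport g) →
    ∀ v : T.dom, bracket s (T.φ k f) (T.φ l g) v = 0

/-- `L` is an `H`-valued tempered distribution on `ℝ⁴ⁿ` such that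
`L(f₁ ⊗ ⋯ ⊗ fₙ) = φ_{k₁}(f₁) ⋯ φ_{kₙ}(fₙ) Ω` for all test functions `f₁, …, fₙ`. -/
def IsVectorDistribution (T : WightmanTheory K H) (n : ℕ) (k : Fin n → Fin K)
    (L : 𝓢(Points n, ℂ) →L[ℂ] H) : Prop :=
  ∀ (f : Fin n → 𝓢(Spacetime, ℂ)) (F : 𝓢(Points n, ℂ)),
    (∀ x, F x = ∏ j, f j (Points.point j x)) → L F = ((monomial T.φ T.vacuum n k f : T.dom) : H)

open Classical in
/-- The `H`-valued tempered distribution `Ψⁿ_k` with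
`Ψⁿ_k(f₁ ⊗ ⋯ ⊗ fₙ) = φ_{k₁}(f₁) ⋯ φ_{kₙ}(fₙ) Ω`. It is unique because the sums of product functions
are dense, and it exists by the nuclear theorem (the value `0` in the other case never occurs). -/
def Psi (T : WightmanTheory K H) (n : ℕ) (k : Fin n → Fin K) : 𝓢(Points n, ℂ) →L[ℂ] H :=
  if h : ∃ L, T.IsVectorDistribution n k L then h.choose else 0

/-- The domain `𝒟`, spanned by all vectors `Ψⁿ_k(g)`. -/
def domain (T : WightmanTheory K H) : Submodule ℂ H :=
  Submodule.span ℂ {v : H | ∃ (n : ℕ) (k : Fin n → Fin K) (g : 𝓢(Points n, ℂ)), v = T.Psi n k g}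

/-- `Ψⁿ_k(g)` as an element of `𝒟`. -/
def psi (T : WightmanTheory K H) (n : ℕ) (k : Fin n → Fin K) (g : 𝓢(Points n, ℂ)) : T.domain :=
  ⟨T.Psi n k g, Submodule.subset_span ⟨n, k, g, rfl⟩⟩

/-- The linear operator `A` on `𝒟` is the `θ`-deformed field operator `φ^θ_k(f)`:
`A Ψⁿ_m(g) = Ψⁿ⁺¹_{k m}(f ⊗_θ g)` for all `n`, `m`, `g`. -/
def IsDeformedField (T : WightmanTheory K H) (θ : Matrix (Fin 4) (Fin 4) ℝ) (k : Fin K)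
    (f : 𝓢(Spacetime, ℂ)) (A : Module.End ℂ T.domain) : Prop :=
  ∀ (n : ℕ) (m : Fin n → Fin K) (g : 𝓢(Points n, ℂ)),
    A (T.psi n m g) = T.psi (n + 1) (Fin.cons k m) (moyalTensor θ f g)

open Classical in
/-- The `θ`-deformed field operator `φ^θ_k(f)` on `𝒟`. It is unique because the vectors `Ψⁿ_m(g)`
span `𝒟`, and it exists for antisymmetric `θ`. -/
def deformedField (T : WightmanTheory K H) (θ : Matrix (Fin 4) (Fin 4) ℝ) (k : Fin K)
    (f : 𝓢(Spacetime, ℂ)) : Module.End ℂ T.domain :=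
  if h : ∃ A, T.IsDeformedField θ k f A then h.choose else 0

end WightmanTheory

end MoyalQFT

end

open scoped SchwartzMap FourierTransform Pointwise

noncomputable section

namespace MoyalQFT

open Filter Topology MeasureTheory

/-! ### Completeness of Schwartz space -/

section Complete

variable {E F : Type*} [NormedAddCommGroup E] [NormedSpace ℝ E] [NormedAddCommGroup F]
  [NormedSpace ℝ F]

/-! The Moyal phase is bilinear in the momentum of the field and the total momentum of the vector on
which the field acts. In position space such a phase is a displacement: on vectors of total momentum
`R` the deformed field is the undeformed one, smeared with `f` displaced by `π • act θ R`. As `θ` is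
antisymmetric, the momentum of the field itself may be added to `R`, so `R` can also be read as the
total momentum after the action of the field. In the variables of Mathlib's Fourier transform the
spectrum condition puts all these momenta into `-V₊`. If `σ = ±1` satisfies `0 ≤ σ κe`, then `σ θ₁`
maps `-V₊` into the closed wedge `|x₀| ≤ x₁` (`act_thetaRef_mem_closedWedge`).

Separated wedges force `θ' = -θ`. Let `Λ`, `Λ'` represent `θ`, `θ'` and put `M = Λ⁻¹ Λ'`. Rescaling
the hypothesis gives `(ℓ - M ℓ')² ≤ 0` for all `ℓ`, `ℓ'` in the closed standard wedge. Applied to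
the two lightlike boundary directions, this shows that `M` exchanges them up to negative factors
(`exists_lightlike_of_spacelike`), hence `M θ₁ Mᵀ = -θ₁`. Moreover `x₁ - x₂` lies in the closed
wedge of `θ` for `x₁`, `x₂` in the two supports.

For opposite parameters the exchange of the two fields preserves the phases (`swapCLM_moyalTensor`),
so both orders of the product involve the same displacements. With `Q` the momentum of the original
vector and `R` that of the final one, the supports are separated by `x₁ - x₂ + π θ (R + Q)`, which
stays in the closed wedge. A small translation of `f₁` moves it into the open wedge with a margin
(`stablySpacelike_translate`), the undeformed bracket then vanishes, and continuity removes the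
translation.

To give this meaning for smeared momenta, the phases are replaced by kernels in two variables, and
these by products `û(p) b(R)` with small supports (`twist`, `clm_moyalKernel_eq_zero`). Each factor
`b(R)` becomes a function of the translation generators (`Psi_momentumCut`), which vanishes off the
spectrum. The same reduction to products shows that the deformed fields are well defined: a linear
relation among the vectors `Ψ(gᵢ)` is preserved by functions of the total momentum and, through
adjoints, by undeformed fields, hence by all kernels.

The analytic tool is a Gabor frame: every Schwartz function is a sum of modulated bumps with rapidly
decreasing coefficients (`hasSum_frame`), and the frame functions of several points are products.
Together with a Baire category argument this yields the kernel theorem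
(`SeparatelyContinuous.exists_kernel`), and hence `Ψⁿ_k`. It also yields density of products, the
approximation by small supports, and the exchange of continuous linear maps with integrals. -/

theorem continuous_schwartz_seminorm (k n : ℕ) :
    Continuous (SchwartzMap.seminorm ℝ k n : 𝓢(E, F) → ℝ) :=
  (schwartz_withSeminorms ℝ E F).continuous_seminorm (k, n)

theorem norm_iteratedFDeriv_sub_le (f g : 𝓢(E, F)) (k n : ℕ) (x : E) :
    ‖x‖ ^ k * ‖iteratedFDeriv ℝ n f x - iteratedFDeriv ℝ n g x‖ ≤
      SchwartzMap.seminorm ℝ k n (f - g) := by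
  have h := SchwartzMap.le_seminorm ℝ k n (f - g) x
  have h2 : iteratedFDeriv ℝ n (f - g : 𝓢(E, F)) x =
      iteratedFDeriv ℝ n f x - iteratedFDeriv ℝ n g x := by
    have : ((f - g : 𝓢(E, F)) : E → F) = (f : E → F) - g := rfl
    rw [this, iteratedFDeriv_sub ((f.smooth n)) ((g.smooth n))]
    rfl
  rwa [h2] at h

theorem tendsto_schwartz_iff {ι : Type*} {l : Filter ι} {u : ι → 𝓢(E, F)} {f : 𝓢(E, F)} :
    Tendsto u l (𝓝 f) ↔ ∀ k n : ℕ, Tendsto (fun i => SchwartzMap.seminorm ℝ k n (u i - f)) l (𝓝 0) := by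
  rw [(schwartz_withSeminorms ℝ E F).tendsto_nhds]
  simp only [Prod.forall, Metric.tendsto_nhds, Real.dist_eq, sub_zero]
  refine forall_congr' fun k => forall_congr' fun n => forall_congr' fun ε =>
    forall_congr' fun _ => ?_
  refine eventually_congr (Eventually.of_forall fun i => ?_)
  rw [abs_of_nonneg (apply_nonneg _ _)]
  rfl

theorem cauchySeq_seminorm {u : ℕ → 𝓢(E, F)} (hu : CauchySeq u) (k n : ℕ) {ε : ℝ} (hε : 0 < ε) :
    ∃ N, ∀ i ≥ N, ∀ j ≥ N, SchwartzMap.seminorm ℝ k n (u i - u j) < ε := by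
  have h : {p : 𝓢(E, F) × 𝓢(E, F) | SchwartzMap.seminorm ℝ k n (p.1 - p.2) < ε} ∈
      uniformity 𝓢(E, F) := by
    rw [uniformity_eq_comap_nhds_zero_swapped]
    refine ⟨{f | SchwartzMap.seminorm ℝ k n f < ε}, ?_, fun p hp => hp⟩
    refine (isOpen_lt (continuous_schwartz_seminorm k n) continuous_const).mem_nhds ?_
    simpa using hε
  obtain ⟨N, hN⟩ := (cauchySeq_iff.1 hu) _ h
  exact ⟨N, fun i hi j hj => hN i hi j hj⟩

/-- Derivatives of every order converge uniformly, also with polynomial weights. The limits `P n`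
form a Taylor series of infinite order, so they are the derivatives of a single Schwartz function.
Completeness supports both the Baire arguments and the convergence of frame expansions. -/
instance instCompleteSpaceSchwartz [CompleteSpace F] : CompleteSpace 𝓢(E, F) := by
  have : (uniformity 𝓢(E, F)).IsCountablyGenerated :=
    IsUniformAddGroup.uniformity_countably_generated
  refine UniformSpace.complete_of_cauchySeq_tendsto fun u hu => ?_
  have hc : ∀ n x, CauchySeq fun i => iteratedFDeriv ℝ n (u i) x := by
    intro n x
    refine Metric.cauchySeq_iff.2 fun ε hε => ?_
    obtain ⟨N, hN⟩ := cauchySeq_seminorm hu 0 n hε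
    refine ⟨N, fun i hi j hj => ?_⟩
    have := norm_iteratedFDeriv_sub_le (u i) (u j) 0 n x
    rw [dist_eq_norm]
    simpa using this.trans_lt (hN i hi j hj)
  choose P hP using fun n x => cauchySeq_tendsto_of_complete (hc n x)
  have hdist : ∀ k n : ℕ, ∀ ε > 0, ∃ N, ∀ i ≥ N, ∀ x,
      ‖x‖ ^ k * ‖iteratedFDeriv ℝ n (u i) x - P n x‖ ≤ ε := by
    intro k n ε hε
    obtain ⟨N, hN⟩ := cauchySeq_seminorm hu k n hε
    refine ⟨N, fun i hi x => ?_⟩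
    have h1 : Tendsto (fun j => ‖x‖ ^ k * ‖iteratedFDeriv ℝ n (u i) x - iteratedFDeriv ℝ n (u j) x‖)
        atTop (𝓝 (‖x‖ ^ k * ‖iteratedFDeriv ℝ n (u i) x - P n x‖)) :=
      ((tendsto_const_nhds.sub (hP n x)).norm).const_mul _
    refine le_of_tendsto h1 ?_
    filter_upwards [eventually_ge_atTop N] with j hj
    exact (norm_iteratedFDeriv_sub_le (u i) (u j) k n x).trans (hN i hi j hj).le
  have hunif : ∀ n, TendstoUniformly (fun i x => iteratedFDeriv ℝ n (u i) x) (P n) atTop := by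
    intro n
    refine Metric.tendstoUniformly_iff.2 fun ε hε => ?_
    obtain ⟨N, hN⟩ := hdist 0 n (ε / 2) (by positivity)
    filter_upwards [eventually_ge_atTop N] with i hi x
    rw [dist_comm, dist_eq_norm]
    have := hN i hi x
    simp only [pow_zero, one_mul] at this
    linarith
  have hcont : ∀ n, Continuous (P n) := fun n =>
    (hunif n).continuous (Frequently.of_forall fun i => ((u i).smooth n).continuous_iteratedFDeriv
      le_rfl)
  have hT : HasFTaylorSeriesUpTo (𝕜 := ℝ) ((⊤ : ℕ∞) : WithTop ℕ∞) (fun x => (P 0 x).curry0)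
      (fun x n => P n x) := by
    refine ⟨fun x => rfl, fun n _ x => ?_, fun n _ => hcont n⟩
    refine hasFDerivAt_of_tendstoUniformly (l := atTop)
      (f := fun i x => iteratedFDeriv ℝ n (u i) x)
      (f' := fun i x => (iteratedFDeriv ℝ (n + 1) (u i) x).curryLeft)
      (g' := fun x => (P (n + 1) x).curryLeft) ?_ ?_ (fun x => hP n x) x
    · have := (continuousMultilinearCurryLeftEquiv ℝ (fun _ : Fin (n + 1) => E)
        F).isometry.uniformContinuous.comp_tendstoUniformly (hunif (n + 1))
      exact this
    · intro i x
      exact (contDiff_iff_ftaylorSeries.1 ((u i).smooth ⊤)).fderiv n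
        (by exact_mod_cast ENat.natCast_lt_top n) x
  have hiter : ∀ n x, iteratedFDeriv ℝ n (fun x => (P 0 x).curry0) x = P n x := fun n x =>
    (hT.eq_iteratedFDeriv (by exact_mod_cast le_top) x).symm
  refine ⟨⟨fun x => (P 0 x).curry0, hT.contDiff, fun k n => ?_⟩, ?_⟩
  · obtain ⟨N, hN⟩ := hdist k n 1 one_pos
    refine ⟨SchwartzMap.seminorm ℝ k n (u N) + 1, fun x => ?_⟩
    rw [hiter]
    have h1 := hN N le_rfl x
    have h2 := SchwartzMap.le_seminorm ℝ k n (u N) x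
    have h3 : ‖P n x‖ ≤ ‖iteratedFDeriv ℝ n (u N) x‖ + ‖iteratedFDeriv ℝ n (u N) x - P n x‖ := by
      have := norm_sub_le (iteratedFDeriv ℝ n (u N) x) (iteratedFDeriv ℝ n (u N) x - P n x)
      simpa using this
    calc ‖x‖ ^ k * ‖P n x‖ ≤ ‖x‖ ^ k * (‖iteratedFDeriv ℝ n (u N) x‖ +
          ‖iteratedFDeriv ℝ n (u N) x - P n x‖) := by gcongr
      _ ≤ _ := by rw [mul_add]; linarith
  · refine tendsto_schwartz_iff.2 fun k n => ?_
    refine Metric.tendsto_atTop.2 fun ε hε => ?_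
    obtain ⟨N, hN⟩ := hdist k n (ε / 2) (by positivity)
    refine ⟨N, fun i hi => ?_⟩
    rw [Real.dist_eq, sub_zero, abs_of_nonneg (apply_nonneg _ _)]
    refine (SchwartzMap.seminorm_le_bound ℝ k n _ (by positivity : 0 ≤ ε / 2) fun x => ?_).trans_lt
      (half_lt_self hε)
    refine le_of_eq_of_le ?_ (hN i hi x)
    rw [← hiter n x]
    congr 2
    rw [← Pi.sub_apply, ← iteratedFDeriv_sub ((u i).smooth n)
      (hT.contDiff.of_le (by exact_mod_cast le_top))]
    rfl

instance instBaireSpaceSchwartz [CompleteSpace F] : BaireSpace 𝓢(E, F) := by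
  have : (uniformity 𝓢(E, F)).IsCountablyGenerated :=
    IsUniformAddGroup.uniformity_countably_generated
  infer_instance

theorem summable_schwartz [CompleteSpace F] {ι : Type*} {u : ι → 𝓢(E, F)}
    (h : ∀ k n : ℕ, Summable fun i => SchwartzMap.seminorm ℝ k n (u i)) : Summable u := by
  refine summable_iff_vanishing.2 fun e he => ?_
  obtain ⟨⟨s, r⟩, hr, hs⟩ := (schwartz_withSeminorms ℝ E F).hasBasis_ball.mem_iff.1 he
  simp only at hr hs
  have hsum : Summable fun i => (s.sup (schwartzSeminormFamily ℝ E F)) (u i) := by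
    refine Summable.of_nonneg_of_le (fun i => apply_nonneg _ _) (fun i => ?_)
      (summable_sum (s := s) fun m _ => h m.1 m.2)
    refine (Seminorm.finset_sup_le_sum _ s (u i)).trans (le_of_eq ?_)
    simp only [FunLike.coe_sum, Finset.sum_apply]
    rfl
  obtain ⟨t, ht⟩ := summable_iff_vanishing.1 hsum (Metric.ball 0 r) (Metric.ball_mem_nhds _ hr)
  refine ⟨t, fun t' ht' => hs ?_⟩
  rw [Seminorm.mem_ball_zero]
  have h1 := ht t' ht'
  rw [mem_ball_zero_iff, Real.norm_eq_abs] at h1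
  refine lt_of_le_of_lt ?_ ((le_abs_self _).trans_lt h1)
  exact Finset.le_sum_of_subadditive _ (map_zero _).le (map_add_le_add _) _ _

end Complete

/-! ### Operations on Schwartz functions -/

section Operations

variable {E E₁ E₂ : Type*} [NormedAddCommGroup E] [NormedSpace ℝ E] [NormedAddCommGroup E₁]
  [NormedSpace ℝ E₁] [NormedAddCommGroup E₂] [NormedSpace ℝ E₂]

/-- The linear maps `A` and `B` control the norm, so that `f (A x) * g (B x)` is a Schwartz function
of `x` whenever `f` and `g` are. -/
def Controls (A : E →L[ℝ] E₁) (B : E →L[ℝ] E₂) : Prop :=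
  ∃ C : ℝ, ∀ x, ‖x‖ ≤ C * ((1 + ‖A x‖) * (1 + ‖B x‖))

theorem Controls.symm {A : E →L[ℝ] E₁} {B : E →L[ℝ] E₂} (h : Controls A B) : Controls B A := by
  obtain ⟨C, hC⟩ := h
  exact ⟨C, fun x => by rw [mul_comm (1 + ‖B x‖)]; exact hC x⟩

/-- The map `f ↦ (x ↦ f (A x) * g (B x))`. -/
def mulCompCLM (A : E →L[ℝ] E₁) (B : E →L[ℝ] E₂) (h : Controls A B) (g : 𝓢(E₂, ℂ)) :
    𝓢(E₁, ℂ) →L[ℂ] 𝓢(E, ℂ) :=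
  SchwartzMap.mkCLM (fun f x => f (A x) * g (B x))
    (fun f₁ f₂ x => by simp [add_mul]) (fun c f x => by simp [mul_assoc])
    (fun f => ((f.smooth ⊤).comp A.contDiff).mul ((g.smooth ⊤).comp B.contDiff)) (by
      rintro ⟨k, N⟩
      obtain ⟨C, hC⟩ := h
      set R : ℝ := 2 ^ k * ((Finset.Iic (k, N)).sup fun m => SchwartzMap.seminorm ℂ m.1 m.2) g
      have hC0 : 0 ≤ C := by
        have := hC 0
        simp only [norm_zero, map_zero, add_zero, mul_one] at this
        exact this
      have hR : 0 ≤ R := by positivity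
      refine ⟨Finset.Iic (k, N), C ^ k * ∑ i ∈ Finset.range (N + 1),
        (N.choose i : ℝ) * (2 ^ k * ‖A‖ ^ i) * (R * ‖B‖ ^ (N - i)), by positivity, fun f x => ?_⟩
      set S : ℝ := (Finset.Iic (k, N)).sup (schwartzSeminormFamily ℂ E₁ ℂ) f
      have hmul := norm_iteratedFDeriv_mul_le (𝕜 := ℝ) (N := ((⊤ : ℕ∞) : WithTop ℕ∞))
        (f := fun x => f (A x)) (g := fun x => g (B x))
        ((f.smooth ⊤).comp A.contDiff) ((g.smooth ⊤).comp B.contDiff) x (n := N)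
        (by exact_mod_cast le_top)
      have hx : ‖x‖ ^ k ≤ C ^ k * ((1 + ‖A x‖) ^ k * (1 + ‖B x‖) ^ k) := by
        rw [← mul_pow, ← mul_pow]
        exact pow_le_pow_left₀ (norm_nonneg _) (hC x) k
      refine (mul_le_mul hx hmul (norm_nonneg _) (by positivity)).trans ?_
      rw [mul_assoc (C ^ k), mul_assoc (C ^ k)]
      refine mul_le_mul_of_nonneg_left ?_ (pow_nonneg hC0 k)
      rw [Finset.mul_sum, Finset.sum_mul]
      refine Finset.sum_le_sum fun i hi => ?_
      have hi' : i ≤ N := Nat.lt_succ_iff.mp (Finset.mem_range.mp hi)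
      have h1 := norm_iteratedFDeriv_comp_clm_le A f i x
      have h2 := norm_iteratedFDeriv_comp_clm_le B g (N - i) x
      have h3 := SchwartzMap.one_add_le_sup_seminorm_apply (𝕜 := ℂ) (m := (k, N)) (k := k) (n := i)
        le_rfl hi' f (A x)
      have h4 := SchwartzMap.one_add_le_sup_seminorm_apply (𝕜 := ℂ) (m := (k, N)) (k := k)
        (n := N - i) le_rfl (Nat.sub_le _ _) g (B x)
      calc (1 + ‖A x‖) ^ k * (1 + ‖B x‖) ^ k *
            ((N.choose i : ℝ) * ‖iteratedFDeriv ℝ i (fun y => f (A y)) x‖ *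
              ‖iteratedFDeriv ℝ (N - i) (fun y => g (B y)) x‖)
          ≤ (1 + ‖A x‖) ^ k * (1 + ‖B x‖) ^ k *
            ((N.choose i : ℝ) * (‖iteratedFDeriv ℝ i f (A x)‖ * ‖A‖ ^ i) *
              (‖iteratedFDeriv ℝ (N - i) g (B x)‖ * ‖B‖ ^ (N - i))) := by gcongr
        _ = (N.choose i : ℝ) *
            (((1 + ‖A x‖) ^ k * ‖iteratedFDeriv ℝ i f (A x)‖) * ‖A‖ ^ i) *
            (((1 + ‖B x‖) ^ k * ‖iteratedFDeriv ℝ (N - i) g (B x)‖) * ‖B‖ ^ (N - i)) := by ring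
        _ ≤ (N.choose i : ℝ) * ((2 ^ k * S) * ‖A‖ ^ i) * (R * ‖B‖ ^ (N - i)) := by
            have hS : 0 ≤ S := apply_nonneg _ _
            have h3' : (1 + ‖A x‖) ^ k * ‖iteratedFDeriv ℝ i f (A x)‖ ≤ 2 ^ k * S := h3
            have h4' : (1 + ‖B x‖) ^ k * ‖iteratedFDeriv ℝ (N - i) g (B x)‖ ≤ R := h4
            refine mul_le_mul ?_ (mul_le_mul_of_nonneg_right h4' (by positivity)) (by positivity)
              (by positivity)
            exact mul_le_mul_of_nonneg_left (mul_le_mul_of_nonneg_right h3' (by positivity))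
              (by positivity)
        _ = _ := by ring)

@[simp]
theorem mulCompCLM_apply (A : E →L[ℝ] E₁) (B : E →L[ℝ] E₂) (h : Controls A B) (g : 𝓢(E₂, ℂ))
    (f : 𝓢(E₁, ℂ)) (x : E) : mulCompCLM A B h g f x = f (A x) * g (B x) := rfl

theorem mulCompCLM_symm (A : E →L[ℝ] E₁) (B : E →L[ℝ] E₂) (h : Controls A B) (g : 𝓢(E₂, ℂ))
    (f : 𝓢(E₁, ℂ)) : mulCompCLM A B h g f = mulCompCLM B A h.symm f g := by
  ext x
  simp [mul_comm]

/-- A function that is smooth with bounded derivatives of all orders. -/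
structure BoundedDerivs (χ : E → ℂ) : Prop where
  contDiff : ContDiff ℝ ((⊤ : ℕ∞) : WithTop ℕ∞) χ
  bound : ∀ i : ℕ, ∃ C : ℝ, ∀ x, ‖iteratedFDeriv ℝ i χ x‖ ≤ C

theorem BoundedDerivs.hasTemperateGrowth {χ : E → ℂ} (h : BoundedDerivs χ) :
    χ.HasTemperateGrowth := by
  refine ⟨h.contDiff, fun n => ?_⟩
  obtain ⟨C, hC⟩ := h.bound n
  exact ⟨0, C, fun x => by simpa using hC x⟩

theorem boundedDerivs_schwartz (f : 𝓢(E, ℂ)) : BoundedDerivs (f : E → ℂ) :=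
  ⟨f.smooth ⊤, fun i => ⟨_, fun x => SchwartzMap.norm_iteratedFDeriv_le_seminorm ℝ f i x⟩⟩

theorem boundedDerivs_exp : BoundedDerivs fun t : ℝ => Complex.exp (t * Complex.I) := by
  have hd : ∀ n : ℕ, iteratedDeriv n (fun t : ℝ => Complex.exp (t * Complex.I)) =
      fun t : ℝ => Complex.I ^ n * Complex.exp (t * Complex.I) := by
    intro n
    induction n with
    | zero => simp
    | succ n ih =>
      rw [iteratedDeriv_succ, ih]
      funext t
      have h0 : HasDerivAt (fun t : ℝ => (t : ℂ) * Complex.I) Complex.I t := by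
        simpa using (Complex.ofRealCLM.hasDerivAt (x := t)).mul_const Complex.I
      rw [((h0.cexp).const_mul (Complex.I ^ n)).deriv]
      ring
  refine ⟨hasTemperateGrowth_exp_mul_I.1, fun n => ⟨1, fun x => ?_⟩⟩
  rw [norm_iteratedFDeriv_eq_norm_iteratedDeriv, hd]
  simp [Complex.norm_exp]

theorem BoundedDerivs.hasTemperateGrowth_comp {χ : E₁ → ℂ} (hχ : BoundedDerivs χ)
    (A : E →L[ℝ] E₁) (ε : ℝ) : (fun x => χ (ε • A x)).HasTemperateGrowth :=
  hχ.hasTemperateGrowth.comp (ε • A).hasTemperateGrowth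

/-- `χ (ε A x) f(x) → f(x)` in Schwartz space as `ε → 0`, if `χ 0 = 1`. -/
theorem tendsto_smulLeft_dilate {χ : E₁ → ℂ} (hχ : BoundedDerivs χ) (h1 : χ 0 = 1)
    (A : E →L[ℝ] E₁) (f : 𝓢(E, ℂ)) :
    Tendsto (fun ε : ℝ => SchwartzMap.smulLeftCLM ℂ (fun x => χ (ε • A x)) f) (𝓝 0) (𝓝 f) := by
  -- The factor `|ε|` comes from the mean value inequality for `i = 0` and from `|ε| ^ i ≤ |ε|` in
  -- the chain rule otherwise. The price is a factor `1 + ‖x‖`, which is why the seminorms of order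
  -- `k + 1` enter below.
  have key : ∀ i : ℕ, ∃ C : ℝ, 0 ≤ C ∧ ∀ ε : ℝ, |ε| ≤ 1 → ∀ x,
      ‖iteratedFDeriv ℝ i (fun x => χ (ε • A x) - 1) x‖ ≤ |ε| * C * (1 + ‖x‖) := by
    intro i
    obtain ⟨C₁, hC₁⟩ := hχ.bound 1
    obtain ⟨C, hC⟩ := hχ.bound i
    have hC₁0 : 0 ≤ C₁ := (norm_nonneg _).trans (hC₁ 0)
    have hC0 : 0 ≤ C := (norm_nonneg _).trans (hC 0)
    refine ⟨C₁ * ‖A‖ + C * (1 + ‖A‖) ^ i, by positivity, fun ε hε x => ?_⟩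
    rcases Nat.eq_zero_or_pos i with rfl | hi
    · rw [norm_iteratedFDeriv_zero]
      have h2 : ‖χ (ε • A x) - χ 0‖ ≤ C₁ * ‖ε • A x - 0‖ :=
        Convex.norm_image_sub_le_of_norm_fderiv_le (𝕜 := ℝ) (s := Set.univ)
          (fun y _ => (hχ.contDiff.differentiable (by simp)) y)
          (fun y _ => by simpa [norm_iteratedFDeriv_one] using hC₁ y) convex_univ
          (Set.mem_univ _) (Set.mem_univ _)
      rw [h1, sub_zero, norm_smul, Real.norm_eq_abs] at h2
      refine h2.trans ?_
      have h3 := A.le_opNorm x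
      calc C₁ * (|ε| * ‖A x‖) ≤ C₁ * (|ε| * (‖A‖ * ‖x‖)) := by gcongr
        _ = |ε| * (C₁ * ‖A‖) * ‖x‖ := by ring
        _ ≤ |ε| * (C₁ * ‖A‖ + C * (1 + ‖A‖) ^ 0) * (1 + ‖x‖) := by
            gcongr
            · linarith [mul_nonneg hC0 (pow_nonneg (by positivity : 0 ≤ 1 + ‖A‖) 0)]
            · linarith
    · have h2 : (fun x => χ (ε • A x) - 1) = fun x => (χ ∘ (ε • A)) x + (-1 : ℂ) := by
        funext x; simp [sub_eq_add_neg]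
      have h3 : iteratedFDeriv ℝ i (fun x => χ (ε • A x) - 1) x =
          iteratedFDeriv ℝ i (χ ∘ (ε • A)) x := by
        rw [h2]
        rw [fun_iteratedFDeriv_add_apply
          ((hχ.contDiff.comp (ε • A).contDiff).of_le (by exact_mod_cast le_top)).contDiffAt
          contDiff_const.contDiffAt, iteratedFDeriv_const_of_ne hi.ne']
        simp
      rw [h3, (ε • A).iteratedFDeriv_comp_right hχ.contDiff x (by exact_mod_cast le_top)]
      refine (ContinuousMultilinearMap.norm_compContinuousLinearMap_le _ _).trans ?_
      have h4 : ‖ε • A‖ ^ i ≤ |ε| * (1 + ‖A‖) ^ i := by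
        rw [norm_smul, mul_pow, Real.norm_eq_abs]
        have : |ε| ^ i ≤ |ε| := pow_le_of_le_one (abs_nonneg _) hε hi.ne'
        have : ‖A‖ ^ i ≤ (1 + ‖A‖) ^ i := pow_le_pow_left₀ (norm_nonneg _) (by simp) i
        gcongr
      simp only [Finset.prod_const, Finset.card_univ, Fintype.card_fin]
      calc _ ≤ C * (|ε| * (1 + ‖A‖) ^ i) := by gcongr; exact hC _
        _ = |ε| * (C * (1 + ‖A‖) ^ i) * 1 := by ring
        _ ≤ _ := by
          gcongr
          · linarith [mul_nonneg hC₁0 (norm_nonneg A)]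
          · linarith [norm_nonneg x]
  choose K hK0 hK using key
  refine tendsto_schwartz_iff.2 fun k n => ?_
  set S : ℝ := 2 ^ (k + 1) * ((Finset.Iic (k + 1, n)).sup fun m => SchwartzMap.seminorm ℝ m.1 m.2) f
  set M : ℝ := ∑ i ∈ Finset.range (n + 1), (n.choose i : ℝ) * K i * S
  have hS : 0 ≤ S := by positivity
  have hM : 0 ≤ M := Finset.sum_nonneg fun i _ => by have := hK0 i; positivity
  have hb : ∀ ε : ℝ, |ε| ≤ 1 → SchwartzMap.seminorm ℝ k n
      (SchwartzMap.smulLeftCLM ℂ (fun x => χ (ε • A x)) f - f) ≤ |ε| * M := by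
    intro ε hε
    refine SchwartzMap.seminorm_le_bound ℝ k n _ (by positivity) fun x => ?_
    have h2 : ((SchwartzMap.smulLeftCLM ℂ (fun x => χ (ε • A x)) f - f : 𝓢(E, ℂ)) : E → ℂ) =
        fun x => (χ (ε • A x) - 1) * f x := by
      funext x
      rw [sub_apply,
        SchwartzMap.smulLeftCLM_apply_apply (hχ.hasTemperateGrowth_comp A ε), smul_eq_mul]
      ring
    rw [h2]
    have hmul := norm_iteratedFDeriv_mul_le (𝕜 := ℝ) (N := ((⊤ : ℕ∞) : WithTop ℕ∞))
      (f := fun x => χ (ε • A x) - 1) (g := f)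
      ((hχ.contDiff.comp (ε • A).contDiff).sub contDiff_const) (f.smooth ⊤) x (n := n)
      (by exact_mod_cast le_top)
    refine (mul_le_mul_of_nonneg_left hmul (by positivity)).trans ?_
    rw [Finset.mul_sum, Finset.mul_sum]
    refine Finset.sum_le_sum fun i hi => ?_
    have h3 := SchwartzMap.one_add_le_sup_seminorm_apply (𝕜 := ℝ) (m := (k + 1, n)) (k := k + 1)
      (n := n - i) le_rfl (Nat.sub_le _ _) f x
    have h4 := hK i ε hε x
    have h5 := hK0 i
    calc ‖x‖ ^ k * ((n.choose i : ℝ) * ‖iteratedFDeriv ℝ i (fun x => χ (ε • A x) - 1) x‖ *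
          ‖iteratedFDeriv ℝ (n - i) f x‖)
        ≤ (1 + ‖x‖) ^ k * ((n.choose i : ℝ) * (|ε| * K i * (1 + ‖x‖)) *
          ‖iteratedFDeriv ℝ (n - i) f x‖) := by
          gcongr
          linarith
      _ = |ε| * ((n.choose i : ℝ) * K i * ((1 + ‖x‖) ^ (k + 1) *
          ‖iteratedFDeriv ℝ (n - i) f x‖)) := by ring
      _ ≤ _ := by gcongr
  have hlim : Tendsto (fun ε : ℝ => |ε| * M) (𝓝 0) (𝓝 0) := by
    have : Continuous fun ε : ℝ => |ε| * M := by fun_prop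
    simpa using this.tendsto 0
  refine squeeze_zero' (Eventually.of_forall fun ε => apply_nonneg _ _) ?_ hlim
  filter_upwards [Metric.ball_mem_nhds (0 : ℝ) one_pos] with ε hε
  refine hb ε ?_
  rw [mem_ball_zero_iff, Real.norm_eq_abs] at hε
  exact hε.le

end Operations

/-! ### Fourier series of functions supported in a cube -/

section Torus

variable {ι : Type*}

/-- The representative of a point of the torus in the cube with centre `z` and side `1`. -/
def cubeRep (z : ι → ℝ) (τ : UnitAddTorus ι) : EuclideanSpace ℝ ι :=
  WithLp.toLp 2 fun i => ((AddCircle.equivIoc 1 (z i - 1 / 2) (τ i) : Set.Ioc (z i - 1 / 2)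
    (z i - 1 / 2 + 1)) : ℝ)

theorem coe_cubeRep (z : ι → ℝ) (τ : UnitAddTorus ι) (i : ι) :
    ((cubeRep z τ i : ℝ) : UnitAddCircle) = τ i :=
  (AddCircle.equivIoc 1 (z i - 1 / 2)).symm_apply_apply (τ i)

theorem cubeRep_coe {z : ι → ℝ} {x : ι → ℝ}
    (hx : ∀ i, x i ∈ Set.Ioc (z i - 1 / 2) (z i - 1 / 2 + 1)) :
    cubeRep z (fun i => (x i : UnitAddCircle)) = WithLp.toLp 2 x := by
  ext i
  have := (AddCircle.equivIoc 1 (z i - 1 / 2)).apply_symm_apply ⟨x i, hx i⟩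
  exact congrArg Subtype.val this

/-- `cubeRep` jumps only at the faces of the unit cube. Near them `g` vanishes, since its support
lies in the concentric cube of half the side. -/
theorem continuous_comp_cubeRep [Fintype ι] {g : EuclideanSpace ℝ ι → ℂ} (hg : Continuous g) {z : ι → ℝ}
    (hz : ∀ x, g x ≠ 0 → ∀ i, |x i - z i| ≤ 1 / 4) : Continuous fun τ => g (cubeRep z τ) := by
  refine continuous_iff_continuousAt.2 fun τ => ?_
  by_cases hτ : ∀ i, τ i ≠ ((z i - 1 / 2 : ℝ) : UnitAddCircle)
  · refine ContinuousAt.comp hg.continuousAt ?_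
    refine ContinuousAt.comp (f := fun τ : UnitAddTorus ι => fun i =>
      ((AddCircle.equivIoc 1 (z i - 1 / 2) (τ i) : Set.Ioc (z i - 1 / 2) (z i - 1 / 2 + 1)) : ℝ))
      (PiLp.continuous_toLp 2 _).continuousAt ?_
    refine continuousAt_pi.2 fun i => ?_
    have h1 := AddCircle.continuousAt_equivIoc 1 (z i - 1 / 2) (hτ i)
    have h2 : ContinuousAt (fun τ : UnitAddTorus ι => AddCircle.equivIoc 1 (z i - 1 / 2) (τ i)) τ :=
      ContinuousAt.comp (f := fun τ : UnitAddTorus ι => τ i) h1 (continuous_apply i).continuousAt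
    exact continuous_subtype_val.continuousAt.comp h2
  · push Not at hτ
    obtain ⟨i, hi⟩ := hτ
    set K : Set UnitAddCircle := (fun t : ℝ => (t : UnitAddCircle)) '' Set.Icc (z i - 1 / 4)
      (z i + 1 / 4)
    have hK : IsClosed K := (isCompact_Icc.image (AddCircle.continuous_mk' 1)).isClosed
    have hmem : τ i ∉ K := by
      rintro ⟨t, ht, hteq⟩
      have h3 : t = z i - 1 / 2 := by
        have h4 := (AddCircle.coe_eq_coe_iff_of_mem_Ico (p := (1 : ℝ)) (a := z i - 1 / 2)
          (x := t) (y := z i - 1 / 2) ⟨by linarith [ht.1], by linarith [ht.2]⟩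
          ⟨le_rfl, by linarith⟩).1 (hteq.trans hi)
        exact h4
      linarith [ht.1]
    have hev : Continuous fun σ : UnitAddTorus ι => σ i := continuous_apply i
    have hopen : {σ : UnitAddTorus ι | σ i ∉ K} ∈ 𝓝 τ :=
      (hK.isOpen_compl.preimage hev).mem_nhds hmem
    refine ContinuousAt.congr (f := fun _ => (0 : ℂ)) continuousAt_const ?_
    filter_upwards [hopen] with σ hσ
    by_contra hne
    have h5 := hz _ (Ne.symm hne) i
    rw [abs_le] at h5
    exact hσ ⟨cubeRep z σ i, ⟨by linarith [h5.1], by linarith [h5.2]⟩, coe_cubeRep z σ i⟩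

/-- The integral over the torus is an integral over one unit cube, and this is the integral over the
whole space because `g` vanishes outside. -/
theorem mFourierCoeff_comp_cubeRep [Fintype ι] (g : 𝓢(EuclideanSpace ℝ ι, ℂ)) {z : ι → ℝ}
    (hz : ∀ x, g x ≠ 0 → ∀ i, |x i - z i| ≤ 1 / 4) (b : ι → ℤ) :
    UnitAddTorus.mFourierCoeff (fun τ => g (cubeRep z τ)) b =
      𝓕 g (WithLp.toLp 2 fun i => (b i : ℝ)) := by
  rw [UnitAddTorus.mFourierCoeff_eq_integral _ _ fun i => z i - 1 / 2]
  have hmeas : MeasurableSet {x : ι → ℝ | ∀ i, x i ∈ Set.Ioc (z i - 1 / 2) (z i - 1 / 2 + 1)} := by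
    have : {x : ι → ℝ | ∀ i, x i ∈ Set.Ioc (z i - 1 / 2) (z i - 1 / 2 + 1)} =
        Set.univ.pi fun i => Set.Ioc (z i - 1 / 2) (z i - 1 / 2 + 1) := by
      ext; simp [Set.mem_pi]
    rw [this]
    exact MeasurableSet.univ_pi fun i => measurableSet_Ioc
  have h1 : ∀ x ∈ {x : ι → ℝ | ∀ i, x i ∈ Set.Ioc (z i - 1 / 2) (z i - 1 / 2 + 1)},
      UnitAddTorus.mFourier (-b) (fun i => (x i : UnitAddCircle)) •
        g (cubeRep z fun i => (x i : UnitAddCircle)) =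
      (fun v : EuclideanSpace ℝ ι => Complex.exp (((-2 * Real.pi *
        inner ℝ v (WithLp.toLp 2 fun i => (b i : ℝ) : EuclideanSpace ℝ ι) : ℝ) : ℂ) * Complex.I) •
          g v) (WithLp.toLp 2 x) := by
    intro x hx
    rw [cubeRep_coe hx]
    simp only
    congr 1
    simp only [UnitAddTorus.mFourier, ContinuousMap.coe_mk, fourier_coe_apply, Pi.neg_apply,
      PiLp.inner_apply]
    rw [← Complex.exp_sum]
    congr 1
    push_cast
    rw [Finset.mul_sum, Finset.sum_mul]
    refine Finset.sum_congr rfl fun i _ => ?_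
    simp
    ring
  refine (setIntegral_congr_fun hmeas h1).trans ?_
  rw [setIntegral_eq_integral_of_forall_compl_eq_zero, SchwartzMap.fourier_coe, Real.fourier_eq']
  · exact (PiLp.volume_preserving_toLp ι).integral_comp
      (MeasurableEquiv.toLp 2 (ι → ℝ)).measurableEmbedding
      fun v : EuclideanSpace ℝ ι => Complex.exp (((-2 * Real.pi *
        inner ℝ v (WithLp.toLp 2 fun i => (b i : ℝ) : EuclideanSpace ℝ ι) : ℝ) : ℂ) * Complex.I) •
          g v
  · intro x hx
    have : g (WithLp.toLp 2 x) = 0 := by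
      by_contra hne
      refine hx fun i => ?_
      have h5 := hz _ hne i
      simp only [abs_le] at h5
      exact ⟨by linarith [h5.1], by linarith [h5.2]⟩
    simp [this]

/-- The periodic extension agrees with `g` on the whole open unit cube, not just near the support of
`g`. This leaves room for a plateau function that is `1` on the support and removes the other
periods. -/
theorem hasSum_fourier_of_supported_cube [Fintype ι] (g : 𝓢(EuclideanSpace ℝ ι, ℂ)) {z : ι → ℝ}
    (hz : ∀ x, g x ≠ 0 → ∀ i, |x i - z i| ≤ 1 / 4)
    (hs : Summable fun b : ι → ℤ => 𝓕 g (WithLp.toLp 2 fun i => (b i : ℝ)))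
    {x : EuclideanSpace ℝ ι} (hx : ∀ i, |x i - z i| < 1 / 2) :
    HasSum (fun b : ι → ℤ => 𝓕 g (WithLp.toLp 2 fun i => (b i : ℝ)) *
      Complex.exp (((2 * Real.pi * ∑ i, b i * x i : ℝ) : ℂ) * Complex.I)) (g x) := by
  let G : C(UnitAddTorus ι, ℂ) := ⟨_, continuous_comp_cubeRep g.continuous hz⟩
  have hc : ∀ b, UnitAddTorus.mFourierCoeff G b = 𝓕 g (WithLp.toLp 2 fun i => (b i : ℝ)) :=
    mFourierCoeff_comp_cubeRep g hz
  have h := UnitAddTorus.hasSum_mFourier_series_apply_of_summable (f := G)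
    (by simpa only [← hc] using hs) (fun i => (x i : UnitAddCircle))
  have hGx : G (fun i => (x i : UnitAddCircle)) = g x := by
    change g (cubeRep z _) = g x
    rw [cubeRep_coe (x := fun i => x i)]
    intro i
    have := abs_lt.1 (hx i)
    exact ⟨by linarith [this.1], by linarith [this.2]⟩
  rw [hGx] at h
  convert h using 2 with b
  rw [hc, smul_eq_mul]
  congr 1
  simp only [UnitAddTorus.mFourier, ContinuousMap.coe_mk, fourier_coe_apply]
  rw [← Complex.exp_sum]
  congr 1
  push_cast
  rw [Finset.mul_sum, Finset.sum_mul]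
  refine Finset.sum_congr rfl fun i _ => ?_
  simp
  ring

end Torus

/-! ### An increasing family of Schwartz norms -/

section SchwartzNorm

variable {E : Type*} [NormedAddCommGroup E] [NormedSpace ℝ E]

/-- The supremum of the Schwartz seminorms of order at most `N`. -/
def schwartzNorm (N : ℕ) : Seminorm ℂ 𝓢(E, ℂ) :=
  (Finset.Iic (N, N)).sup (schwartzSeminormFamily ℂ E ℂ)

theorem seminorm_le_schwartzNorm {k n N : ℕ} (hk : k ≤ N) (hn : n ≤ N) (f : 𝓢(E, ℂ)) :
    SchwartzMap.seminorm ℝ k n f ≤ schwartzNorm N f :=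
  Seminorm.le_def.1 (Finset.le_sup (f := schwartzSeminormFamily ℂ E ℂ)
    (Finset.mem_Iic.2 (Prod.mk_le_mk.2 ⟨hk, hn⟩))) f

theorem schwartzNorm_mono {N M : ℕ} (h : N ≤ M) (f : 𝓢(E, ℂ)) :
    schwartzNorm N f ≤ schwartzNorm M f :=
  Seminorm.le_def.1 (Finset.sup_mono (Finset.Iic_subset_Iic.2 (Prod.mk_le_mk.2 ⟨h, h⟩))) f

theorem schwartzNorm_le {N : ℕ} {f : 𝓢(E, ℂ)} {M : ℝ} (hM : 0 ≤ M)
    (h : ∀ k ≤ N, ∀ n ≤ N, ∀ x, ‖x‖ ^ k * ‖iteratedFDeriv ℝ n f x‖ ≤ M) :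
    schwartzNorm N f ≤ M := by
  refine Seminorm.finset_sup_apply_le hM fun m hm => ?_
  rw [Finset.mem_Iic, Prod.le_def] at hm
  exact SchwartzMap.seminorm_le_bound ℂ m.1 m.2 f hM (h m.1 hm.1 m.2 hm.2)

theorem one_add_pow_mul_le_schwartzNorm {k n N : ℕ} (hk : k ≤ N) (hn : n ≤ N) (f : 𝓢(E, ℂ))
    (x : E) : (1 + ‖x‖) ^ k * ‖iteratedFDeriv ℝ n f x‖ ≤ 2 ^ N * schwartzNorm N f :=
  SchwartzMap.one_add_le_sup_seminorm_apply (𝕜 := ℂ) (m := (N, N)) hk hn f x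

theorem continuous_schwartzNorm (N : ℕ) : Continuous (schwartzNorm N : 𝓢(E, ℂ) → ℝ) := by
  refine Seminorm.continuous_of_le (q := ∑ m ∈ Finset.Iic (N, N), schwartzSeminormFamily ℂ E ℂ m) ?_
    (Seminorm.finset_sup_le_sum _ _)
  rw [FunLike.coe_sum, Finset.sum_fn]
  exact continuous_finsetSum _ fun m _ => (schwartz_withSeminorms ℂ E ℂ).continuous_seminorm m

theorem exists_le_schwartzNorm (q : Seminorm ℂ 𝓢(E, ℂ)) (hq : Continuous q) :
    ∃ (N : ℕ) (C : ℝ), 0 ≤ C ∧ ∀ f, q f ≤ C * schwartzNorm N f := by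
  obtain ⟨s, C, -, hC⟩ := Seminorm.bound_of_continuous (schwartz_withSeminorms ℂ E ℂ) q hq
  refine ⟨s.sup fun m => m.1 ⊔ m.2, C, C.2, fun f => (hC f).trans ?_⟩
  have h1 : s ⊆ Finset.Iic (s.sup (fun m => m.1 ⊔ m.2), s.sup fun m => m.1 ⊔ m.2) := by
    intro m hm
    have := Finset.le_sup (f := fun m : ℕ × ℕ => m.1 ⊔ m.2) hm
    rw [Finset.mem_Iic]
    exact ⟨le_sup_left.trans this, le_sup_right.trans this⟩
  have h2 : s.sup (schwartzSeminormFamily ℂ E ℂ) f ≤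
    schwartzNorm (s.sup fun m => m.1 ⊔ m.2) f := Seminorm.le_def.1 (Finset.sup_mono h1) f
  exact mul_le_mul_of_nonneg_left h2 C.2

theorem exists_schwartzNorm_clm_le {E' : Type*} [NormedAddCommGroup E'] [NormedSpace ℝ E']
    (T : 𝓢(E, ℂ) →L[ℂ] 𝓢(E', ℂ)) (N : ℕ) :
    ∃ (M : ℕ) (C : ℝ), 0 ≤ C ∧ ∀ f, schwartzNorm N (T f) ≤ C * schwartzNorm M f :=
  exists_le_schwartzNorm ((schwartzNorm N).comp T.toLinearMap)
    ((continuous_schwartzNorm N).comp T.continuous)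

theorem exists_norm_clm_le {H : Type*} [NormedAddCommGroup H] [NormedSpace ℂ H]
    (T : 𝓢(E, ℂ) →L[ℂ] H) :
    ∃ (M : ℕ) (C : ℝ), 0 ≤ C ∧ ∀ f, ‖T f‖ ≤ C * schwartzNorm M f :=
  exists_le_schwartzNorm ((normSeminorm ℂ H).comp T.toLinearMap) (continuous_norm.comp T.continuous)

/-- A translation costs only a polynomial factor, because `‖x‖ ≤ (1 + ‖a‖) * (1 + ‖x - a‖)`. -/
theorem schwartzNorm_compSubConst_le (N : ℕ) (f : 𝓢(E, ℂ)) (a : E) :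
    schwartzNorm N (SchwartzMap.compSubConstCLM ℂ a f) ≤
      (1 + ‖a‖) ^ N * (2 ^ N * schwartzNorm N f) := by
  have hf : 0 ≤ schwartzNorm N f := apply_nonneg _ _
  refine schwartzNorm_le (by positivity) fun k hk n hn x => ?_
  have h1 : iteratedFDeriv ℝ n (SchwartzMap.compSubConstCLM ℂ a f) x =
      iteratedFDeriv ℝ n f (x - a) := by
    have : (SchwartzMap.compSubConstCLM ℂ a f : E → ℂ) = fun x => f (x - a) := by
      ext x; simp
    rw [this, iteratedFDeriv_comp_sub]
  rw [h1]
  have h2 := one_add_pow_mul_le_schwartzNorm hk hn f (x - a)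
  have h3 : ‖x‖ ≤ (1 + ‖a‖) * (1 + ‖x - a‖) := by
    have := norm_add_le (x - a) a
    rw [sub_add_cancel] at this
    nlinarith [norm_nonneg a, norm_nonneg (x - a)]
  have h4 : (1 + ‖a‖) ^ k ≤ (1 + ‖a‖) ^ N := pow_le_pow_right₀ (by simp) hk
  calc ‖x‖ ^ k * ‖iteratedFDeriv ℝ n f (x - a)‖
      ≤ ((1 + ‖a‖) * (1 + ‖x - a‖)) ^ k * ‖iteratedFDeriv ℝ n f (x - a)‖ := by gcongr
    _ = (1 + ‖a‖) ^ k * ((1 + ‖x - a‖) ^ k * ‖iteratedFDeriv ℝ n f (x - a)‖) := by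
        rw [mul_pow]; ring
    _ ≤ _ := by gcongr

theorem controls_id : Controls (ContinuousLinearMap.id ℝ E) (ContinuousLinearMap.id ℝ E) :=
  ⟨1, fun x => by simp only [ContinuousLinearMap.id_apply]; nlinarith [norm_nonneg x]⟩

/-- Multiplication by the Schwartz function `g`. -/
def mulCLM (g : 𝓢(E, ℂ)) : 𝓢(E, ℂ) →L[ℂ] 𝓢(E, ℂ) :=
  mulCompCLM (ContinuousLinearMap.id ℝ E) (ContinuousLinearMap.id ℝ E) controls_id g

@[simp]
theorem mulCLM_apply (g f : 𝓢(E, ℂ)) (x : E) : mulCLM g f x = f x * g x := rfl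

/-- Since `1 + ‖a‖ ≤ (1 + ‖x‖) * (1 + ‖x - a‖)`, decay in the position `a` of the window is bought
with `N` further powers of the weight on `f`, whence the order `2 * N`, and `N` powers on `ρ`. -/
theorem exists_schwartzNorm_mul_translate_le (ρ : 𝓢(E, ℂ)) (N : ℕ) :
    ∃ C : ℝ, 0 ≤ C ∧ ∀ (f : 𝓢(E, ℂ)) (a : E), (1 + ‖a‖) ^ N *
      schwartzNorm N (mulCLM (SchwartzMap.compSubConstCLM ℂ a ρ) f) ≤
        C * schwartzNorm (2 * N) f := by
  set R : ℝ := 2 ^ N * schwartzNorm N ρ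
  have hR : 0 ≤ R := by positivity
  refine ⟨2 ^ N * (2 ^ (2 * N) * R), by positivity, fun f a => ?_⟩
  have ha : 0 < (1 + ‖a‖) ^ N := by positivity
  have hf : 0 ≤ schwartzNorm (2 * N) f := apply_nonneg _ _
  rw [← le_div_iff₀' ha]
  refine schwartzNorm_le (by positivity) fun k hk n hn x => ?_
  rw [le_div_iff₀' ha]
  have hmul := norm_iteratedFDeriv_mul_le (𝕜 := ℝ) (N := ((⊤ : ℕ∞) : WithTop ℕ∞))
    (f := f) (g := fun x => ρ (x - a)) (f.smooth ⊤)
    ((ρ.smooth ⊤).comp (contDiff_id.sub contDiff_const)) x (n := n) (by exact_mod_cast le_top)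
  have h0 : (mulCLM (SchwartzMap.compSubConstCLM ℂ a ρ) f : E → ℂ) = fun x => f x * ρ (x - a) := by
    ext x; simp
  rw [h0]
  have h3 : 1 + ‖a‖ ≤ (1 + ‖x‖) * (1 + ‖x - a‖) := by
    have := norm_sub_le x (x - a)
    rw [sub_sub_cancel] at this
    nlinarith [norm_nonneg x, norm_nonneg (x - a)]
  have hterm : ∀ i ∈ Finset.range (n + 1), (1 + ‖a‖) ^ N * (‖x‖ ^ k * ((n.choose i : ℝ) *
      ‖iteratedFDeriv ℝ i f x‖ * ‖iteratedFDeriv ℝ (n - i) (fun x => ρ (x - a)) x‖)) ≤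
      (n.choose i : ℝ) * ((2 ^ (2 * N) * schwartzNorm (2 * N) f) * R) := by
    intro i hi
    have hi' : i ≤ n := Nat.lt_succ_iff.mp (Finset.mem_range.mp hi)
    rw [iteratedFDeriv_comp_sub]
    have h4 := one_add_pow_mul_le_schwartzNorm (N := 2 * N) (k := k + N) (n := i) (by omega)
      (by omega) f x
    have h5 := one_add_pow_mul_le_schwartzNorm (N := N) (k := N) (n := n - i) le_rfl
      (by omega) ρ (x - a)
    calc _ ≤ ((1 + ‖x‖) * (1 + ‖x - a‖)) ^ N * ((1 + ‖x‖) ^ k * ((n.choose i : ℝ) *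
          ‖iteratedFDeriv ℝ i f x‖ * ‖iteratedFDeriv ℝ (n - i) ρ (x - a)‖)) := by
          gcongr; linarith
      _ = (n.choose i : ℝ) * (((1 + ‖x‖) ^ (k + N) * ‖iteratedFDeriv ℝ i f x‖) *
          ((1 + ‖x - a‖) ^ N * ‖iteratedFDeriv ℝ (n - i) ρ (x - a)‖)) := by
          rw [mul_pow, pow_add]; ring
      _ ≤ _ := by
          refine mul_le_mul_of_nonneg_left (mul_le_mul h4 h5 (by positivity) (by positivity))
            (by positivity)
  calc _ ≤ (1 + ‖a‖) ^ N * (‖x‖ ^ k * ∑ i ∈ Finset.range (n + 1), (n.choose i : ℝ) *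
        ‖iteratedFDeriv ℝ i f x‖ * ‖iteratedFDeriv ℝ (n - i) (fun x => ρ (x - a)) x‖) := by
        gcongr
    _ ≤ ∑ i ∈ Finset.range (n + 1),
        (n.choose i : ℝ) * ((2 ^ (2 * N) * schwartzNorm (2 * N) f) * R) := by
        rw [Finset.mul_sum, Finset.mul_sum]
        exact Finset.sum_le_sum hterm
    _ = 2 ^ n * ((2 ^ (2 * N) * schwartzNorm (2 * N) f) * R) := by
        rw [← Finset.sum_mul]
        congr 1
        exact_mod_cast Nat.sum_range_choose n
    _ ≤ 2 ^ N * ((2 ^ (2 * N) * schwartzNorm (2 * N) f) * R) := by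
        gcongr
        norm_num
    _ = _ := by ring

end SchwartzNorm

/-! ### A Gabor frame -/

section Frame

/-- A smooth function supported in `[-1, 1]` whose integer translates sum up to `1`. -/
def partitionBump (t : ℝ) : ℝ := Real.smoothTransition (t + 1) - Real.smoothTransition t

/-- A smooth function supported in `[-2, 2]` that is equal to `1` on `[-1, 1]`. -/
def plateauBump (t : ℝ) : ℝ := Real.smoothTransition (t + 2) * Real.smoothTransition (2 - t)

theorem contDiff_partitionBump : ContDiff ℝ ((⊤ : ℕ∞) : WithTop ℕ∞) partitionBump :=
  (Real.smoothTransition.contDiff.comp (contDiff_id.add contDiff_const)).sub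
    Real.smoothTransition.contDiff

theorem contDiff_plateauBump : ContDiff ℝ ((⊤ : ℕ∞) : WithTop ℕ∞) plateauBump :=
  (Real.smoothTransition.contDiff.comp (contDiff_id.add contDiff_const)).mul
    (Real.smoothTransition.contDiff.comp (contDiff_const.sub contDiff_id))

theorem abs_lt_of_partitionBump_ne_zero {t : ℝ} (h : partitionBump t ≠ 0) : |t| < 1 := by
  rw [abs_lt]
  constructor
  · by_contra hc
    exact h (by rw [partitionBump, Real.smoothTransition.zero_of_nonpos (by linarith),
      Real.smoothTransition.zero_of_nonpos (by linarith), sub_zero])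
  · by_contra hc
    exact h (by rw [partitionBump, Real.smoothTransition.one_of_one_le (by linarith),
      Real.smoothTransition.one_of_one_le (by linarith), sub_self])

theorem abs_lt_of_plateauBump_ne_zero {t : ℝ} (h : plateauBump t ≠ 0) : |t| < 2 := by
  rw [abs_lt]
  constructor
  · by_contra hc
    exact h (by rw [plateauBump, Real.smoothTransition.zero_of_nonpos (by linarith), zero_mul])
  · by_contra hc
    exact h (by rw [plateauBump, Real.smoothTransition.zero_of_nonpos (x := 2 - t) (by linarith),
      mul_zero])

theorem plateauBump_eq_one {t : ℝ} (h : |t| < 1) : plateauBump t = 1 := by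
  rw [abs_lt] at h
  rw [plateauBump, Real.smoothTransition.one_of_one_le (by linarith),
    Real.smoothTransition.one_of_one_le (by linarith), mul_one]

theorem sum_partitionBump (t : ℝ) :
    ∑ a ∈ ({⌊t⌋, ⌊t⌋ + 1} : Finset ℤ), partitionBump (t - a) = 1 := by
  rw [Finset.sum_pair (by omega)]
  have h1 := Int.floor_le t
  have h2 := Int.lt_floor_add_one t
  push_cast
  rw [partitionBump, partitionBump, Real.smoothTransition.one_of_one_le (by linarith),
    Real.smoothTransition.zero_of_nonpos (x := t - (⌊t⌋ + 1)) (by linarith)]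
  have : t - (⌊t⌋ + 1) + 1 = t - ⌊t⌋ := by ring
  rw [this]
  ring

theorem mem_of_partitionBump_ne_zero {t : ℝ} {a : ℤ} (h : partitionBump (t - a) ≠ 0) :
    a ∈ ({⌊t⌋, ⌊t⌋ + 1} : Finset ℤ) := by
  have h1 := abs_lt.1 (abs_lt_of_partitionBump_ne_zero h)
  have h2 : (⌊t⌋ : ℝ) - 1 < a := by linarith [Int.floor_le t]
  have h3 : (a : ℝ) < ⌊t⌋ + 2 := by linarith [Int.lt_floor_add_one t]
  have h4 : ⌊t⌋ - 1 < a := by exact_mod_cast h2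
  have h5 : a < ⌊t⌋ + 2 := by exact_mod_cast h3
  simp only [Finset.mem_insert, Finset.mem_singleton]
  omega

variable {ι : Type*}

/-- The product of copies of the function `u (4 t)` of one variable. -/
def bumpProd (ι : Type*) [Fintype ι] (u : ℝ → ℝ) (hu : ContDiff ℝ ((⊤ : ℕ∞) : WithTop ℕ∞) u)
    (hs : ∀ t, u t ≠ 0 → |t| < 2) : 𝓢(EuclideanSpace ℝ ι, ℂ) :=
  HasCompactSupport.toSchwartzMap (f := fun x : EuclideanSpace ℝ ι => ∏ i, (u (4 * x i) : ℂ))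
    (by
      refine HasCompactSupport.intro (K := WithLp.toLp 2 '' (Set.univ.pi fun _ : ι =>
        Set.Icc (-1 : ℝ) 1)) ((isCompact_univ_pi fun _ => isCompact_Icc).image
          (PiLp.continuous_toLp 2 _)) fun x hx => ?_
      by_contra hne
      refine hx ⟨fun i => x i, fun i _ => ?_, rfl⟩
      have h1 : u (4 * x i) ≠ 0 := by
        have := (Finset.prod_ne_zero_iff.1 hne) i (Finset.mem_univ i)
        exact_mod_cast this
      have h2 := abs_lt.1 (hs _ h1)
      exact ⟨by linarith [h2.1], by linarith [h2.2]⟩)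
    (by
      refine contDiff_prod fun i _ => ?_
      refine Complex.ofRealCLM.contDiff.comp (hu.comp (contDiff_const.mul ?_))
      exact (EuclideanSpace.proj i : EuclideanSpace ℝ ι →L[ℝ] ℝ).contDiff)

@[simp]
theorem bumpProd_apply [Fintype ι] (u : ℝ → ℝ) (hu hs) (x : EuclideanSpace ℝ ι) :
    bumpProd ι u hu hs x = ∏ i, (u (4 * x i) : ℂ) := rfl

/-- The vector of `ℝ^ι` with integer components `b`. -/
def intVec (b : ι → ℤ) : EuclideanSpace ℝ ι := WithLp.toLp 2 fun i => (b i : ℝ)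

/-- The vector of `ℝ^ι` with components `a i / 4`. -/
def quarterVec (a : ι → ℤ) : EuclideanSpace ℝ ι := WithLp.toLp 2 fun i => (a i : ℝ) / 4

@[simp] theorem intVec_apply (b : ι → ℤ) (i : ι) : intVec b i = b i := rfl

@[simp] theorem quarterVec_apply (b : ι → ℤ) (i : ι) : quarterVec b i = b i / 4 := rfl

variable [Fintype ι]

/-- The function `∏ i, partitionBump (4 x i - a i)`. -/
def framePartition (a : ι → ℤ) : 𝓢(EuclideanSpace ℝ ι, ℂ) :=
  SchwartzMap.compSubConstCLM ℂ (quarterVec a) (bumpProd ι partitionBump contDiff_partitionBump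
    fun _ h => (abs_lt_of_partitionBump_ne_zero h).trans one_lt_two)

/-- The function `∏ i, plateauBump (4 x i - a i)`. -/
def framePlateau (a : ι → ℤ) : 𝓢(EuclideanSpace ℝ ι, ℂ) :=
  SchwartzMap.compSubConstCLM ℂ (quarterVec a) (bumpProd ι plateauBump contDiff_plateauBump
    fun _ h => abs_lt_of_plateauBump_ne_zero h)

theorem framePartition_apply (a : ι → ℤ) (x : EuclideanSpace ℝ ι) :
    framePartition a x = ∏ i, (partitionBump (4 * x i - a i) : ℂ) := by
  simp only [framePartition, SchwartzMap.compSubConstCLM_apply, bumpProd_apply, PiLp.sub_apply,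
    quarterVec_apply]
  refine Finset.prod_congr rfl fun i _ => ?_
  congr 2
  ring

theorem framePlateau_apply (a : ι → ℤ) (x : EuclideanSpace ℝ ι) :
    framePlateau a x = ∏ i, (plateauBump (4 * x i - a i) : ℂ) := by
  simp only [framePlateau, SchwartzMap.compSubConstCLM_apply, bumpProd_apply, PiLp.sub_apply,
    quarterVec_apply]
  refine Finset.prod_congr rfl fun i _ => ?_
  congr 2
  ring

theorem abs_lt_of_framePartition_ne_zero {a : ι → ℤ} {x : EuclideanSpace ℝ ι}
    (h : framePartition a x ≠ 0) (i : ι) : |4 * x i - a i| < 1 := by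
  rw [framePartition_apply] at h
  have := (Finset.prod_ne_zero_iff.1 h) i (Finset.mem_univ i)
  exact abs_lt_of_partitionBump_ne_zero (by exact_mod_cast this)

theorem abs_lt_of_framePlateau_ne_zero {a : ι → ℤ} {x : EuclideanSpace ℝ ι}
    (h : framePlateau a x ≠ 0) (i : ι) : |4 * x i - a i| < 2 := by
  rw [framePlateau_apply] at h
  have := (Finset.prod_ne_zero_iff.1 h) i (Finset.mem_univ i)
  exact abs_lt_of_plateauBump_ne_zero (by exact_mod_cast this)

theorem framePlateau_eq_one {a : ι → ℤ} {x : EuclideanSpace ℝ ι}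
    (h : framePartition a x ≠ 0) : framePlateau a x = 1 := by
  rw [framePlateau_apply]
  refine Finset.prod_eq_one fun i _ => ?_
  rw [plateauBump_eq_one (abs_lt_of_framePartition_ne_zero h i), Complex.ofReal_one]

theorem hasSum_framePartition (x : EuclideanSpace ℝ ι) :
    HasSum (fun a : ι → ℤ => framePartition a x) 1 := by
  classical
  have h1 : ∑ a ∈ Fintype.piFinset fun i => ({⌊4 * x i⌋, ⌊4 * x i⌋ + 1} : Finset ℤ),
      framePartition a x = 1 := by
    simp_rw [framePartition_apply]
    rw [← Finset.prod_univ_sum (fun i => ({⌊4 * x i⌋, ⌊4 * x i⌋ + 1} : Finset ℤ))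
      fun i a => (partitionBump (4 * x i - a) : ℂ)]
    refine Finset.prod_eq_one fun i _ => ?_
    exact_mod_cast sum_partitionBump (4 * x i)
  rw [← h1]
  refine hasSum_sum_of_ne_finset_zero fun a ha => ?_
  by_contra hne
  refine ha (Fintype.mem_piFinset.2 fun i => ?_)
  rw [framePartition_apply] at hne
  have := (Finset.prod_ne_zero_iff.1 hne) i (Finset.mem_univ i)
  exact mem_of_partitionBump_ne_zero (by exact_mod_cast this)

/-- The character `exp (2πi b·x)`. -/
def character (b : EuclideanSpace ℝ ι) (x : EuclideanSpace ℝ ι) : ℂ :=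
  Complex.exp (((2 * Real.pi * inner ℝ x b : ℝ) : ℂ) * Complex.I)

theorem character_hasTemperateGrowth (b : EuclideanSpace ℝ ι) :
    (character b).HasTemperateGrowth := by
  have h : (fun x : EuclideanSpace ℝ ι => 2 * Real.pi * inner ℝ x b).HasTemperateGrowth := by
    fun_prop
  exact hasTemperateGrowth_exp_mul_I.comp h

theorem fourier_character_smul (b : EuclideanSpace ℝ ι) (f : 𝓢(EuclideanSpace ℝ ι, ℂ)) :
    𝓕 (SchwartzMap.smulLeftCLM ℂ (character b) f) = SchwartzMap.compSubConstCLM ℂ b (𝓕 f) := by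
  ext w
  rw [SchwartzMap.compSubConstCLM_apply, SchwartzMap.fourier_coe, SchwartzMap.fourier_coe,
    Real.fourier_eq', Real.fourier_eq']
  congr 1
  funext v
  rw [SchwartzMap.smulLeftCLM_apply_apply (character_hasTemperateGrowth b), smul_smul, character,
    ← Complex.exp_add, inner_sub_right]
  congr 2
  push_cast
  ring

/-- The frame function `exp (2πi b·x) ∏ i, plateauBump (4 x i - a i)`. -/
def frameFun (m : (ι → ℤ) × (ι → ℤ)) : 𝓢(EuclideanSpace ℝ ι, ℂ) :=
  SchwartzMap.smulLeftCLM ℂ (character (intVec m.2)) (framePlateau m.1)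

/-- The dual frame function `exp (-2πi b·x) ∏ i, partitionBump (4 x i - a i)`. -/
def frameDual (m : (ι → ℤ) × (ι → ℤ)) : 𝓢(EuclideanSpace ℝ ι, ℂ) :=
  SchwartzMap.smulLeftCLM ℂ (character (-intVec m.2)) (framePartition m.1)

theorem frameFun_apply (m : (ι → ℤ) × (ι → ℤ)) (x : EuclideanSpace ℝ ι) :
    frameFun m x = character (intVec m.2) x * framePlateau m.1 x := by
  rw [frameFun, SchwartzMap.smulLeftCLM_apply_apply (character_hasTemperateGrowth _), smul_eq_mul]

theorem frameDual_apply (m : (ι → ℤ) × (ι → ℤ)) (x : EuclideanSpace ℝ ι) :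
    frameDual m x = character (-intVec m.2) x * framePartition m.1 x := by
  rw [frameDual, SchwartzMap.smulLeftCLM_apply_apply (character_hasTemperateGrowth _), smul_eq_mul]

theorem integral_mul_frameDual (m : (ι → ℤ) × (ι → ℤ)) (f : 𝓢(EuclideanSpace ℝ ι, ℂ)) :
    ∫ x, f x * frameDual m x = 𝓕 (mulCLM (framePartition m.1) f) (intVec m.2) := by
  rw [SchwartzMap.fourier_coe, Real.fourier_eq']
  congr 1
  funext x
  rw [frameDual_apply, mulCLM_apply, character, smul_eq_mul, inner_neg_right]
  have : ((2 * Real.pi * -inner ℝ x (intVec m.2) : ℝ) : ℂ) * Complex.I =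
    ((-2 * Real.pi * inner ℝ x (intVec m.2) : ℝ) : ℂ) * Complex.I := by push_cast; ring
  rw [this]
  ring

/-- The factor `1 / 4` is wasteful here; it matches the bound for `quarterVec`, so that
`summable_weight` serves both. -/
theorem abs_le_norm_intVec (b : ι → ℤ) (i : ι) : |(b i : ℝ)| / 4 ≤ ‖intVec b‖ := by
  have h : ‖intVec b i‖ ≤ ‖intVec b‖ := PiLp.norm_apply_le _ i
  rw [intVec_apply, Real.norm_eq_abs] at h
  linarith [abs_nonneg (b i : ℝ)]

theorem abs_le_norm_quarterVec (b : ι → ℤ) (i : ι) : |(b i : ℝ)| / 4 ≤ ‖quarterVec b‖ := by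
  have h : ‖quarterVec b i‖ ≤ ‖quarterVec b‖ := PiLp.norm_apply_le _ i
  rw [quarterVec_apply, Real.norm_eq_abs, abs_div, abs_of_pos (by norm_num : (0:ℝ) < 4)] at h
  exact h

theorem summable_int_weight : Summable fun n : ℤ => ((1 + |(n : ℝ)| / 4) ^ 2)⁻¹ := by
  have h1 : Summable fun n : ℤ => 16 * (1 / |(n : ℝ)| ^ (2 : ℝ)) + (if n = 0 then (1 : ℝ) else 0) :=
    ((Real.summable_one_div_int_add_rpow 0 2).2 one_lt_two |>.congr (fun n => by simp)
      |>.mul_left 16).add (summable_of_ne_finset_zero (s := {0}) (fun n hn => by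
        simp at hn; simp [hn]))
  refine Summable.of_nonneg_of_le (fun n => by positivity) (fun n => ?_) h1
  rcases eq_or_ne n 0 with rfl | hn
  · simp
  · have hpos : 0 < |(n : ℝ)| := by positivity
    simp only [hn, if_false, add_zero]
    rw [Real.rpow_two, inv_eq_one_div, mul_one_div, div_le_div_iff₀ (by positivity) (by positivity)]
    nlinarith

theorem summable_pi_prod {I : Type*} {u : ι → I → ℝ} (h0 : ∀ i n, 0 ≤ u i n)
    (hu : ∀ i, Summable (u i)) : Summable fun a : ι → I => ∏ i, u i (a i) := by
  classical
  refine summable_of_sum_le (c := ∏ i : ι, ∑' n, u i n)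
    (fun a => Finset.prod_nonneg fun i _ => h0 i _) fun s => ?_
  have hsub : s ⊆ Fintype.piFinset fun i => s.image fun a => a i := fun a ha =>
    Fintype.mem_piFinset.2 fun i => Finset.mem_image_of_mem (fun a : ι → I => a i) ha
  refine (Finset.sum_le_sum_of_subset_of_nonneg hsub fun a _ _ =>
    Finset.prod_nonneg fun i _ => h0 i _).trans ?_
  rw [← Finset.prod_univ_sum (fun i => s.image fun a => a i) u]
  refine Finset.prod_le_prod (fun i _ => Finset.sum_nonneg fun n _ => h0 i n) fun i _ => ?_
  exact (hu i).sum_le_tsum _ fun n _ => h0 i n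

theorem summable_weight {v : (ι → ℤ) → ℝ} (hv : ∀ a i, |(a i : ℝ)| / 4 ≤ v a) (hv0 : ∀ a, 0 ≤ v a) :
    Summable fun a : ι → ℤ => ((1 + v a) ^ (2 * Fintype.card ι))⁻¹ := by
  refine Summable.of_nonneg_of_le (fun a => by have := hv0 a; positivity) (fun a => ?_)
    (summable_pi_prod (fun _ _ => by positivity) fun _ : ι => summable_int_weight)
  have := hv0 a
  rw [Finset.prod_inv_distrib]
  refine inv_anti₀ (by positivity) ?_
  calc ∏ i, (1 + |(a i : ℝ)| / 4) ^ 2 ≤ ∏ _i : ι, (1 + v a) ^ 2 := by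
        refine Finset.prod_le_prod (fun i _ => by positivity) fun i _ => ?_
        have := hv a i
        gcongr
    _ = _ := by rw [Finset.prod_const, Finset.card_univ, ← pow_mul]

/-- The size of a frame index. -/
def frameWeight (m : (ι → ℤ) × (ι → ℤ)) : ℝ := (1 + ‖quarterVec m.1‖) * (1 + ‖intVec m.2‖)

theorem one_le_frameWeight (m : (ι → ℤ) × (ι → ℤ)) : 1 ≤ frameWeight m :=
  one_le_mul_of_one_le_of_one_le (by simp) (by simp)

theorem summable_frameWeight :
    Summable fun m : (ι → ℤ) × (ι → ℤ) => (frameWeight m ^ (2 * Fintype.card ι))⁻¹ := by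
  have h1 := summable_weight (ι := ι) abs_le_norm_quarterVec fun a => norm_nonneg (quarterVec a)
  have h2 := summable_weight (ι := ι) abs_le_norm_intVec fun a => norm_nonneg (intVec a)
  refine (h1.mul_of_nonneg h2 (fun a => by positivity) fun a => by positivity).congr fun m => ?_
  rw [frameWeight, mul_pow, mul_inv]

/-- A coefficient is a value of the Fourier transform of a localized piece of `f`. The localization
gives decay in the position index, the Fourier transform decay in the frequency index. -/
theorem exists_frameCoeff_le (N : ℕ) : ∃ (M : ℕ) (C : ℝ), 0 ≤ C ∧
    ∀ (f : 𝓢(EuclideanSpace ℝ ι, ℂ)) (m : (ι → ℤ) × (ι → ℤ)),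
      frameWeight m ^ N * ‖∫ x, f x * frameDual m x‖ ≤ C * schwartzNorm M f := by
  obtain ⟨M, C, hC, h⟩ := exists_schwartzNorm_clm_le
    (FourierTransform.fourierCLM ℂ 𝓢(EuclideanSpace ℝ ι, ℂ)) N
  obtain ⟨C', hC', h'⟩ := exists_schwartzNorm_mul_translate_le
    (bumpProd ι partitionBump contDiff_partitionBump
      fun _ h => (abs_lt_of_partitionBump_ne_zero h).trans one_lt_two) (max M N)
  refine ⟨2 * max M N, 2 ^ N * C * C', by positivity, fun f m => ?_⟩
  rw [integral_mul_frameDual]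
  set g := mulCLM (framePartition m.1) f
  have h1 := one_add_pow_mul_le_schwartzNorm (N := N) (k := N) (n := 0) le_rfl (Nat.zero_le _) (𝓕 g)
    (intVec m.2)
  rw [norm_iteratedFDeriv_zero] at h1
  have h2 : schwartzNorm N (𝓕 g) ≤ C * schwartzNorm M g := h g
  have h3 : (1 + ‖quarterVec m.1‖) ^ (max M N) * schwartzNorm (max M N) g ≤
    C' * schwartzNorm (2 * max M N) f := h' f (quarterVec m.1)
  have h4 := schwartzNorm_mono (le_max_left M N) g
  have h5 : (1 + ‖quarterVec m.1‖) ^ N ≤ (1 + ‖quarterVec m.1‖) ^ (max M N) :=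
    pow_le_pow_right₀ (by simp) (le_max_right _ _)
  have h6 : 0 ≤ schwartzNorm (max M N) g := apply_nonneg _ _
  calc frameWeight m ^ N * ‖𝓕 g (intVec m.2)‖
      = (1 + ‖quarterVec m.1‖) ^ N * ((1 + ‖intVec m.2‖) ^ N * ‖𝓕 g (intVec m.2)‖) := by
        rw [frameWeight, mul_pow]; ring
    _ ≤ (1 + ‖quarterVec m.1‖) ^ N * (2 ^ N * (C * schwartzNorm (max M N) g)) := by
        refine mul_le_mul_of_nonneg_left (h1.trans ?_) (by positivity)
        exact mul_le_mul_of_nonneg_left (h2.trans (mul_le_mul_of_nonneg_left h4 hC)) (by positivity)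
    _ ≤ (1 + ‖quarterVec m.1‖) ^ (max M N) * (2 ^ N * (C * schwartzNorm (max M N) g)) := by
        gcongr
    _ = 2 ^ N * C * ((1 + ‖quarterVec m.1‖) ^ (max M N) * schwartzNorm (max M N) g) := by ring
    _ ≤ 2 ^ N * C * (C' * schwartzNorm (2 * max M N) f) := by gcongr
    _ = _ := by ring

/-- A frame function is a fixed bump translated by `quarterVec` in position and by `intVec` in
momentum, and each translation costs a polynomial factor. Against the rapidly decreasing
coefficients this growth is harmless. -/
theorem exists_frameFun_le (N : ℕ) : ∃ (M : ℕ) (C : ℝ), 0 ≤ C ∧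
    ∀ m : (ι → ℤ) × (ι → ℤ), schwartzNorm N (frameFun m) ≤ C * frameWeight m ^ M := by
  obtain ⟨M, C, hC, h⟩ := exists_schwartzNorm_clm_le
    (FourierTransform.fourierInvCLM ℂ 𝓢(EuclideanSpace ℝ ι, ℂ)) N
  obtain ⟨M', C', hC', h'⟩ := exists_schwartzNorm_clm_le
    (FourierTransform.fourierCLM ℂ 𝓢(EuclideanSpace ℝ ι, ℂ)) M
  set η : 𝓢(EuclideanSpace ℝ ι, ℂ) := bumpProd ι plateauBump contDiff_plateauBump
    fun _ h => abs_lt_of_plateauBump_ne_zero h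
  set R : ℝ := 2 ^ M' * schwartzNorm M' η
  have hR : 0 ≤ R := by positivity
  refine ⟨max M M', C * (2 ^ M * (C' * R)), by positivity, fun m => ?_⟩
  have h1 : frameFun m = 𝓕⁻ (SchwartzMap.compSubConstCLM ℂ (intVec m.2) (𝓕 (framePlateau m.1))) := by
    rw [← fourier_character_smul, FourierTransform.fourierInv_fourier_eq]
    rfl
  have h2 : schwartzNorm N (frameFun m) ≤ C * schwartzNorm M
      (SchwartzMap.compSubConstCLM ℂ (intVec m.2) (𝓕 (framePlateau m.1))) := by
    rw [h1]; exact h _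
  have h3 := schwartzNorm_compSubConst_le M (𝓕 (framePlateau m.1)) (intVec m.2)
  have h4 : schwartzNorm M (𝓕 (framePlateau m.1)) ≤ C' * schwartzNorm M' (framePlateau m.1) := h' _
  have h5 : schwartzNorm M' (framePlateau m.1) ≤ (1 + ‖quarterVec m.1‖) ^ M' * R :=
    schwartzNorm_compSubConst_le M' η (quarterVec m.1)
  calc schwartzNorm N (frameFun m)
      ≤ C * ((1 + ‖intVec m.2‖) ^ M * (2 ^ M * (C' * ((1 + ‖quarterVec m.1‖) ^ M' * R)))) := by
        refine h2.trans (mul_le_mul_of_nonneg_left (h3.trans ?_) hC)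
        gcongr
        exact h4.trans (by gcongr)
    _ ≤ C * ((1 + ‖intVec m.2‖) ^ (max M M') * (2 ^ M *
        (C' * ((1 + ‖quarterVec m.1‖) ^ (max M M') * R)))) := by
        gcongr
        · simp
        · exact le_max_left _ _
        · simp
        · exact le_max_right _ _
    _ = _ := by rw [frameWeight, mul_pow]; ring

theorem summable_frameCoeff_mul (N : ℕ) (f : 𝓢(EuclideanSpace ℝ ι, ℂ)) :
    Summable fun m : (ι → ℤ) × (ι → ℤ) => ‖∫ x, f x * frameDual m x‖ * frameWeight m ^ N := by
  obtain ⟨M, C, hC, h⟩ := exists_frameCoeff_le (ι := ι) (N + 2 * Fintype.card ι)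
  refine Summable.of_nonneg_of_le (fun m => ?_) (fun m => ?_)
    (summable_frameWeight.mul_left (C * schwartzNorm M f))
  · have := one_le_frameWeight m
    positivity
  · have h1 := one_le_frameWeight m
    rw [← div_eq_mul_inv, le_div_iff₀ (by positivity)]
    refine le_of_eq_of_le ?_ (h f m)
    rw [pow_add]
    ring

/-- Every Schwartz function is the sum of its frame expansion. -/
theorem hasSum_frame (f : 𝓢(EuclideanSpace ℝ ι, ℂ)) :
    HasSum (fun m : (ι → ℤ) × (ι → ℤ) => (∫ x, f x * frameDual m x) • frameFun m) f := by
  have hsum : Summable fun m : (ι → ℤ) × (ι → ℤ) => (∫ x, f x * frameDual m x) • frameFun m := by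
    refine summable_schwartz fun k n => ?_
    obtain ⟨M, C, hC, h⟩ := exists_frameFun_le (ι := ι) (max k n)
    refine Summable.of_nonneg_of_le (fun m => apply_nonneg _ _) (fun m => ?_)
      ((summable_frameCoeff_mul M f).mul_left C)
    refine (seminorm_le_schwartzNorm (le_max_left k n) (le_max_right k n) _).trans ?_
    rw [map_smul_eq_mul]
    refine (mul_le_mul_of_nonneg_left (h m) (norm_nonneg _)).trans (le_of_eq ?_)
    ring
  obtain ⟨g, hg⟩ := hsum
  suffices g = f by rwa [this] at hg
  ext x
  have h1 : HasSum (fun m : (ι → ℤ) × (ι → ℤ) => (∫ x, f x * frameDual m x) * frameFun m x) (g x) :=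
    hg.map ((BoundedContinuousFunction.evalCLM ℂ x).comp
      (SchwartzMap.toBoundedContinuousFunctionCLM ℂ (EuclideanSpace ℝ ι) ℂ))
      (ContinuousLinearMap.continuous _)
  -- For a fixed cell the sum over the frequencies is the Fourier series of the piece
  -- `framePartition a * f`, cut off by the plateau, which is `1` where the piece is nonzero. The
  -- sum over the cells is then the partition of unity.
  have h2 : ∀ a : ι → ℤ, HasSum (fun b : ι → ℤ => (∫ x, f x * frameDual (a, b) x) *
      frameFun (a, b) x) (framePartition a x * f x) := by
    intro a
    simp_rw [integral_mul_frameDual, frameFun_apply]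
    by_cases hx : framePlateau a x = 0
    · have h3 : framePartition a x = 0 := by
        by_contra hne
        exact one_ne_zero ((framePlateau_eq_one hne).symm.trans hx)
      simp only [hx, h3, mul_zero, zero_mul]
      exact hasSum_zero
    · set g := mulCLM (framePartition a) f
      have hsupp : ∀ y, g y ≠ 0 → ∀ i, |y i - a i / 4| ≤ 1 / 4 := by
        intro y hy i
        rw [mulCLM_apply] at hy
        have := abs_lt.1 (abs_lt_of_framePartition_ne_zero (right_ne_zero_of_mul hy) i)
        rw [abs_le]
        constructor <;> linarith [this.1, this.2]
      have hs : Summable fun b : ι → ℤ => 𝓕 g (WithLp.toLp 2 fun i => (b i : ℝ)) := by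
        have h4 := ((summable_frameCoeff_mul 0 f).comp_injective (Prod.mk_right_injective a))
        refine Summable.of_norm (h4.congr fun b => ?_)
        simp only [Function.comp_apply, pow_zero, mul_one, integral_mul_frameDual]
        rfl
      have hx' : ∀ i, |x i - a i / 4| < 1 / 2 := by
        intro i
        have := abs_lt.1 (abs_lt_of_framePlateau_ne_zero hx i)
        rw [abs_lt]
        constructor <;> linarith [this.1, this.2]
      have h5 := (hasSum_fourier_of_supported_cube g hsupp hs hx').mul_right (framePlateau a x)
      have h6 : g x * framePlateau a x = framePartition a x * f x := by
        rw [mulCLM_apply]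
        by_cases h7 : framePartition a x = 0
        · simp [h7]
        · rw [framePlateau_eq_one h7]; ring
      rw [h6] at h5
      refine (congrArg (fun u => HasSum u (framePartition a x * f x)) (funext fun b => ?_)).mpr h5
      rw [mul_assoc]
      congr 2
  have h3 := h1.prod_fiberwise h2
  have h4 : HasSum (fun a : ι → ℤ => framePartition a x * f x) (1 * f x) :=
    (hasSum_framePartition x).mul_right (f x)
  rw [one_mul] at h4
  exact h3.unique h4

end Frame

/-! ### Products of test functions -/

section Products

/-- The splitting of `x = (x₁, …, xₙ₊₁)` into `x₁` and `(x₂, …, xₙ₊₁)`. -/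
def splitPoints (n : ℕ) : Points (n + 1) ≃ₗᵢ[ℝ] WithLp 2 (Spacetime × Points n) where
  toFun x := WithLp.toLp 2 (Points.point 0 x, Points.tail x)
  invFun y := WithLp.toLp 2 fun jμ => Fin.cases (motive := fun _ => ℝ) (y.fst jμ.2)
    (fun j => y.snd (j, jμ.2)) jμ.1
  left_inv x := by
    ext ⟨j, μ⟩
    refine Fin.cases ?_ (fun j => ?_) j <;> rfl
  right_inv y := rfl
  map_add' x y := by rw [map_add, map_add]; rfl
  map_smul' c x := by rw [map_smul, map_smul]; rfl
  norm_map' x := by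
    change ‖(WithLp.toLp 2 (Points.point 0 x, Points.tail x) : WithLp 2 (Spacetime × Points n))‖ =
      ‖x‖
    rw [← sq_eq_sq₀ (norm_nonneg _) (norm_nonneg _), WithLp.prod_norm_sq_eq_of_L2]
    simp only [EuclideanSpace.norm_sq_eq, Fintype.sum_prod_type]
    exact ((Fin.sum_univ_succ fun j : Fin (n + 1) => ∑ μ, ‖x (j, μ)‖ ^ 2)).symm

theorem splitPoints_apply {n : ℕ} (x : Points (n + 1)) :
    splitPoints n x = WithLp.toLp 2 (Points.point 0 x, Points.tail x) := rfl

theorem measurePreserving_split (n : ℕ) :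
    MeasurePreserving fun x : Points (n + 1) => (Points.point 0 x, Points.tail x) :=
  (WithLp.volume_preserving_ofLp Spacetime (Points n)).comp (splitPoints n).measurePreserving

theorem measurableEmbedding_split (n : ℕ) :
    MeasurableEmbedding fun x : Points (n + 1) => (Points.point 0 x, Points.tail x) :=
  ((splitPoints n).toHomeomorph.toMeasurableEquiv.trans
    (MeasurableEquiv.toLp 2 (Spacetime × Points n)).symm).measurableEmbedding

theorem integral_split {G : Type*} [NormedAddCommGroup G] [NormedSpace ℝ G] {n : ℕ}
    (f : Spacetime × Points n → G) :
    ∫ x : Points (n + 1), f (Points.point 0 x, Points.tail x) = ∫ z, f z :=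
  (measurePreserving_split n).integral_comp (measurableEmbedding_split n) f

theorem inner_split {n : ℕ} (x y : Points (n + 1)) :
    inner ℝ x y = inner ℝ (Points.point 0 x) (Points.point 0 y) +
      inner ℝ (Points.tail x) (Points.tail y) := by
  simp only [PiLp.inner_apply, Fintype.sum_prod_type, Fin.sum_univ_succ, Points.point_apply,
      Points.tail_apply]

theorem controls_split (n : ℕ) :
    Controls (Points.point (n := n + 1) 0) (Points.tail (n := n)) :=
  ⟨1, fun x => by rw [one_mul]; exact Points.norm_le x⟩

/-- `tensor f g` as a continuous linear map in `f`. -/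
def tensorLeft {n : ℕ} (g : 𝓢(Points n, ℂ)) : 𝓢(Spacetime, ℂ) →L[ℂ] 𝓢(Points (n + 1), ℂ) :=
  mulCompCLM (Points.point 0) Points.tail (controls_split n) g

/-- `tensor f g` as a continuous linear map in `g`. -/
def tensorRight {n : ℕ} (f : 𝓢(Spacetime, ℂ)) : 𝓢(Points n, ℂ) →L[ℂ] 𝓢(Points (n + 1), ℂ) :=
  mulCompCLM Points.tail (Points.point 0) (controls_split n).symm f

theorem tensorLeft_apply {n : ℕ} (f : 𝓢(Spacetime, ℂ)) (g : 𝓢(Points n, ℂ)) :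
    tensorLeft g f = tensor f g := rfl

theorem tensorRight_apply {n : ℕ} (f : 𝓢(Spacetime, ℂ)) (g : 𝓢(Points n, ℂ)) :
    tensorRight f g = tensor f g := by
  ext x
  simp [tensorRight, mul_comm]

theorem integral_tensor_mul_tensor {n : ℕ} (f f' : 𝓢(Spacetime, ℂ)) (g g' : 𝓢(Points n, ℂ)) :
    ∫ x, tensor f g x * tensor f' g' x = (∫ x, f x * f' x) * ∫ x, g x * g' x := by
  have h := integral_split (n := n) fun z : Spacetime × Points n => (f z.1 * f' z.1) *
    (g z.2 * g' z.2)
  rw [Measure.volume_eq_prod, integral_prod_mul (fun x => f x * f' x) fun x => g x * g' x] at h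
  rw [← h]
  congr 1
  funext x
  simp only [tensor_apply]
  ring

theorem fourier_tensor {n : ℕ} (f : 𝓢(Spacetime, ℂ)) (g : 𝓢(Points n, ℂ)) :
    𝓕 (tensor f g) = tensor (𝓕 f) (𝓕 g) := by
  ext w
  simp only [tensor_apply, SchwartzMap.fourier_coe, Real.fourier_eq']
  rw [← integral_prod_mul, ← Measure.volume_eq_prod, ← integral_split]
  congr 1
  funext x
  simp only [smul_eq_mul]
  rw [inner_split, mul_add]
  push_cast
  rw [add_mul, Complex.exp_add]
  ring

/-- The function `f₁ ⊗ ⋯ ⊗ fₙ`. -/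
def prodFun : (n : ℕ) → (Fin n → 𝓢(Spacetime, ℂ)) → 𝓢(Points n, ℂ)
  | 0, _ => HasCompactSupport.toSchwartzMap (f := fun _ => 1)
      (HasCompactSupport.intro isCompact_univ fun x hx => absurd (Set.mem_univ x) hx) contDiff_const
  | n + 1, f => tensor (f 0) (prodFun n (Fin.tail f))

theorem prodFun_zero (f : Fin 0 → 𝓢(Spacetime, ℂ)) (x : Points 0) : prodFun 0 f x = 1 := rfl

theorem prodFun_succ {n : ℕ} (f : Fin (n + 1) → 𝓢(Spacetime, ℂ)) :
    prodFun (n + 1) f = tensor (f 0) (prodFun n (Fin.tail f)) := rfl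

theorem prodFun_cons {n : ℕ} (u : 𝓢(Spacetime, ℂ)) (f : Fin n → 𝓢(Spacetime, ℂ)) :
    prodFun (n + 1) (Fin.cons u f) = tensor u (prodFun n f) := by
  rw [prodFun_succ, Fin.cons_zero, Fin.tail_cons]

theorem prodFun_apply {n : ℕ} (f : Fin n → 𝓢(Spacetime, ℂ)) (x : Points n) :
    prodFun n f x = ∏ j, f j (Points.point j x) := by
  induction n with
  | zero => rw [prodFun_zero, Finset.univ_eq_empty, Finset.prod_empty]
  | succ n ih =>
    rw [prodFun_succ, tensor_apply, ih, Fin.prod_univ_succ]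
    rfl

theorem integral_prodFun_mul_prodFun {n : ℕ} (f g : Fin n → 𝓢(Spacetime, ℂ)) :
    ∫ x, prodFun n f x * prodFun n g x = ∏ j, ∫ x, f j x * g j x := by
  induction n with
  | zero =>
    simp only [prodFun_zero, Finset.univ_eq_empty, Finset.prod_empty, mul_one]
    have : (volume : Measure (Points 0)) Set.univ = 1 := by
      rw [volume_euclideanSpace_eq_dirac]
      simp
    simp [Measure.real, this]
  | succ n ih =>
    rw [prodFun_succ, prodFun_succ, integral_tensor_mul_tensor, ih, Fin.prod_univ_succ]
    rfl

/-- Frame indices for one point of space-time. -/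
abbrev FrameIndex : Type := (Fin 4 → ℤ) × (Fin 4 → ℤ)

/-- Frame indices for `n` points. -/
def frameIndexEquiv (n : ℕ) :
    (Fin n → FrameIndex) ≃ (Fin n × Fin 4 → ℤ) × (Fin n × Fin 4 → ℤ) where
  toFun m := (fun jμ => (m jμ.1).1 jμ.2, fun jμ => (m jμ.1).2 jμ.2)
  invFun m j := (fun μ => m.1 (j, μ), fun μ => m.2 (j, μ))
  left_inv _ := rfl
  right_inv _ := rfl

theorem character_points {n : ℕ} (b x : Points n) :
    character b x = ∏ j, character (Points.point j b) (Points.point j x) := by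
  simp only [character, PiLp.inner_apply, Fintype.sum_prod_type, Points.point_apply]
  rw [← Complex.exp_sum]
  congr 1
  push_cast
  rw [Finset.mul_sum, Finset.sum_mul]

/-- Characters and bumps are products over the coordinates, so the frame for `n` points is the
tensor power of the frame for one point. This is what makes product functions total. -/
theorem frameFun_frameIndexEquiv {n : ℕ} (m : Fin n → FrameIndex) :
    frameFun (frameIndexEquiv n m) = prodFun n fun j => frameFun (m j) := by
  ext x
  rw [prodFun_apply, frameFun_apply, character_points, framePlateau_apply, Fintype.prod_prod_type,
    ← Finset.prod_mul_distrib]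
  refine Finset.prod_congr rfl fun j _ => ?_
  rw [frameFun_apply, framePlateau_apply]
  rfl

theorem frameDual_frameIndexEquiv {n : ℕ} (m : Fin n → FrameIndex) :
    frameDual (frameIndexEquiv n m) = prodFun n fun j => frameDual (m j) := by
  ext x
  rw [prodFun_apply, frameDual_apply, character_points, framePartition_apply,
    Fintype.prod_prod_type, ← Finset.prod_mul_distrib]
  refine Finset.prod_congr rfl fun j _ => ?_
  rw [frameDual_apply, framePartition_apply]
  rfl

theorem hasSum_prodFrame {n : ℕ} (f : 𝓢(Points n, ℂ)) :
    HasSum (fun m : Fin n → FrameIndex => (∫ x, f x * prodFun n (fun j => frameDual (m j)) x) •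
      prodFun n fun j => frameFun (m j)) f := by
  have h := (frameIndexEquiv n).hasSum_iff.2 (hasSum_frame f)
  simpa only [Function.comp_def, frameFun_frameIndexEquiv, frameDual_frameIndexEquiv] using h

theorem norm_point_le {n : ℕ} (j : Fin n) (x : Points n) : ‖Points.point j x‖ ≤ ‖x‖ := by
  rw [← sq_le_sq₀ (norm_nonneg _) (norm_nonneg _)]
  simp only [EuclideanSpace.norm_sq_eq, Fintype.sum_prod_type, Points.point_apply]
  exact Finset.single_le_sum (f := fun j : Fin n => ∑ μ : Fin 4, ‖x (j, μ)‖ ^ 2)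
    (fun i _ => by positivity) (Finset.mem_univ j)

theorem frameWeight_le {n : ℕ} (m : Fin n → FrameIndex) (j : Fin n) :
    frameWeight (m j) ≤ frameWeight (frameIndexEquiv n m) := by
  have h1 : ‖quarterVec (m j).1‖ ≤ ‖quarterVec (frameIndexEquiv n m).1‖ :=
    norm_point_le j (quarterVec (frameIndexEquiv n m).1)
  have h2 : ‖intVec (m j).2‖ ≤ ‖intVec (frameIndexEquiv n m).2‖ :=
    norm_point_le j (intVec (frameIndexEquiv n m).2)
  rw [frameWeight, frameWeight]
  gcongr

/-- Two continuous linear maps that agree on product functions are equal. -/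
theorem clm_ext_prodFun {n : ℕ} {F : Type*} [AddCommGroup F] [Module ℂ F] [TopologicalSpace F]
    [T2Space F] {S T : 𝓢(Points n, ℂ) →L[ℂ] F} (h : ∀ f, S (prodFun n f) = T (prodFun n f)) :
    S = T := by
  ext f
  have h1 := (hasSum_prodFrame f).mapL S
  have h2 := (hasSum_prodFrame f).mapL T
  refine h1.unique ?_
  convert h2 using 2 with m
  rw [map_smul, map_smul, h]

end Products

/-! ### The kernel theorem -/

section Kernel

variable {H : Type*} [NormedAddCommGroup H] [NormedSpace ℂ H]

theorem exists_schwartzNorm_ball_subset {E : Type*} [NormedAddCommGroup E] [NormedSpace ℝ E]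
    {V : Set 𝓢(E, ℂ)} (hV : V ∈ 𝓝 0) :
    ∃ (N : ℕ) (r : ℝ), 0 < r ∧ ∀ f, schwartzNorm N f < r → f ∈ V := by
  obtain ⟨⟨s, r⟩, hr, hs⟩ := (schwartz_withSeminorms ℂ E ℂ).hasBasis_ball.mem_iff.1 hV
  refine ⟨s.sup fun m => m.1 ⊔ m.2, r, hr, fun f hf => hs ?_⟩
  have h1 : s ⊆ Finset.Iic (s.sup (fun m => m.1 ⊔ m.2), s.sup fun m => m.1 ⊔ m.2) := by
    intro m hm
    have := Finset.le_sup (f := fun m : ℕ × ℕ => m.1 ⊔ m.2) hm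
    exact Finset.mem_Iic.2 ⟨le_sup_left.trans this, le_sup_right.trans this⟩
  rw [Seminorm.mem_ball_zero]
  exact (Seminorm.le_def.1 (Finset.sup_mono (f := schwartzSeminormFamily ℂ E ℂ) h1) f).trans_lt hf

/-- A multilinear map is separately continuous. -/
def SeparatelyContinuous {n : ℕ} (M : MultilinearMap ℂ (fun _ : Fin n => 𝓢(Spacetime, ℂ)) H) :
    Prop :=
  ∀ (f : Fin n → 𝓢(Spacetime, ℂ)) (j : Fin n), Continuous fun u => M (Function.update f j u)

theorem SeparatelyContinuous.curryLeft {n : ℕ}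
    {M : MultilinearMap ℂ (fun _ : Fin (n + 1) => 𝓢(Spacetime, ℂ)) H}
    (hM : SeparatelyContinuous M) (u : 𝓢(Spacetime, ℂ)) : SeparatelyContinuous (M.curryLeft u) := by
  intro f j
  have h := hM (Fin.cons u f) j.succ
  simpa only [MultilinearMap.curryLeft_apply, Fin.cons_update] using h

theorem SeparatelyContinuous.continuous_cons {n : ℕ}
    {M : MultilinearMap ℂ (fun _ : Fin (n + 1) => 𝓢(Spacetime, ℂ)) H}
    (hM : SeparatelyContinuous M) (f : Fin n → 𝓢(Spacetime, ℂ)) :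
    Continuous fun u => M.curryLeft u f := by
  have h := hM (Fin.cons 0 f) 0
  simpa only [MultilinearMap.curryLeft_apply, Fin.update_cons_zero] using h

/-- A separately continuous multilinear map on a power of Schwartz space is bounded by a product of
seminorms. -/
theorem SeparatelyContinuous.exists_bound {n : ℕ}
    {M : MultilinearMap ℂ (fun _ : Fin n => 𝓢(Spacetime, ℂ)) H} (hM : SeparatelyContinuous M) :
    ∃ (N : ℕ) (C : ℝ), 0 ≤ C ∧ ∀ f, ‖M f‖ ≤ C * ∏ j, schwartzNorm N (f j) := by
  induction n with
  | zero =>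
    refine ⟨0, ‖M 0‖, norm_nonneg _, fun f => ?_⟩
    rw [Subsingleton.elim f 0]
    simp
  | succ n ih =>
    -- By the induction hypothesis the closed sets `A N` cover Schwartz space, so by Baire one of
    -- them contains a neighbourhood of some `u₀`. Subtracting the value at `u₀` and rescaling turns
    -- this into a bound by a seminorm of `u`.
    let A : ℕ → Set 𝓢(Spacetime, ℂ) := fun N =>
      {u | ∀ f, ‖M.curryLeft u f‖ ≤ N * ∏ j, schwartzNorm N (f j)}
    have hclosed : ∀ N, IsClosed (A N) := fun N => by
      simp only [A, Set.ofPred_forall]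
      exact isClosed_iInter fun f => isClosed_le (hM.continuous_cons f).norm continuous_const
    have hunion : ⋃ N, A N = Set.univ := by
      refine Set.eq_univ_of_forall fun u => ?_
      obtain ⟨N, C, hC, h⟩ := ih (hM.curryLeft u)
      obtain ⟨N', hN'⟩ := exists_nat_ge C
      refine Set.mem_iUnion.2 ⟨max N N', fun f => (h f).trans ?_⟩
      refine mul_le_mul (hN'.trans (by exact_mod_cast le_max_right _ _)) ?_
        (Finset.prod_nonneg fun j _ => apply_nonneg _ _) (by positivity)
      exact Finset.prod_le_prod (fun j _ => apply_nonneg _ _)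
        fun j _ => schwartzNorm_mono (le_max_left _ _) _
    obtain ⟨N, u₀, hu₀⟩ := nonempty_interior_of_iUnion_of_closed hclosed hunion
    have hV : {u | u₀ + u ∈ A N} ∈ 𝓝 (0 : 𝓢(Spacetime, ℂ)) := by
      have h1 : Tendsto (fun u : 𝓢(Spacetime, ℂ) => u₀ + u) (𝓝 0) (𝓝 u₀) := by
        simpa using (continuous_const_add u₀).tendsto (0 : 𝓢(Spacetime, ℂ))
      exact h1 (mem_interior_iff_mem_nhds.1 hu₀)
    obtain ⟨N', r, hr, hN'⟩ := exists_schwartzNorm_ball_subset hV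
    refine ⟨max N N', 2 * N / r, by positivity, fun f => ?_⟩
    obtain ⟨u, f, rfl⟩ : ∃ u f', f = Fin.cons u f' := ⟨f 0, Fin.tail f, (Fin.cons_self_tail f).symm⟩
    set P : ℝ := ∏ j, schwartzNorm N (f j)
    have hP : 0 ≤ P := Finset.prod_nonneg fun j _ => apply_nonneg _ _
    set S : ℝ := schwartzNorm N' u
    have hS : 0 ≤ S := apply_nonneg _ _
    have key : ∀ v, schwartzNorm N' v < r → ‖M.curryLeft v f‖ ≤ 2 * N * P := fun v hv => by
      have h1 : ‖M.curryLeft (u₀ + v) f‖ ≤ N * P := hN' v hv f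
      have h2 : ‖M.curryLeft u₀ f‖ ≤ N * P := interior_subset hu₀ f
      rw [map_add, add_apply] at h1
      have h3 := norm_sub_le (M.curryLeft u₀ f + M.curryLeft v f) (M.curryLeft u₀ f)
      rw [add_sub_cancel_left] at h3
      linarith
    have h1 : ‖M.curryLeft u f‖ * r ≤ 2 * N * P * S := by
      -- The additional `δ` avoids a division by `S`, which may be zero.
      refine le_of_forall_pos_le_add fun ε hε => ?_
      obtain ⟨δ, hδ, hδ'⟩ : ∃ δ > 0, 2 * N * P * δ ≤ ε :=
        ⟨ε / (2 * N * P + 1), by positivity, by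
          rw [mul_div_assoc', div_le_iff₀ (by positivity)]; nlinarith⟩
      have hpos : 0 < S + δ := by linarith
      have h2 := key (((r / (S + δ) : ℝ) : ℂ) • u) (by
        rw [map_smul_eq_mul, Complex.norm_real, Real.norm_of_nonneg (by positivity),
          div_mul_eq_mul_div, div_lt_iff₀ hpos]
        change r * S < r * (S + δ)
        nlinarith)
      rw [map_smul, smul_apply, norm_smul, Complex.norm_real,
        Real.norm_of_nonneg (by positivity), div_mul_eq_mul_div, div_le_iff₀ hpos] at h2
      nlinarith
    rw [Fin.prod_univ_succ, Fin.cons_zero]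
    simp only [Fin.cons_succ]
    have h4 : S ≤ schwartzNorm (max N N') u := schwartzNorm_mono (le_max_right _ _) _
    have h5 : P ≤ ∏ j, schwartzNorm (max N N') (f j) :=
      Finset.prod_le_prod (fun j _ => apply_nonneg _ _)
        fun j _ => schwartzNorm_mono (le_max_left _ _) _
    have h6 : ‖M (Fin.cons u f)‖ ≤ 2 * N / r * (S * P) := by
      rw [div_mul_eq_mul_div, le_div_iff₀ hr]
      calc _ ≤ 2 * N * P * S := h1
        _ = _ := by ring
    refine h6.trans ?_
    gcongr

/-- The values of a separately continuous multilinear map at frame functions are polynomially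
bounded. -/
theorem SeparatelyContinuous.exists_frame_bound {n : ℕ}
    {M : MultilinearMap ℂ (fun _ : Fin n => 𝓢(Spacetime, ℂ)) H} (hM : SeparatelyContinuous M) :
    ∃ (N : ℕ) (C : ℝ), 0 ≤ C ∧ ∀ m : Fin n → FrameIndex, ‖M fun j => frameFun (m j)‖ ≤
      C * frameWeight (frameIndexEquiv n m) ^ N := by
  obtain ⟨N, C, hC, h⟩ := hM.exists_bound
  obtain ⟨N', C', hC', h'⟩ := exists_frameFun_le (ι := Fin 4) N
  refine ⟨N' * n, C * C' ^ n, by positivity, fun m => (h _).trans ?_⟩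
  rw [mul_assoc]
  refine mul_le_mul_of_nonneg_left ?_ hC
  calc ∏ j, schwartzNorm N (frameFun (m j))
      ≤ ∏ _j : Fin n, C' * frameWeight (frameIndexEquiv n m) ^ N' := by
        refine Finset.prod_le_prod (fun j _ => apply_nonneg _ _) fun j _ => (h' _).trans ?_
        have h1 := zero_le_one.trans (one_le_frameWeight (m j))
        have h2 := frameWeight_le m j
        gcongr
    _ = _ := by
      rw [Finset.prod_const, Finset.card_univ, Fintype.card_fin, mul_pow, ← pow_mul]

theorem SeparatelyContinuous.summable_frame {n : ℕ}
    {M : MultilinearMap ℂ (fun _ : Fin n => 𝓢(Spacetime, ℂ)) H} (hM : SeparatelyContinuous M)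
    (F : 𝓢(Points n, ℂ)) :
    Summable fun m : Fin n → FrameIndex =>
      ‖(∫ x, F x * prodFun n (fun j => frameDual (m j)) x) • M fun j => frameFun (m j)‖ := by
  obtain ⟨N, C, hC, h⟩ := hM.exists_frame_bound
  have h1 := (frameIndexEquiv n).summable_iff.2 (summable_frameCoeff_mul N F)
  simp only [Function.comp_def, frameDual_frameIndexEquiv] at h1
  refine Summable.of_nonneg_of_le (fun m => norm_nonneg _) (fun m => ?_) (h1.mul_left C)
  rw [norm_smul]
  have := h m
  calc _ ≤ ‖∫ x, F x * prodFun n (fun j => frameDual (m j)) x‖ *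
        (C * frameWeight (frameIndexEquiv n m) ^ N) := by gcongr
    _ = _ := by ring

variable [CompleteSpace H]

/-- The linear extension of a multilinear map to functions of several variables. -/
theorem SeparatelyContinuous.exists_clm {n : ℕ}
    {M : MultilinearMap ℂ (fun _ : Fin n => 𝓢(Spacetime, ℂ)) H} (hM : SeparatelyContinuous M) :
    ∃ L : 𝓢(Points n, ℂ) →L[ℂ] H, ∀ F, L F = ∑' m : Fin n → FrameIndex,
      (∫ x, F x * prodFun n (fun j => frameDual (m j)) x) • M fun j => frameFun (m j) := by
  have hint : ∀ F G : 𝓢(Points n, ℂ), Integrable fun x => F x * G x := fun F G =>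
    (mulCLM G F).integrable
  refine ⟨SchwartzMap.mkCLMtoNormedSpace (𝕜 := ℂ) (fun F => ∑' m : Fin n → FrameIndex,
      (∫ x, F x * prodFun n (fun j => frameDual (m j)) x) • M fun j => frameFun (m j)) ?_ ?_ ?_,
    fun F => rfl⟩
  · intro F G
    rw [← (hM.summable_frame F).of_norm.tsum_add (hM.summable_frame G).of_norm]
    refine tsum_congr fun m => ?_
    rw [← add_smul, ← integral_add (hint _ _) (hint _ _)]
    simp only [add_apply, add_mul]
  · intro c F
    rw [RingHom.id_apply, ← tsum_const_smul'' c]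
    refine tsum_congr fun m => ?_
    rw [smul_smul, ← integral_const_mul]
    simp only [smul_apply, smul_eq_mul, mul_assoc]
  · obtain ⟨N, C, hC, h⟩ := hM.exists_frame_bound
    set d := 2 * Fintype.card (Fin n × Fin 4)
    obtain ⟨N', C', hC', h'⟩ := exists_frameCoeff_le (ι := Fin n × Fin 4) (N + d)
    have hs := (frameIndexEquiv n).summable_iff.2
      (summable_frameWeight (ι := Fin n × Fin 4))
    set S := ∑' m, ((fun m : (Fin n × Fin 4 → ℤ) × (Fin n × Fin 4 → ℤ) =>
      (frameWeight m ^ d)⁻¹) ∘ frameIndexEquiv n) m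
    have hS : 0 ≤ S := tsum_nonneg fun m => by
      have := one_le_frameWeight (frameIndexEquiv n m)
      simp only [Function.comp_apply]
      positivity
    refine ⟨Finset.Iic (N', N'), C * C' * S, by positivity, fun F => ?_⟩
    refine (norm_tsum_le_tsum_norm (hM.summable_frame F)).trans ?_
    change _ ≤ C * C' * S * schwartzNorm N' F
    have hle : ∀ m, ‖(∫ x, F x * prodFun n (fun j => frameDual (m j)) x) •
        M fun j => frameFun (m j)‖ ≤ C * C' * schwartzNorm N' F *
          ((fun m : (Fin n × Fin 4 → ℤ) × (Fin n × Fin 4 → ℤ) =>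
      (frameWeight m ^ d)⁻¹) ∘ frameIndexEquiv n) m := fun m => by
      rw [norm_smul]
      simp only [Function.comp_apply]
      have hw := one_le_frameWeight (frameIndexEquiv n m)
      have h1 := h' F (frameIndexEquiv n m)
      rw [frameDual_frameIndexEquiv] at h1
      have h2 := h m
      rw [← div_eq_mul_inv, le_div_iff₀ (by positivity)]
      calc _ ≤ ‖∫ x, F x * prodFun n (fun j => frameDual (m j)) x‖ *
            (C * frameWeight (frameIndexEquiv n m) ^ N) * frameWeight (frameIndexEquiv n m) ^ d := by
            gcongr
        _ = C * (frameWeight (frameIndexEquiv n m) ^ (N + d) *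
            ‖∫ x, F x * prodFun n (fun j => frameDual (m j)) x‖) := by rw [pow_add]; ring
        _ ≤ C * (C' * schwartzNorm N' F) := by gcongr
        _ = _ := by ring
    refine (Summable.tsum_le_tsum hle (hM.summable_frame F) (hs.mul_left _)).trans_eq ?_
    rw [tsum_mul_left]
    ring

/-- The variables are expanded one after the other, for which separate continuity suffices. The
family over all indices is known to be summable, so its sum equals the iterated sum. -/
theorem SeparatelyContinuous.hasSum {n : ℕ}
    {M : MultilinearMap ℂ (fun _ : Fin n => 𝓢(Spacetime, ℂ)) H} (hM : SeparatelyContinuous M)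
    (f : Fin n → 𝓢(Spacetime, ℂ)) :
    HasSum (fun m : Fin n → FrameIndex =>
      (∏ j, ∫ x, f j x * frameDual (m j) x) • M fun j => frameFun (m j)) (M f) := by
  have hs := (hM.summable_frame (prodFun n f)).of_norm
  simp only [integral_prodFun_mul_prodFun] at hs
  induction n with
  | zero =>
    have h := hasSum_unique fun m : Fin 0 → FrameIndex =>
      (∏ j, ∫ x, f j x * frameDual (m j) x) • M fun j => frameFun (m j)
    simp only [Finset.univ_eq_empty, Finset.prod_empty, one_smul] at h ⊢
    convert h using 2
  | succ n ih =>
    obtain ⟨u, f, rfl⟩ : ∃ u f', f = Fin.cons u f' := ⟨f 0, Fin.tail f, (Fin.cons_self_tail f).symm⟩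
    have e : (fun m : FrameIndex × (Fin n → FrameIndex) =>
        (∫ x, u x * frameDual m.1 x) • (∏ j, ∫ x, f j x * frameDual (m.2 j) x) •
          M.curryLeft (frameFun m.1) fun j => frameFun (m.2 j)) =
        (fun m : Fin (n + 1) → FrameIndex =>
        (∏ j, ∫ x, (Fin.cons u f : Fin (n + 1) → 𝓢(Spacetime, ℂ)) j x * frameDual (m j) x) •
          M fun j => frameFun (m j)) ∘ Fin.consEquiv fun _ => FrameIndex := by
      funext m
      simp only [Function.comp_apply, Fin.consEquiv_apply, Fin.prod_univ_succ, Fin.cons_zero,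
        Fin.cons_succ, smul_smul, MultilinearMap.curryLeft_apply]
      congr 2
      funext j
      refine Fin.cases ?_ (fun j => ?_) j <;> simp
    have hs' := (Fin.consEquiv fun _ : Fin (n + 1) => FrameIndex).summable_iff.2 hs
    refine (Fin.consEquiv fun _ : Fin (n + 1) => FrameIndex).hasSum_iff.1 ?_
    rw [← e] at hs' ⊢
    have inner : ∀ i : FrameIndex, HasSum (fun m : Fin n → FrameIndex =>
        (∫ x, u x * frameDual i x) • (∏ j, ∫ x, f j x * frameDual (m j) x) •
          M.curryLeft (frameFun i) fun j => frameFun (m j))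
        ((∫ x, u x * frameDual i x) • M.curryLeft (frameFun i) f) := fun i => by
      have hi := hM.curryLeft (frameFun i)
      have h1 := (hi.summable_frame (prodFun n f)).of_norm
      simp only [integral_prodFun_mul_prodFun] at h1
      exact (ih hi f h1).const_smul _
    have outer := hs'.hasSum.prod_fiberwise inner
    have h2 : HasSum (fun i : FrameIndex => (∫ x, u x * frameDual i x) •
        M.curryLeft (frameFun i) f) (M.curryLeft u f) := by
      have h3 := (hasSum_frame u).map (⟨⟨fun v => M.curryLeft v f, by simp⟩, by simp⟩ :
        𝓢(Spacetime, ℂ) →ₗ[ℂ] H) (hM.continuous_cons f)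
      refine (congrArg (fun w => HasSum w (M.curryLeft u f)) (funext fun b => ?_)).mp h3
      rw [Function.comp_apply, map_smul]
      rfl
    rw [show M (Fin.cons u f) = M.curryLeft u f from rfl, ← outer.unique h2]
    exact hs'.hasSum

/-- The kernel theorem: a separately continuous multilinear map on a power of Schwartz space extends
to a continuous linear map on Schwartz functions of several variables. -/
theorem SeparatelyContinuous.exists_kernel {n : ℕ}
    {M : MultilinearMap ℂ (fun _ : Fin n => 𝓢(Spacetime, ℂ)) H} (hM : SeparatelyContinuous M) :
    ∃ L : 𝓢(Points n, ℂ) →L[ℂ] H, ∀ f, L (prodFun n f) = M f := by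
  obtain ⟨L, hL⟩ := hM.exists_clm
  refine ⟨L, fun f => ?_⟩
  rw [hL, ← (hM.hasSum f).tsum_eq]
  simp only [integral_prodFun_mul_prodFun]

end Kernel

/-! ### Integrals over translations -/

section Slices

/-- The tuple `(y, x₁, …, xₙ)`. -/
def joinPoints {n : ℕ} (y : Spacetime) (x : Points n) : Points (n + 1) :=
  (splitPoints n).symm (WithLp.toLp 2 (y, x))

@[simp]
theorem point_zero_joinPoints {n : ℕ} (y : Spacetime) (x : Points n) :
    Points.point 0 (joinPoints y x) = y := rfl

@[simp]
theorem tail_joinPoints {n : ℕ} (y : Spacetime) (x : Points n) :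
    Points.tail (joinPoints y x) = x := rfl

theorem joinPoints_add {n : ℕ} (y y' : Spacetime) (x x' : Points n) :
    joinPoints (y + y') (x + x') = joinPoints y x + joinPoints y' x' :=
  (splitPoints n).symm.map_add (WithLp.toLp 2 (y, x)) (WithLp.toLp 2 (y', x'))

theorem joinPoints_smul {n : ℕ} (c : ℝ) (y : Spacetime) (x : Points n) :
    joinPoints (c • y) (c • x) = c • joinPoints y x :=
  (splitPoints n).symm.map_smul c (WithLp.toLp 2 (y, x))

/-- `x ↦ (0, x₁, …, xₙ)` as a linear map. -/
def joinZero (n : ℕ) : Points n →L[ℝ] Points (n + 1) :=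
  LinearMap.toContinuousLinearMap
    { toFun := fun x => joinPoints 0 x
      map_add' := fun x y => by rw [← joinPoints_add, add_zero]
      map_smul' := fun c x => by rw [RingHom.id_apply, ← joinPoints_smul, smul_zero] }

theorem joinPoints_eq {n : ℕ} (y : Spacetime) (x : Points n) :
    joinPoints y x = joinPoints y 0 + joinZero n x := by
  change joinPoints y x = joinPoints y 0 + joinPoints 0 x
  rw [← joinPoints_add, add_zero, zero_add]

theorem norm_sq_split {n : ℕ} (x : Points (n + 1)) :
    ‖x‖ ^ 2 = ‖Points.point 0 x‖ ^ 2 + ‖Points.tail x‖ ^ 2 := by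
  rw [← (splitPoints n).norm_map x, splitPoints_apply, WithLp.prod_norm_sq_eq_of_L2]
  rfl

theorem norm_tail_le {n : ℕ} (x : Points (n + 1)) : ‖Points.tail x‖ ≤ ‖x‖ := by
  rw [← sq_le_sq₀ (norm_nonneg _) (norm_nonneg _), norm_sq_split]
  nlinarith [sq_nonneg ‖Points.point 0 x‖]

theorem norm_le_split {n : ℕ} (x : Points (n + 1)) :
    ‖x‖ ≤ ‖Points.point 0 x‖ + ‖Points.tail x‖ := by
  rw [← sq_le_sq₀ (norm_nonneg _) (by positivity), norm_sq_split]
  nlinarith [mul_nonneg (norm_nonneg (Points.point 0 x)) (norm_nonneg (Points.tail x))]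

/-- The function `x ↦ G(y, x₁, …, xₙ)`. -/
def sliceCLM {n : ℕ} (y : Spacetime) : 𝓢(Points (n + 1), ℂ) →L[ℂ] 𝓢(Points n, ℂ) :=
  SchwartzMap.compCLM ℂ (g := fun x => joinPoints y x)
    (by
      rw [funext (joinPoints_eq y)]
      exact (Function.HasTemperateGrowth.const _).add (joinZero n).hasTemperateGrowth)
    ⟨1, 1, fun x => by
      have h := norm_tail_le (joinPoints y x)
      rw [tail_joinPoints] at h
      linarith⟩

theorem sliceCLM_tensor {n : ℕ} (y : Spacetime) (f : 𝓢(Spacetime, ℂ)) (g : 𝓢(Points n, ℂ)) :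
    sliceCLM y (tensor f g) = f y • g := rfl

/-- The function `∫ G(y, x₁, …, xₙ) dy`. -/
def marginalCLM (n : ℕ) : 𝓢(Points (n + 1), ℂ) →L[ℂ] 𝓢(Points n, ℂ) :=
  -- Integrating over the first variable restricts the Fourier transform to first momentum zero; in
  -- this form continuity comes for free.
  (FourierTransform.fourierInvCLM ℂ 𝓢(Points n, ℂ)).comp
    ((sliceCLM 0).comp (FourierTransform.fourierCLM ℂ 𝓢(Points (n + 1), ℂ)))

theorem marginalCLM_tensor {n : ℕ} (f : 𝓢(Spacetime, ℂ)) (g : 𝓢(Points n, ℂ)) :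
    marginalCLM n (tensor f g) = (∫ y, f y) • g := by
  change 𝓕⁻ (sliceCLM 0 (𝓕 (tensor f g))) = _
  rw [fourier_tensor, sliceCLM_tensor, FourierTransform.fourierInv_smul,
    FourierTransform.fourierInv_fourier_eq]
  congr 1
  rw [SchwartzMap.fourier_coe, Real.fourier_eq']
  simp

theorem norm_character {ι : Type*} [Fintype ι] (b x : EuclideanSpace ℝ ι) :
    ‖character b x‖ = 1 := by
  rw [character, Complex.norm_exp_ofReal_mul_I]

/-- The character has modulus one and the bump is translated, so the `L¹` norm does not depend on
the index. This dominates the frame expansion when sum and integral are exchanged in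
`integral_clm_slice`. -/
theorem integral_norm_frameFun {ι : Type*} [Fintype ι] (m : (ι → ℤ) × (ι → ℤ)) :
    ∫ x, ‖frameFun m x‖ = ∫ x, ‖(framePlateau 0 : 𝓢(EuclideanSpace ℝ ι, ℂ)) x‖ := by
  simp only [frameFun_apply, norm_mul, norm_character, one_mul]
  rw [← integral_sub_right_eq_self (fun x => ‖(framePlateau 0 : 𝓢(EuclideanSpace ℝ ι, ℂ)) x‖)
    (quarterVec m.1)]
  refine integral_congr_ae (Eventually.of_forall fun x => ?_)
  simp only [framePlateau, SchwartzMap.compSubConstCLM_apply]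
  have : quarterVec (0 : ι → ℤ) = 0 := by ext i; simp
  rw [this, sub_zero]

/-- A continuous linear map commutes with the integration over the first variable. -/
theorem integral_clm_slice {H : Type*} [NormedAddCommGroup H] [NormedSpace ℂ H] [CompleteSpace H]
    {n : ℕ} (L : 𝓢(Points n, ℂ) →L[ℂ] H) (G : 𝓢(Points (n + 1), ℂ)) :
    ∫ y, L (sliceCLM y G) = L (marginalCLM n G) := by
  set c : (Fin (n + 1) → FrameIndex) → ℂ := fun m =>
    ∫ x, G x * prodFun (n + 1) (fun j => frameDual (m j)) x
  set g : (Fin (n + 1) → FrameIndex) → 𝓢(Points n, ℂ) := fun m =>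
    prodFun n (fun j => frameFun (m j.succ))
  have hG : HasSum (fun m => c m • tensor (frameFun (m 0)) (g m)) G := hasSum_prodFrame G
  set F : (Fin (n + 1) → FrameIndex) → Spacetime → H := fun m y =>
    (c m * frameFun (m 0) y) • L (g m)
  have hF : ∀ y, HasSum (fun m => F m y) (L (sliceCLM y G)) := fun y => by
    have h := hG.mapL (L.comp (sliceCLM y))
    refine (congrArg (fun w => HasSum w (L (sliceCLM y G))) (funext fun m => ?_)).mp h
    rw [map_smul, ContinuousLinearMap.comp_apply, sliceCLM_tensor, map_smul, smul_smul]
  have hM : HasSum (fun m => ∫ y, F m y) (L (marginalCLM n G)) := by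
    have h := hG.mapL (L.comp (marginalCLM n))
    refine (congrArg (fun w => HasSum w (L (marginalCLM n G))) (funext fun m => ?_)).mp h
    rw [map_smul, ContinuousLinearMap.comp_apply, marginalCLM_tensor, map_smul, smul_smul,
      integral_smul_const, integral_const_mul]
  have hint : ∀ m, Integrable (F m) := fun m =>
    ((frameFun (m 0)).integrable.const_mul (c m)).smul_const _
  have hs : Summable fun m => ∫ y, ‖F m y‖ := by
    obtain ⟨N₁, C₁, hC₁, h₁⟩ := exists_norm_clm_le L
    obtain ⟨N', C', hC', h'⟩ := exists_frameFun_le (ι := Fin n × Fin 4) N₁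
    have h1 := (frameIndexEquiv (n + 1)).summable_iff.2 (summable_frameCoeff_mul N' G)
    simp only [Function.comp_def, frameDual_frameIndexEquiv] at h1
    set I : ℝ := ∫ x, ‖(framePlateau 0 : 𝓢(Spacetime, ℂ)) x‖
    have hI : 0 ≤ I := integral_nonneg fun x => norm_nonneg _
    refine Summable.of_nonneg_of_le (fun m => integral_nonneg fun y => norm_nonneg _) (fun m => ?_)
      (h1.mul_left (I * (C₁ * C')))
    simp only [F, norm_smul, norm_mul]
    rw [integral_mul_const, integral_const_mul, integral_norm_frameFun]
    have hw := one_le_frameWeight (frameIndexEquiv n fun j => m j.succ)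
    have hle : frameWeight (frameIndexEquiv n fun j => m j.succ) ≤
        frameWeight (frameIndexEquiv (n + 1) m) := by
      have h1 : ‖quarterVec (frameIndexEquiv n fun j => m j.succ).1‖ ≤
          ‖quarterVec (frameIndexEquiv (n + 1) m).1‖ :=
        norm_tail_le (quarterVec (frameIndexEquiv (n + 1) m).1)
      have h2 : ‖intVec (frameIndexEquiv n fun j => m j.succ).2‖ ≤
          ‖intVec (frameIndexEquiv (n + 1) m).2‖ :=
        norm_tail_le (intVec (frameIndexEquiv (n + 1) m).2)
      rw [frameWeight, frameWeight]
      gcongr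
    have h2 : ‖L (g m)‖ ≤ C₁ * (C' * frameWeight (frameIndexEquiv (n + 1) m) ^ N') := by
      refine (h₁ _).trans ?_
      gcongr
      simp only [g]
      rw [← frameFun_frameIndexEquiv]
      refine (h' _).trans ?_
      gcongr
    calc ‖c m‖ * I * ‖L (g m)‖ ≤ ‖c m‖ * I *
          (C₁ * (C' * frameWeight (frameIndexEquiv (n + 1) m) ^ N')) := by gcongr
      _ = _ := by ring
  have h := hasSum_integral_of_summable_integral_norm hint hs
  rw [hM.unique h]
  exact integral_congr_ae (Eventually.of_forall fun y => ((hF y).tsum_eq).symm)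

/-- The tuple `(y, …, y)`. -/
def diagPoints (n : ℕ) : Spacetime →L[ℝ] Points n :=
  LinearMap.toContinuousLinearMap
    { toFun := fun y => WithLp.toLp 2 fun jμ => y jμ.2
      map_add' := fun x y => by ext μ; simp
      map_smul' := fun c x => by ext μ; simp }

/-- The sum `q₁ + ⋯ + qₙ`. -/
def sumPoints (n : ℕ) : Points n →L[ℝ] Spacetime := ∑ j, Points.point j

theorem sumPoints_apply {n : ℕ} (q : Points n) : sumPoints n q = ∑ j, Points.point j q := by
  rw [sumPoints, sum_apply]

theorem sumPoints_succ {n : ℕ} (q : Points (n + 1)) :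
    sumPoints (n + 1) q = Points.point 0 q + sumPoints n (Points.tail q) := by
  rw [sumPoints_apply, sumPoints_apply, Fin.sum_univ_succ]
  rfl

theorem inner_diagPoints {n : ℕ} (y : Spacetime) (q : Points n) :
    inner ℝ (diagPoints n y) q = inner ℝ y (sumPoints n q) := by
  rw [sumPoints_apply, inner_sum]
  simp only [PiLp.inner_apply, Fintype.sum_prod_type]
  rfl

theorem fourier_compSubConst {ι : Type*} [Fintype ι] (a : EuclideanSpace ℝ ι)
    (g : 𝓢(EuclideanSpace ℝ ι, ℂ)) (w : EuclideanSpace ℝ ι) :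
    𝓕 (SchwartzMap.compSubConstCLM ℂ a g) w =
      Complex.exp (((-2 * Real.pi * inner ℝ a w : ℝ) : ℂ) * Complex.I) * 𝓕 g w := by
  rw [SchwartzMap.fourier_coe, SchwartzMap.fourier_coe, Real.fourier_eq', Real.fourier_eq',
    ← integral_add_right_eq_self _ a, ← integral_const_mul]
  congr 1
  funext x
  rw [SchwartzMap.compSubConstCLM_apply, add_sub_cancel_right, inner_add_left, smul_eq_mul,
    smul_eq_mul, ← mul_assoc, ← Complex.exp_add]
  congr 2
  push_cast
  ring

/-- Multiplication of the Fourier transform of `g` with `b(q₁ + ⋯ + qₙ)`. -/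
def momentumCut {n : ℕ} (b : 𝓢(Spacetime, ℂ)) : 𝓢(Points n, ℂ) →L[ℂ] 𝓢(Points n, ℂ) :=
  (FourierTransform.fourierInvCLM ℂ 𝓢(Points n, ℂ)).comp
    ((SchwartzMap.smulLeftCLM ℂ fun q => b (sumPoints n q)).comp
      (FourierTransform.fourierCLM ℂ 𝓢(Points n, ℂ)))

theorem hasTemperateGrowth_comp_sumPoints {n : ℕ} (b : 𝓢(Spacetime, ℂ)) :
    (fun q : Points n => b (sumPoints n q)).HasTemperateGrowth :=
  b.hasTemperateGrowth.comp (sumPoints n).hasTemperateGrowth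

theorem fourier_momentumCut {n : ℕ} (b : 𝓢(Spacetime, ℂ)) (g : 𝓢(Points n, ℂ)) (q : Points n) :
    𝓕 (momentumCut b g) q = b (sumPoints n q) * 𝓕 g q := by
  change 𝓕 (𝓕⁻ (SchwartzMap.smulLeftCLM ℂ (fun q => b (sumPoints n q)) (𝓕 g))) q = _
  rw [FourierTransform.fourier_fourierInv_eq,
    SchwartzMap.smulLeftCLM_apply_apply (hasTemperateGrowth_comp_sumPoints b), smul_eq_mul]

theorem controls_shear (n : ℕ) : Controls (Points.point (n := n + 1) 0)
    (Points.tail (n := n) - (diagPoints n).comp (Points.point 0)) := by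
  refine ⟨1 + 2 * ‖diagPoints n‖ + 1, fun x => ?_⟩
  have h1 := norm_le_split x
  have h2 := norm_le_norm_sub_add (Points.tail x) (diagPoints n (Points.point 0 x))
  have h3 := (diagPoints n).le_opNorm (Points.point 0 x)
  change ‖x‖ ≤ (1 + 2 * ‖diagPoints n‖ + 1) * ((1 + ‖Points.point 0 x‖) *
    (1 + ‖Points.tail x - diagPoints n (Points.point 0 x)‖))
  set a := ‖Points.point 0 x‖
  set b := ‖Points.tail x - diagPoints n (Points.point 0 x)‖
  set D := ‖diagPoints n‖
  have ha : 0 ≤ a := norm_nonneg _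
  have hb : 0 ≤ b := norm_nonneg _
  have hD : 0 ≤ D := norm_nonneg _
  have h4 : ‖x‖ ≤ a + (b + D * a) := by linarith
  have : 0 ≤ a * b := by positivity
  have : 0 ≤ D * a := by positivity
  have : 0 ≤ D * b := by positivity
  have : 0 ≤ D * (a * b) := by positivity
  nlinarith

/-- The function `h(y) g(x₁ - y, …, xₙ - y)`. -/
def shearTensor {n : ℕ} (h : 𝓢(Spacetime, ℂ)) (g : 𝓢(Points n, ℂ)) : 𝓢(Points (n + 1), ℂ) :=
  mulCompCLM _ _ (controls_shear n) g h

theorem integral_clm_translate_eq_marginal {H : Type*} [NormedAddCommGroup H] [NormedSpace ℂ H]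
    [CompleteSpace H] {n : ℕ} (L : 𝓢(Points n, ℂ) →L[ℂ] H) (h : 𝓢(Spacetime, ℂ))
    (g : 𝓢(Points n, ℂ)) :
    ∫ y, h y • L (SchwartzMap.compSubConstCLM ℂ (diagPoints n y) g) =
      L (marginalCLM n (shearTensor h g)) := by
  have hG : ∀ y, sliceCLM y (shearTensor h g) =
      h y • SchwartzMap.compSubConstCLM ℂ (diagPoints n y) g := fun y => rfl
  rw [← integral_clm_slice]
  simp only [hG, map_smul]

/-- The evaluation of a Schwartz function at a point. -/
def evalCLM {E : Type*} [NormedAddCommGroup E] [NormedSpace ℝ E] (x : E) : 𝓢(E, ℂ) →L[ℂ] ℂ :=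
  SchwartzMap.mkCLMtoNormedSpace (𝕜 := ℂ) (fun f => f x) (fun _ _ => rfl) (fun _ _ => rfl)
    ⟨{(0, 0)}, 1, zero_le_one, fun f => by
      simpa using SchwartzMap.norm_le_seminorm ℂ f x⟩

/-- The average of the translates of `g` with weight `h` is a cut in momentum space. -/
theorem integral_clm_translate {H : Type*} [NormedAddCommGroup H] [NormedSpace ℂ H]
    [CompleteSpace H] {n : ℕ} (L : 𝓢(Points n, ℂ) →L[ℂ] H) (h : 𝓢(Spacetime, ℂ))
    (g : 𝓢(Points n, ℂ)) :
    ∫ y, h y • L (SchwartzMap.compSubConstCLM ℂ (diagPoints n y) g) = L (momentumCut (𝓕 h) g) := by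
  rw [integral_clm_translate_eq_marginal]
  congr 1
  suffices hq : 𝓕 (marginalCLM n (shearTensor h g)) = 𝓕 (momentumCut (𝓕 h) g) by
    rw [← FourierTransform.fourierInv_fourier_eq (F := 𝓢(Points n, ℂ)) (marginalCLM n _), hq,
      FourierTransform.fourierInv_fourier_eq]
  ext q
  -- The marginal is identified by the scalar functionals `g ↦ 𝓕 g q`. For them translation is a
  -- phase in the total momentum, and its average with weight `h` is the value of `𝓕 h` there.
  have hq := integral_clm_translate_eq_marginal ((evalCLM q).comp
    (FourierTransform.fourierCLM ℂ 𝓢(Points n, ℂ))) h g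
  change ∫ y, h y • 𝓕 (SchwartzMap.compSubConstCLM ℂ (diagPoints n y) g) q =
    𝓕 (marginalCLM n (shearTensor h g)) q at hq
  rw [← hq, fourier_momentumCut, SchwartzMap.fourier_coe, Real.fourier_eq', ← integral_mul_const]
  congr 1
  funext y
  rw [fourier_compSubConst, inner_diagPoints, smul_eq_mul, smul_eq_mul]
  ring

end Slices

/-! ### Vector-valued distributions of a Wightman theory -/

section Wightman

variable {K : ℕ} {H : Type*} [NormedAddCommGroup H] [InnerProductSpace ℂ H]

/-- A linear map from Schwartz space to a Hilbert space is continuous if its matrix elements with the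
vectors of a dense set are continuous. -/
theorem continuous_of_continuous_inner {E : Type*} [NormedAddCommGroup E] [NormedSpace ℝ E]
    {D : Set H} (hD : Dense D) (T : 𝓢(E, ℂ) →ₗ[ℂ] H)
    (h : ∀ v ∈ D, Continuous fun f => inner ℂ v (T f)) : Continuous T := by
  -- The condition `‖T f‖ ≤ r` can be tested on the dense set, so `‖T f‖` is a lower semicontinuous
  -- seminorm of `f`. On a barrelled space, as Schwartz space is by Baire's theorem, such a seminorm
  -- is continuous.
  have hsub : ∀ r : ℝ, 0 ≤ r → {f | ‖T f‖ ≤ r} = ⋂ v ∈ D, {f | ‖inner ℂ v (T f)‖ ≤ r * ‖v‖} := by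
    intro r hr
    ext f
    simp only [Set.mem_iInter, Set.mem_ofPred_eq]
    constructor
    · intro hf v _
      calc ‖inner ℂ v (T f)‖ ≤ ‖v‖ * ‖T f‖ := norm_inner_le_norm _ _
        _ ≤ ‖v‖ * r := by gcongr
        _ = r * ‖v‖ := mul_comm _ _
    · intro hf
      have hall : ∀ v : H, ‖inner ℂ v (T f)‖ ≤ r * ‖v‖ := by
        have hcl : IsClosed {v : H | ‖inner ℂ v (T f)‖ ≤ r * ‖v‖} :=
          isClosed_le (by fun_prop) (by fun_prop)
        intro v
        exact hcl.closure_subset_iff.2 (fun v hv => hf v hv) (hD v)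
      have h1 := hall (T f)
      rw [inner_self_eq_norm_sq_to_K] at h1
      simp only [norm_pow, RCLike.norm_ofReal, abs_norm] at h1
      by_contra hc
      push Not at hc
      nlinarith
  have hlsc : LowerSemicontinuous ((normSeminorm ℂ H).comp T) := by
    rw [lowerSemicontinuous_iff_isClosed_preimage]
    intro r
    by_cases hr : 0 ≤ r
    · have h1 : (⇑((normSeminorm ℂ H).comp T)) ⁻¹' Set.Iic r = {f | ‖T f‖ ≤ r} := rfl
      rw [h1, hsub r hr]
      exact isClosed_biInter fun v hv => isClosed_le (h v hv).norm continuous_const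
    · have h1 : (⇑((normSeminorm ℂ H).comp T)) ⁻¹' Set.Iic r = ∅ := by
        refine Set.eq_empty_of_forall_notMem fun f hf => hr ?_
        exact (norm_nonneg (T f)).trans hf
      rw [h1]
      exact isClosed_empty
  have hc := Seminorm.continuous_of_lowerSemicontinuous _ hlsc
  refine continuous_of_continuousAt_zero T ?_
  rw [ContinuousAt, map_zero, tendsto_zero_iff_norm_tendsto_zero]
  have := hc.tendsto 0
  rw [map_zero] at this
  exact this

/-- The vector `φ_{k₁}(f₁) ⋯ φ_{kₙ}(fₙ) Ω` as a multilinear map. -/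
def monomialMulti {V : Type*} [AddCommGroup V] [Module ℂ V]
    (φ : Fin K → 𝓢(Spacetime, ℂ) →ₗ[ℂ] Module.End ℂ V) (Ω : V) :
    (n : ℕ) → (Fin n → Fin K) → MultilinearMap ℂ (fun _ : Fin n => 𝓢(Spacetime, ℂ)) V
  | 0, _ => MultilinearMap.constOfIsEmpty ℂ _ Ω
  | n + 1, k => LinearMap.uncurryLeft
      { toFun := fun u => (φ (k 0) u).compMultilinearMap (monomialMulti φ Ω n (Fin.tail k))
        map_add' := fun u v => by ext f; simp
        map_smul' := fun c u => by ext f; simp }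

theorem monomialMulti_apply {V : Type*} [AddCommGroup V] [Module ℂ V]
    (φ : Fin K → 𝓢(Spacetime, ℂ) →ₗ[ℂ] Module.End ℂ V) (Ω : V) (n : ℕ) (k : Fin n → Fin K)
    (f : Fin n → 𝓢(Spacetime, ℂ)) : monomialMulti φ Ω n k f = monomial φ Ω n k f := by
  induction n with
  | zero => rfl
  | succ n ih =>
    rw [monomial, ← ih]
    rfl

theorem monomial_cons {V : Type*} [AddCommGroup V] [Module ℂ V]
    (φ : Fin K → 𝓢(Spacetime, ℂ) →ₗ[ℂ] Module.End ℂ V) (Ω : V) {n : ℕ} (j : Fin K)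
    (k : Fin n → Fin K) (u : 𝓢(Spacetime, ℂ)) (f : Fin n → 𝓢(Spacetime, ℂ)) :
    monomial φ Ω (n + 1) (Fin.cons j k) (Fin.cons u f) = φ j u (monomial φ Ω n k f) := by
  rw [monomial, Fin.cons_zero, Fin.cons_zero, Fin.tail_cons, Fin.tail_cons]

variable [CompleteSpace H]

namespace WightmanTheory

variable (T : WightmanTheory K H)

theorem dense_dom : Dense (T.dom : Set H) := by
  refine T.cyclic.mono ?_
  rw [SetLike.coe_subset_coe, Submodule.span_le]
  rintro _ ⟨n, k, f, rfl⟩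
  exact Subtype.mem _

/-- Fields to the left of the varying test function are moved to the other vector as adjoints, until
`tempered` applies. -/
theorem continuous_inner_monomial {n : ℕ} (v : T.dom) (k : Fin n → Fin K)
    (f : Fin n → 𝓢(Spacetime, ℂ)) (j : Fin n) :
    Continuous fun u => inner ℂ (v : H)
      ((monomial T.φ T.vacuum n k (Function.update f j u) : T.dom) : H) := by
  induction n generalizing v with
  | zero => exact j.elim0
  | succ n ih =>
    refine Fin.cases ?_ (fun j => ?_) j
    · have h : ∀ u, monomial T.φ T.vacuum (n + 1) k (Function.update f 0 u) =
          T.φ (k 0) u (monomial T.φ T.vacuum n (Fin.tail k) (Fin.tail f)) := fun u => by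
        rw [monomial, Function.update_self, Fin.tail_update_zero]
      simp only [h]
      exact T.tempered _ _ _
    · have h : ∀ u, monomial T.φ T.vacuum (n + 1) k (Function.update f j.succ u) =
          T.φ (k 0) (f 0) (monomial T.φ T.vacuum n (Fin.tail k)
            (Function.update (Fin.tail f) j u)) := fun u => by
        rw [monomial, Function.update_of_ne (Fin.succ_ne_zero j).symm, Fin.tail_update_succ]
      simp only [h, T.adjoint]
      exact ih _ _ _ j

theorem exists_isVectorDistribution (n : ℕ) (k : Fin n → Fin K) :
    ∃ L, T.IsVectorDistribution n k L := by
  set M : MultilinearMap ℂ (fun _ : Fin n => 𝓢(Spacetime, ℂ)) H :=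
    T.dom.subtype.compMultilinearMap (monomialMulti T.φ T.vacuum n k)
  have hM : SeparatelyContinuous M := fun f j => by
    refine continuous_of_continuous_inner T.dense_dom (M.toLinearMap f j) fun v hv => ?_
    have h := T.continuous_inner_monomial ⟨v, hv⟩ k f j
    simp only [← monomialMulti_apply] at h
    exact h
  obtain ⟨L, hL⟩ := hM.exists_kernel
  refine ⟨L, fun f F hF => ?_⟩
  have : F = prodFun n f := by
    ext x
    rw [hF, prodFun_apply]
  rw [this, hL, ← monomialMulti_apply]
  rfl

/-- The vector-valued distributions `Ψⁿ_k` are well defined. -/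
theorem isVectorDistribution_Psi (n : ℕ) (k : Fin n → Fin K) :
    T.IsVectorDistribution n k (T.Psi n k) := by
  have h := T.exists_isVectorDistribution n k
  rw [Psi, dif_pos h]
  exact h.choose_spec

theorem Psi_prodFun {n : ℕ} (k : Fin n → Fin K) (f : Fin n → 𝓢(Spacetime, ℂ)) :
    T.Psi n k (prodFun n f) = ((monomial T.φ T.vacuum n k f : T.dom) : H) :=
  T.isVectorDistribution_Psi n k f _ fun x => prodFun_apply f x

/-- `Ψ(g)` need not lie in the domain of the undeformed fields. A field still acts on it weakly,
through its adjoint on the dense set `T.dom`, and this depends on the vector `Ψ(g)` only and not on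
`g`. -/
theorem inner_Psi_tensor {n : ℕ} (j : Fin K) (k : Fin n → Fin K) (u : 𝓢(Spacetime, ℂ))
    (g : 𝓢(Points n, ℂ)) (v : T.dom) :
    inner ℂ (v : H) (T.Psi (n + 1) (Fin.cons j k) (tensor u g)) =
      inner ℂ (T.φ (T.bar j) (conjTest u) v : H) (T.Psi n k g) := by
  have h : (innerSL ℂ (v : H)).comp ((T.Psi (n + 1) (Fin.cons j k)).comp (tensorRight u)) =
      (innerSL ℂ (T.φ (T.bar j) (conjTest u) v : H)).comp (T.Psi n k) := by
    refine clm_ext_prodFun fun f => ?_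
    simp only [ContinuousLinearMap.comp_apply, innerSL_apply_apply, tensorRight_apply]
    rw [← prodFun_cons, Psi_prodFun, Psi_prodFun, monomial_cons, T.adjoint]
  have := congrArg (fun L => L g) h
  simpa only [ContinuousLinearMap.comp_apply, innerSL_apply_apply, tensorRight_apply] using this

/-- If a linear combination of vectors `Ψ(gᵢ)` vanishes, so does that of the `φ_j(u)Ψ(gᵢ)`. -/
theorem sum_Psi_tensor_eq_zero {ι : Type*} (s : Finset ι) (c : ι → ℂ) (n : ι → ℕ)
    (k : (i : ι) → Fin (n i) → Fin K) (g : (i : ι) → 𝓢(Points (n i), ℂ))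
    (h : ∑ i ∈ s, c i • T.Psi (n i) (k i) (g i) = 0) (j : Fin K) (u : 𝓢(Spacetime, ℂ)) :
    ∑ i ∈ s, c i • T.Psi (n i + 1) (Fin.cons j (k i)) (tensor u (g i)) = 0 := by
  refine T.dense_dom.eq_zero_of_inner_right ℂ fun v hv => ?_
  have h1 : ∀ i, inner ℂ v (c i • T.Psi (n i + 1) (Fin.cons j (k i)) (tensor u (g i))) =
      inner ℂ (T.φ (T.bar j) (conjTest u) ⟨v, hv⟩ : H) (c i • T.Psi (n i) (k i) (g i)) := fun i => by
    rw [inner_smul_right, inner_smul_right, ← T.inner_Psi_tensor]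
  rw [inner_sum]
  simp only [h1]
  rw [← inner_sum, h, inner_zero_right]

theorem covering_one : covering 1 = 1 := by
  ext μ ν
  fin_cases μ <;> fin_cases ν <;>
    norm_num [covering, pauli, Matrix.trace, Matrix.mul_apply, Fin.sum_univ_two]

theorem act_one (x : Spacetime) : act 1 x = x := by
  ext μ
  simp [act, Matrix.one_apply]

theorem U_monomial {n : ℕ} (y : Spacetime) (k : Fin n → Fin K) (f : Fin n → 𝓢(Spacetime, ℂ)) :
    T.U y 1 ((monomial T.φ T.vacuum n k f : T.dom) : H) =
      ((monomial T.φ T.vacuum n k (fun j => SchwartzMap.compSubConstCLM ℂ y (f j)) : T.dom) : H) := by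
  induction n with
  | zero => exact T.U_vacuum y 1
  | succ n ih =>
    rw [monomial, monomial, T.covariant y 1 (k 0) (f 0) (SchwartzMap.compSubConstCLM ℂ y (f 0))
      (fun x => by rw [covering_one, act_one, SchwartzMap.compSubConstCLM_apply,
        add_sub_cancel_right])]
    rw [inv_one, map_one, Finset.sum_eq_single (k 0)
      (fun m _ hm => by rw [Matrix.one_apply_ne hm.symm, zero_smul])
      (fun h => absurd (Finset.mem_univ _) h), Matrix.one_apply_eq, one_smul]
    have h : (⟨T.U y 1 (monomial T.φ T.vacuum n (Fin.tail k) (Fin.tail f) : T.dom),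
        T.U_dom y 1 _ (Subtype.mem _)⟩ : T.dom) = monomial T.φ T.vacuum n (Fin.tail k)
          (fun j => SchwartzMap.compSubConstCLM ℂ y (Fin.tail f j)) := Subtype.ext (ih _ _)
    rw [h]
    rfl

theorem compSubConst_prodFun {n : ℕ} (y : Spacetime) (f : Fin n → 𝓢(Spacetime, ℂ)) :
    SchwartzMap.compSubConstCLM ℂ (diagPoints n y) (prodFun n f) =
      prodFun n fun j => SchwartzMap.compSubConstCLM ℂ y (f j) := by
  ext x
  rw [SchwartzMap.compSubConstCLM_apply, prodFun_apply, prodFun_apply]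
  rfl

theorem U_Psi {n : ℕ} (y : Spacetime) (k : Fin n → Fin K) (g : 𝓢(Points n, ℂ)) :
    T.U y 1 (T.Psi n k g) = T.Psi n k (SchwartzMap.compSubConstCLM ℂ (diagPoints n y) g) := by
  have h : ((T.U y 1).toContinuousLinearEquiv : H →L[ℂ] H).comp (T.Psi n k) =
      (T.Psi n k).comp (SchwartzMap.compSubConstCLM ℂ (diagPoints n y)) := by
    refine clm_ext_prodFun fun f => ?_
    rw [ContinuousLinearMap.comp_apply, ContinuousLinearMap.comp_apply, compSubConst_prodFun,
      Psi_prodFun, Psi_prodFun, ← U_monomial]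
    rfl
  exact congrArg (fun L => L g) h

theorem continuous_U (v : H) : Continuous fun y => T.U y 1 v :=
  (T.U_continuous v).comp (continuous_id.prodMk continuous_const)

theorem integrable_U (h : 𝓢(Spacetime, ℂ)) (v : H) : Integrable fun y => h y • T.U y 1 v := by
  refine (h.integrable.norm.mul_const ‖v‖).mono'
    (h.continuous.smul (T.continuous_U v)).aestronglyMeasurable
    (Eventually.of_forall fun y => ?_)
  rw [norm_smul, LinearIsometryEquiv.norm_map]

/-- The function `b` of the energy-momentum operators. -/
def spectralOp (b : 𝓢(Spacetime, ℂ)) : H →ₗ[ℂ] H where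
  toFun v := ∫ y, (𝓕⁻ b : 𝓢(Spacetime, ℂ)) y • T.U y 1 v
  map_add' v w := by
    rw [← integral_add (T.integrable_U _ v) (T.integrable_U _ w)]
    simp only [map_add, smul_add]
  map_smul' c v := by
    rw [RingHom.id_apply, ← integral_smul]
    simp only [map_smul]
    congr 1
    funext y
    rw [smul_comm]

/-- Averaging the translates of `Ψ(g)` with weight `𝓕⁻ b` can be done on either side of `Ψ`: on test
functions it is a cut in the total momentum, on the Hilbert space an operator that depends on the
vector alone. -/
theorem Psi_momentumCut {n : ℕ} (k : Fin n → Fin K) (b : 𝓢(Spacetime, ℂ)) (g : 𝓢(Points n, ℂ)) :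
    T.Psi n k (momentumCut b g) = T.spectralOp b (T.Psi n k g) := by
  have h := integral_clm_translate (T.Psi n k) (𝓕⁻ b) g
  rw [FourierTransform.fourier_fourierInv_eq] at h
  rw [← h]
  simp only [← U_Psi]
  rfl

/-- The spectrum condition. -/
theorem spectralOp_eq_zero {b : 𝓢(Spacetime, ℂ)} (hb : ∀ ξ, -ξ ∈ forwardCone → b ξ = 0) :
    T.spectralOp b = 0 := by
  ext v
  refine T.spectrum_condition (𝓕⁻ b) (fun p hp => ?_) v
  -- Comparing `exp(i p·y)` with the kernel `exp(-2πi ⟨y, ξ⟩)` gives `-ξ = η p / (2π)`. The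
  -- reflection `η` preserves the forward cone, so `-ξ` lies in it again.
  set ξ : Spacetime := WithLp.toLp 2 fun μ => -(2 * Real.pi)⁻¹ * (metric μ μ * p μ)
  have hpi := Real.pi_pos
  have hξ : -ξ ∈ forwardCone := by
    obtain ⟨h1, h2⟩ := hp
    refine ⟨?_, ?_⟩
    · have : minkowski (-ξ) (-ξ) = ((2 * Real.pi)⁻¹) ^ 2 * minkowski p p := by
        simp [minkowski, ξ, metric]
        ring
      rw [this]
      positivity
    · have : (-ξ) 0 = (2 * Real.pi)⁻¹ * p 0 := by simp [ξ, metric]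
      rw [this]
      positivity
  rw [← hb ξ hξ]
  have h2 : b ξ = 𝓕 (𝓕⁻ b : 𝓢(Spacetime, ℂ)) ξ := by rw [FourierTransform.fourier_fourierInv_eq]
  rw [h2, SchwartzMap.fourier_coe, Real.fourier_eq']
  congr 1
  funext y
  rw [smul_eq_mul]
  congr 3
  simp [PiLp.inner_apply, Fin.sum_univ_four, minkowski, ξ, metric]
  field_simp
  ring

end WightmanTheory

end Wightman

/-! ### Existence of the deformed fields -/

section Twist

theorem fourierInv_injective {ι : Type*} [Fintype ι] {f g : 𝓢(EuclideanSpace ℝ ι, ℂ)}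
    (h : 𝓕 f = 𝓕 g) : f = g := by
  rw [← FourierTransform.fourierInv_fourier_eq (F := 𝓢(EuclideanSpace ℝ ι, ℂ)) f, h,
    FourierTransform.fourierInv_fourier_eq]

/-- The map `ξ ↦ (ξ₁, ξ₂ + ⋯ + ξₙ₊₁)`. -/
def pairTail (n : ℕ) : Points (n + 1) →L[ℝ] Points 2 :=
  LinearMap.toContinuousLinearMap
    { toFun := fun ξ => joinPoints (Points.point 0 ξ) (diagPoints 1 (sumPoints n (Points.tail ξ)))
      map_add' := fun x y => by simp only [map_add, joinPoints_add]
      map_smul' := fun c x => by simp only [map_smul, joinPoints_smul, RingHom.id_apply] }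

/-- The map `ξ ↦ (ξ₁, ξ₁ + ⋯ + ξₙ₊₁)`. -/
def pairTotal (n : ℕ) : Points (n + 1) →L[ℝ] Points 2 :=
  LinearMap.toContinuousLinearMap
    { toFun := fun ξ => joinPoints (Points.point 0 ξ) (diagPoints 1 (sumPoints (n + 1) ξ))
      map_add' := fun x y => by simp only [map_add, joinPoints_add]
      map_smul' := fun c x => by simp only [map_smul, joinPoints_smul, RingHom.id_apply] }

theorem point_zero_pairTail {n : ℕ} (ξ : Points (n + 1)) :
    Points.point 0 (pairTail n ξ) = Points.point 0 ξ := rfl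

theorem point_one_pairTail {n : ℕ} (ξ : Points (n + 1)) :
    Points.point 1 (pairTail n ξ) = sumPoints n (Points.tail ξ) := rfl

theorem point_zero_pairTotal {n : ℕ} (ξ : Points (n + 1)) :
    Points.point 0 (pairTotal n ξ) = Points.point 0 ξ := rfl

theorem point_one_pairTotal {n : ℕ} (ξ : Points (n + 1)) :
    Points.point 1 (pairTotal n ξ) = sumPoints (n + 1) ξ := rfl

theorem controls_of_point_zero {n : ℕ} {A : Points (n + 1) →L[ℝ] Points 2}
    (hA : ∀ ξ, Points.point 0 (A ξ) = Points.point 0 ξ) : Controls A (Points.tail (n := n)) := by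
  refine ⟨1, fun ξ => ?_⟩
  have h1 := Points.norm_le ξ
  have h2 := norm_point_le 0 (A ξ)
  rw [hA] at h2
  rw [one_mul]
  refine h1.trans ?_
  gcongr

/-- The function with Fourier transform `κ(A ξ) ĝ(ξ₂, …, ξₙ₊₁)`. -/
def twist {n : ℕ} (A : Points (n + 1) →L[ℝ] Points 2)
    (hA : ∀ ξ, Points.point 0 (A ξ) = Points.point 0 ξ) (g : 𝓢(Points n, ℂ)) :
    𝓢(Points 2, ℂ) →L[ℂ] 𝓢(Points (n + 1), ℂ) :=
  (FourierTransform.fourierInvCLM ℂ 𝓢(Points (n + 1), ℂ)).comp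
    (mulCompCLM A Points.tail (controls_of_point_zero hA) (𝓕 g))

theorem fourier_twist {n : ℕ} (A : Points (n + 1) →L[ℝ] Points 2)
    (hA : ∀ ξ, Points.point 0 (A ξ) = Points.point 0 ξ) (g : 𝓢(Points n, ℂ))
    (κ : 𝓢(Points 2, ℂ)) (ξ : Points (n + 1)) :
    𝓕 (twist A hA g κ) ξ = κ (A ξ) * 𝓕 g (Points.tail ξ) := by
  change 𝓕 (𝓕⁻ (mulCompCLM A Points.tail (controls_of_point_zero hA) (𝓕 g) κ)) ξ = _
  rw [FourierTransform.fourier_fourierInv_eq, mulCompCLM_apply]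

/-- `twist` as a continuous linear map in the test function. -/
def twistRight {n : ℕ} (A : Points (n + 1) →L[ℝ] Points 2)
    (hA : ∀ ξ, Points.point 0 (A ξ) = Points.point 0 ξ) (κ : 𝓢(Points 2, ℂ)) :
    𝓢(Points n, ℂ) →L[ℂ] 𝓢(Points (n + 1), ℂ) :=
  (FourierTransform.fourierInvCLM ℂ 𝓢(Points (n + 1), ℂ)).comp
    ((mulCompCLM Points.tail A (controls_of_point_zero hA).symm κ).comp
      (FourierTransform.fourierCLM ℂ 𝓢(Points n, ℂ)))

theorem twistRight_apply {n : ℕ} (A : Points (n + 1) →L[ℝ] Points 2)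
    (hA : ∀ ξ, Points.point 0 (A ξ) = Points.point 0 ξ) (g : 𝓢(Points n, ℂ))
    (κ : 𝓢(Points 2, ℂ)) : twistRight A hA κ g = twist A hA g κ := by
  change 𝓕⁻ (mulCompCLM Points.tail A (controls_of_point_zero hA).symm κ (𝓕 g)) =
    𝓕⁻ (mulCompCLM A Points.tail (controls_of_point_zero hA) (𝓕 g) κ)
  rw [mulCompCLM_symm]

/-- The function `a(x₁) b(x₂)`. -/
def pairTensor (a : 𝓢(Spacetime, ℂ)) : 𝓢(Spacetime, ℂ) →L[ℂ] 𝓢(Points 2, ℂ) :=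
  (tensorRight a).comp (tensorLeft (prodFun 0 Fin.elim0))

@[simp]
theorem pairTensor_apply (a b : 𝓢(Spacetime, ℂ)) (ζ : Points 2) :
    pairTensor a b ζ = a (Points.point 0 ζ) * b (Points.point 1 ζ) := by
  change tensorRight a (tensorLeft (prodFun 0 Fin.elim0) b) ζ = _
  rw [tensorRight_apply, tensorLeft_apply, tensor_apply, tensor_apply, prodFun_zero, mul_one]
  rfl

theorem prodFun_two (w : Fin 2 → 𝓢(Spacetime, ℂ)) : prodFun 2 w = pairTensor (w 0) (w 1) := by
  ext ζ
  rw [prodFun_apply, pairTensor_apply, Fin.prod_univ_two]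

/-- For a product kernel the momentum of the vector is cut first and the field acts afterwards. -/
theorem twist_pairTail {n : ℕ} (g : 𝓢(Points n, ℂ)) (a b : 𝓢(Spacetime, ℂ)) :
    twist (pairTail n) point_zero_pairTail g (pairTensor (𝓕 a) b) = tensor a (momentumCut b g) := by
  refine fourierInv_injective ?_
  ext ξ
  rw [fourier_twist, fourier_tensor, tensor_apply, fourier_momentumCut, pairTensor_apply,
    point_zero_pairTail, point_one_pairTail, mul_assoc]

/-- With the total momentum as second variable the order is reversed: the field acts first, and `b`
becomes an operator to the left of it. -/
theorem twist_pairTotal {n : ℕ} (g : 𝓢(Points n, ℂ)) (a b : 𝓢(Spacetime, ℂ)) :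
    twist (pairTotal n) point_zero_pairTotal g (pairTensor (𝓕 a) b) =
      momentumCut b (tensor a g) := by
  refine fourierInv_injective ?_
  ext ξ
  rw [fourier_twist, fourier_momentumCut, fourier_tensor, tensor_apply, pairTensor_apply,
    point_zero_pairTotal, point_one_pairTotal]
  ring

/-- The function `exp(i φ_θ(p, R)) f̂(p) b(R)`. -/
def moyalKernel (θ : Matrix (Fin 4) (Fin 4) ℝ) (f : 𝓢(Spacetime, ℂ)) :
    𝓢(Spacetime, ℂ) →L[ℂ] 𝓢(Points 2, ℂ) :=
  (SchwartzMap.smulLeftCLM ℂ fun ζ : Points 2 => Complex.exp (moyalPhase θ ζ * Complex.I)).comp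
    (pairTensor (𝓕 f))

theorem moyalKernel_apply (θ : Matrix (Fin 4) (Fin 4) ℝ) (f b : 𝓢(Spacetime, ℂ)) (ζ : Points 2) :
    moyalKernel θ f b ζ = Complex.exp (moyalPhase θ ζ * Complex.I) *
      (𝓕 f (Points.point 0 ζ) * b (Points.point 1 ζ)) := by
  rw [moyalKernel, ContinuousLinearMap.comp_apply,
    SchwartzMap.smulLeftCLM_apply_apply (hasTemperateGrowth_moyalPhase θ), pairTensor_apply,
    smul_eq_mul]

theorem fourier_moyalTensor {n : ℕ} (θ : Matrix (Fin 4) (Fin 4) ℝ) (f : 𝓢(Spacetime, ℂ))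
    (g : 𝓢(Points n, ℂ)) (ξ : Points (n + 1)) :
    𝓕 (moyalTensor θ f g) ξ = Complex.exp (moyalPhase θ ξ * Complex.I) *
      (𝓕 f (Points.point 0 ξ) * 𝓕 g (Points.tail ξ)) := by
  rw [moyalTensor, FourierTransform.fourier_fourierInv_eq,
    SchwartzMap.smulLeftCLM_apply_apply (hasTemperateGrowth_moyalPhase θ), tensor_apply,
    smul_eq_mul]

/-- The dilation `f ↦ f(c ·)`. -/
def dilateCLM {E : Type*} [NormedAddCommGroup E] [NormedSpace ℝ E] [FiniteDimensional ℝ E] (c : ℝ)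
    (hc : c ≠ 0) : 𝓢(E, ℂ) →L[ℂ] 𝓢(E, ℂ) :=
  SchwartzMap.compCLMOfContinuousLinearEquiv ℂ
    (LinearEquiv.smulOfNeZero ℝ E c hc).toContinuousLinearEquiv

@[simp]
theorem dilateCLM_apply {E : Type*} [NormedAddCommGroup E] [NormedSpace ℝ E]
    [FiniteDimensional ℝ E] (c : ℝ) (hc : c ≠ 0) (f : 𝓢(E, ℂ)) (x : E) :
    dilateCLM c hc f x = f (c • x) := rfl

/-- A Schwartz function with value `1` at `0`. -/
theorem exists_schwartz_apply_zero_eq_one :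
    ∃ χ : 𝓢(Spacetime, ℂ), χ 0 = 1 := by
  refine ⟨framePlateau 0, framePlateau_eq_one (fun h => ?_)⟩
  have h1 := framePartition_apply (0 : Fin 4 → ℤ) (0 : Spacetime)
  rw [h] at h1
  simp [partitionBump, Real.smoothTransition.one_of_one_le] at h1

/-- A sequence of Schwartz functions `b` such that `b(B ξ) F(ξ)` tends to `F(ξ)`. -/
def cutoff (i : ℕ) : 𝓢(Spacetime, ℂ) :=
  dilateCLM (1 / ((i : ℝ) + 1)) Nat.one_div_pos_of_nat.ne'
    exists_schwartz_apply_zero_eq_one.choose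

theorem tendsto_twist_moyalKernel {n : ℕ} (A : Points (n + 1) →L[ℝ] Points 2)
    (hA : ∀ ξ, Points.point 0 (A ξ) = Points.point 0 ξ) (θ : Matrix (Fin 4) (Fin 4) ℝ)
    (hθ : ∀ ξ, moyalPhase θ (A ξ) = moyalPhase θ ξ) (f : 𝓢(Spacetime, ℂ)) (g : 𝓢(Points n, ℂ)) :
    Tendsto (fun i => twist A hA g (moyalKernel θ f (cutoff i))) atTop
      (𝓝 (moyalTensor θ f g)) := by
  have hχ := exists_schwartz_apply_zero_eq_one.choose_spec
  set χ := exists_schwartz_apply_zero_eq_one.choose with hχ'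
  -- On the Fourier side the approximants are the transform of `f ⊗_θ g` times `χ(ε R)` with `ε = 1
  -- / (i + 1)`, where `R` is the second component of `A ξ`.
  have hlim := (tendsto_smulLeft_dilate (boundedDerivs_schwartz χ) hχ ((Points.point 1).comp A)
    (𝓕 (moyalTensor θ f g))).comp tendsto_one_div_add_atTop_nhds_zero_nat
  have hlim' := ((FourierTransform.fourierInvCLM ℂ 𝓢(Points (n + 1), ℂ)).continuous.tendsto
    _).comp hlim
  have h0 : (FourierTransform.fourierInvCLM ℂ 𝓢(Points (n + 1), ℂ)) (𝓕 (moyalTensor θ f g)) =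
      moyalTensor θ f g := by
    change 𝓕⁻ (𝓕 (moyalTensor θ f g)) = _
    rw [FourierTransform.fourierInv_fourier_eq]
  rw [h0] at hlim'
  refine hlim'.congr fun i => fourierInv_injective ?_
  change 𝓕 (𝓕⁻ (SchwartzMap.smulLeftCLM ℂ _ (𝓕 (moyalTensor θ f g)))) = _
  rw [FourierTransform.fourier_fourierInv_eq]
  ext ξ
  rw [fourier_twist, SchwartzMap.smulLeftCLM_apply_apply
    ((boundedDerivs_schwartz χ).hasTemperateGrowth_comp _ _), fourier_moyalTensor,
    moyalKernel_apply, hA, hθ, cutoff, dilateCLM_apply, smul_eq_mul, ContinuousLinearMap.comp_apply]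
  ring

theorem moyalPhase_eq {n : ℕ} (θ : Matrix (Fin 4) (Fin 4) ℝ) (ξ : Points (n + 1)) :
    moyalPhase θ ξ = ∑ μ, ∑ ν, (-2 * Real.pi ^ 2 * θ μ ν) *
      (Points.point 0 ξ μ * sumPoints n (Points.tail ξ) ν) := by
  rw [moyalPhase, Finset.sum_comm]
  refine Finset.sum_congr rfl fun μ _ => ?_
  rw [Finset.sum_comm]
  refine Finset.sum_congr rfl fun ν _ => ?_
  rw [sumPoints_apply, WithLp.ofLp_sum, Finset.sum_apply, Finset.mul_sum, Finset.mul_sum]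
  rfl

theorem moyalPhase_two (θ : Matrix (Fin 4) (Fin 4) ℝ) (ζ : Points 2) :
    moyalPhase θ ζ = ∑ μ, ∑ ν, (-2 * Real.pi ^ 2 * θ μ ν) *
      (Points.point 0 ζ μ * Points.point 1 ζ ν) := by
  rw [moyalPhase, Fin.sum_univ_one]
  rfl

theorem moyalPhase_pairTail {n : ℕ} (θ : Matrix (Fin 4) (Fin 4) ℝ) (ξ : Points (n + 1)) :
    moyalPhase θ (pairTail n ξ) = moyalPhase θ ξ := by
  rw [moyalPhase_eq θ ξ, moyalPhase_two, point_zero_pairTail, point_one_pairTail]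

theorem sum_antisymm_eq_zero {θ : Matrix (Fin 4) (Fin 4) ℝ} (hθ : θ.transpose = -θ) (c : ℝ)
    (p : Spacetime) : ∑ μ, ∑ ν, (c * θ μ ν) * (p μ * p ν) = 0 := by
  have h1 : ∑ μ, ∑ ν, (c * θ μ ν) * (p μ * p ν) = -∑ μ, ∑ ν, (c * θ μ ν) * (p μ * p ν) := by
    conv_lhs => rw [Finset.sum_comm]
    simp only [← Finset.sum_neg_distrib]
    refine Finset.sum_congr rfl fun μ _ => Finset.sum_congr rfl fun ν _ => ?_
    have : θ ν μ = -θ μ ν := by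
      have := congrFun (congrFun hθ μ) ν
      simpa using this
    rw [this]
    ring
  linarith

/-- Since `p θ p = 0`, the momentum of the field may be included in the total momentum. The
displacement of the left field is thus governed by the momentum of the final vector, which is again
subject to the spectrum condition. -/
theorem moyalPhase_pairTotal {n : ℕ} {θ : Matrix (Fin 4) (Fin 4) ℝ} (hθ : θ.transpose = -θ)
    (ξ : Points (n + 1)) : moyalPhase θ (pairTotal n ξ) = moyalPhase θ ξ := by
  rw [moyalPhase_eq θ ξ, moyalPhase_two, point_zero_pairTotal, point_one_pairTotal, sumPoints_succ]
  simp only [PiLp.add_apply, mul_add, Finset.sum_add_distrib]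
  rw [sum_antisymm_eq_zero hθ, zero_add]

end Twist

namespace WightmanTheory

variable {K : ℕ} {H : Type*} [NormedAddCommGroup H] [InnerProductSpace ℂ H] [CompleteSpace H]
  (T : WightmanTheory K H)

/-- If a linear combination of vectors `Ψ(gᵢ)` vanishes, so does that of the `Ψ(f ⊗_θ gᵢ)`. -/
theorem sum_Psi_moyalTensor_eq_zero {ι : Type*} (s : Finset ι) (c : ι → ℂ) (n : ι → ℕ)
    (k : (i : ι) → Fin (n i) → Fin K) (g : (i : ι) → 𝓢(Points (n i), ℂ))
    (h : ∑ i ∈ s, c i • T.Psi (n i) (k i) (g i) = 0) (θ : Matrix (Fin 4) (Fin 4) ℝ) (j : Fin K)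
    (f : 𝓢(Spacetime, ℂ)) :
    ∑ i ∈ s, c i • T.Psi (n i + 1) (Fin.cons j (k i)) (moyalTensor θ f (g i)) = 0 := by
  -- For a product kernel the cut acts as one operator `spectralOp` on all `Ψ(gᵢ)`, and a field
  -- preserves linear relations. As products are total, the relation extends to every kernel, in
  -- particular to the cut-off Moyal phases.
  have hzero : ∑ i ∈ s, c i • (T.Psi (n i + 1) (Fin.cons j (k i))).comp
      (twist (pairTail (n i)) point_zero_pairTail (g i)) = 0 := by
    refine clm_ext_prodFun fun w => ?_
    simp only [sum_apply, smul_apply, ContinuousLinearMap.comp_apply]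
    rw [prodFun_two, ← FourierTransform.fourier_fourierInv_eq (F := 𝓢(Spacetime, ℂ)) (w 0)]
    simp only [twist_pairTail]
    refine T.sum_Psi_tensor_eq_zero s c n k (fun i => momentumCut (w 1) (g i)) ?_ j _
    simp only [Psi_momentumCut]
    rw [← map_zero (T.spectralOp (w 1)), ← h, map_sum]
    simp only [map_smul]
  have hlim : Tendsto (fun i => ∑ x ∈ s, c x • T.Psi (n x + 1) (Fin.cons j (k x))
      (twist (pairTail (n x)) point_zero_pairTail (g x) (moyalKernel θ f (cutoff i)))) atTop
      (𝓝 (∑ x ∈ s, c x • T.Psi (n x + 1) (Fin.cons j (k x)) (moyalTensor θ f (g x)))) :=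
    tendsto_finsetSum _ fun x _ => (((T.Psi _ _).continuous.tendsto _).comp
      (tendsto_twist_moyalKernel _ _ θ (moyalPhase_pairTail θ) f (g x))).const_smul _
  refine tendsto_nhds_unique hlim (tendsto_const_nhds.congr fun i => ?_)
  have := congrArg (fun L => L (moyalKernel θ f (cutoff i))) hzero
  simp only [sum_apply, smul_apply, ContinuousLinearMap.comp_apply] at this
  rw [this]
  rfl

/-- The deformed field operators are well defined. -/
theorem isDeformedField_deformedField (θ : Matrix (Fin 4) (Fin 4) ℝ) (j : Fin K)
    (f : 𝓢(Spacetime, ℂ)) : T.IsDeformedField θ j f (T.deformedField θ j f) := by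
  have h : ∃ A, T.IsDeformedField θ j f A := by
    let I := Σ n, (Fin n → Fin K) × 𝓢(Points n, ℂ)
    let E : (I →₀ ℂ) →ₗ[ℂ] T.domain :=
      Finsupp.linearCombination ℂ fun i : I => T.psi i.1 i.2.1 i.2.2
    let E' : (I →₀ ℂ) →ₗ[ℂ] T.domain :=
      Finsupp.linearCombination ℂ fun i : I =>
        T.psi (i.1 + 1) (Fin.cons j i.2.1) (moyalTensor θ f i.2.2)
    have hE : Function.Surjective E := by
      rintro ⟨v, hv⟩
      refine Submodule.span_induction (p := fun v hv => ∃ x, E x = ⟨v, hv⟩) ?_ ?_ ?_ ?_ hv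
      · rintro _ ⟨n, m, g, rfl⟩
        refine ⟨Finsupp.single ⟨n, m, g⟩ 1, ?_⟩
        rw [Finsupp.linearCombination_single, one_smul]
        rfl
      · exact ⟨0, map_zero _⟩
      · rintro a b ha hb ⟨x, hx⟩ ⟨y, hy⟩
        exact ⟨x + y, by rw [map_add, hx, hy]; rfl⟩
      · rintro c a ha ⟨x, hx⟩
        exact ⟨c • x, by rw [map_smul, hx]; rfl⟩
    have hker : ∀ x, E x = 0 → E' x = 0 := fun x hx => by
      rw [Finsupp.linearCombination_apply, Finsupp.sum, ← Subtype.val_inj] at hx ⊢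
      rw [Submodule.coe_sum] at hx ⊢
      exact T.sum_Psi_moyalTensor_eq_zero _ _ _ _ _ hx θ j f
    -- Since `E'` vanishes on the kernel of `E`, composing it with any linear right inverse of `E`
    -- gives the induced map on `𝒟`.
    obtain ⟨S, hS⟩ := E.exists_rightInverse_of_surjective (LinearMap.range_eq_top.2 hE)
    refine ⟨E'.comp S, fun n m g => ?_⟩
    have h1 : E (Finsupp.single ⟨n, m, g⟩ 1) = T.psi n m g := by
      rw [Finsupp.linearCombination_single, one_smul]
    have h2 : E' (Finsupp.single ⟨n, m, g⟩ 1) = T.psi (n + 1) (Fin.cons j m) (moyalTensor θ f g) := by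
      rw [Finsupp.linearCombination_single, one_smul]
    rw [← h1, ← h2, LinearMap.comp_apply, ← sub_eq_zero, ← map_sub]
    refine hker _ ?_
    rw [map_sub, ← LinearMap.comp_apply, hS, LinearMap.id_apply, sub_self]
  rw [deformedField, dif_pos h]
  exact h.choose_spec

end WightmanTheory

/-! ### Approximation by functions with small support -/

section Support

variable {ι : Type*} [Fintype ι]

/-- Conjugation with a dilation turns the frame into one whose functions are supported in cubes of
side `δ`. -/
theorem hasSum_dilate_frame (F : 𝓢(EuclideanSpace ℝ ι, ℂ)) {δ : ℝ} (hδ : δ ≠ 0) :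
    HasSum (fun m : (ι → ℤ) × (ι → ℤ) => (∫ x, F (δ • x) * frameDual m x) •
      dilateCLM δ⁻¹ (inv_ne_zero hδ) (frameFun m)) F := by
  have h := (hasSum_frame (dilateCLM δ hδ F)).mapL (dilateCLM δ⁻¹ (inv_ne_zero hδ))
  have h1 : dilateCLM δ⁻¹ (inv_ne_zero hδ) (dilateCLM δ hδ F) = F := by
    ext x
    rw [dilateCLM_apply, dilateCLM_apply, smul_smul, mul_inv_cancel₀ hδ, one_smul]
  rw [h1] at h
  simpa only [map_smul, dilateCLM_apply] using h

theorem exists_of_frameCoeff_ne_zero {F : 𝓢(EuclideanSpace ℝ ι, ℂ)} {δ : ℝ} (hδ : δ ≠ 0)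
    {m : (ι → ℤ) × (ι → ℤ)} (h : ∫ x, F (δ • x) * frameDual m x ≠ 0) :
    ∃ z, F z ≠ 0 ∧ ∀ i, |4 * (δ⁻¹ * z i) - m.1 i| < 1 := by
  obtain ⟨y, hy⟩ : ∃ y, F (δ • y) * frameDual m y ≠ 0 := by
    by_contra hc
    push Not at hc
    exact h (by simp only [hc, integral_zero])
  refine ⟨δ • y, left_ne_zero_of_mul hy, fun i => ?_⟩
  have h1 := right_ne_zero_of_mul hy
  rw [frameDual_apply] at h1
  have h2 := abs_lt_of_framePartition_ne_zero (right_ne_zero_of_mul h1) i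
  rwa [PiLp.smul_apply, smul_eq_mul, inv_mul_cancel_left₀ hδ]

theorem abs_le_of_mem_tsupport_dilate {δ : ℝ} (hδ : δ ≠ 0) {m : (ι → ℤ) × (ι → ℤ)}
    {x : EuclideanSpace ℝ ι} (hx : x ∈ tsupport (dilateCLM δ⁻¹ (inv_ne_zero hδ) (frameFun m))) (i : ι) :
    |4 * (δ⁻¹ * x i) - m.1 i| ≤ 2 := by
  have hcl : IsClosed {x : EuclideanSpace ℝ ι | |4 * (δ⁻¹ * x i) - m.1 i| ≤ 2} :=
    isClosed_le (by fun_prop) continuous_const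
  refine closure_minimal (fun y hy => ?_) hcl hx
  rw [Function.mem_support, dilateCLM_apply, frameFun_apply] at hy
  exact (abs_lt_of_framePlateau_ne_zero (right_ne_zero_of_mul hy) i).le

theorem norm_le_of_abs_le {x : Spacetime} {δ : ℝ} (hδ : 0 ≤ δ) (h : ∀ i, |x i| ≤ δ) :
    ‖x‖ ≤ 2 * δ := by
  rw [← sq_le_sq₀ (norm_nonneg _) (by positivity), EuclideanSpace.norm_sq_eq]
  calc ∑ i, ‖x i‖ ^ 2 ≤ ∑ _i : Fin 4, δ ^ 2 := by
        refine Finset.sum_le_sum fun i _ => ?_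
        rw [Real.norm_eq_abs]
        exact pow_le_pow_left₀ (abs_nonneg _) (h i) 2
    _ = (2 * δ) ^ 2 := by
        rw [Finset.sum_const, Finset.card_univ, Fintype.card_fin, nsmul_eq_mul]
        push_cast
        ring

theorem norm_sub_le_of_frame {x z : Spacetime} {a : Fin 4 → ℤ} {δ : ℝ} (hδ : 0 < δ)
    (hx : ∀ i, |4 * (δ⁻¹ * x i) - a i| ≤ 2) (hz : ∀ i, |4 * (δ⁻¹ * z i) - a i| ≤ 2) :
    ‖x - z‖ ≤ 2 * δ := by
  refine norm_le_of_abs_le hδ.le fun i => ?_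
  have h1 := abs_sub_le (4 * (δ⁻¹ * x i)) (a i) (4 * (δ⁻¹ * z i))
  rw [abs_sub_comm (a i : ℝ)] at h1
  have h2 : |4 * (δ⁻¹ * x i) - 4 * (δ⁻¹ * z i)| = 4 * δ⁻¹ * |x i - z i| := by
    rw [← abs_of_pos (show 0 < 4 * δ⁻¹ by positivity), ← abs_mul]
    congr 1
    ring
  have h3 : 4 * δ⁻¹ * |x i - z i| ≤ 4 := by linarith [hx i, hz i]
  have h4 : δ⁻¹ * |x i - z i| ≤ 1 := by linarith
  rwa [inv_mul_le_iff₀ hδ, mul_one] at h4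

/-- A continuous linear map is zero if it vanishes on functions with small support. -/
theorem clm_eq_zero_of_small_support {G : Type*} [AddCommGroup G] [Module ℂ G] [TopologicalSpace G]
    [T2Space G] (L : 𝓢(Spacetime, ℂ) →L[ℂ] G) {δ : ℝ} (hδ : 0 < δ)
    (hL : ∀ b : 𝓢(Spacetime, ℂ), ∀ c, (∀ x, b x ≠ 0 → ‖x - c‖ ≤ δ) → L b = 0) (b : 𝓢(Spacetime, ℂ)) :
    L b = 0 := by
  -- The diagonal of a four-dimensional cube is twice its side, so cells of side `δ / 2` have
  -- diameter `δ`.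
  have hδ' : 0 < δ / 2 := by positivity
  have h := (hasSum_dilate_frame b hδ'.ne').mapL L
  have hz : (fun m : (Fin 4 → ℤ) × (Fin 4 → ℤ) => L ((∫ x, b ((δ / 2) • x) * frameDual m x) •
      dilateCLM (δ / 2)⁻¹ (inv_ne_zero hδ'.ne') (frameFun m))) = 0 := by
    funext m
    rw [map_smul, hL _ ((δ / 2) • quarterVec m.1) fun x hx => ?_, smul_zero, Pi.zero_apply]
    have h1 := abs_le_of_mem_tsupport_dilate hδ'.ne' (subset_tsupport _ hx)
    have h2 := norm_sub_le_of_frame (z := (δ / 2) • quarterVec m.1) hδ' h1 fun i => by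
      rw [PiLp.smul_apply, smul_eq_mul, inv_mul_cancel_left₀ hδ'.ne', quarterVec_apply]
      rw [show 4 * ((m.1 i : ℝ) / 4) - m.1 i = 0 by ring]
      simp
    linarith
  rw [hz] at h
  exact h.unique hasSum_zero

theorem dilate_prodFun {n : ℕ} {δ : ℝ} (hδ : δ ≠ 0) (f : Fin n → 𝓢(Spacetime, ℂ)) :
    dilateCLM δ hδ (prodFun n f) = prodFun n fun j => dilateCLM δ hδ (f j) := by
  ext x
  simp only [dilateCLM_apply, prodFun_apply, map_smul]

theorem fourier_pairTensor (a b : 𝓢(Spacetime, ℂ)) :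
    𝓕 (pairTensor a b) = pairTensor (𝓕 a) (𝓕 b) := by
  have h : ∀ a b : 𝓢(Spacetime, ℂ), pairTensor a b = tensor a (tensor b (prodFun 0 Fin.elim0)) := by
    intro a b
    rw [pairTensor, ContinuousLinearMap.comp_apply, tensorRight_apply, tensorLeft_apply]
  have h0 : 𝓕 (prodFun 0 Fin.elim0) = prodFun 0 Fin.elim0 := by
    ext x
    rw [SchwartzMap.fourier_coe, Real.fourier_eq', prodFun_zero]
    simp only [prodFun_zero, PiLp.inner_apply, Finset.univ_eq_empty, Finset.sum_empty]
    have : (volume : Measure (Points 0)) Set.univ = 1 := by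
      rw [volume_euclideanSpace_eq_dirac]
      simp
    simp [Measure.real, this]
  rw [h, h, fourier_tensor, fourier_tensor, h0]

/-- `θ R`, as the vector with components `∑ θ_{μν} R_ν`, gives the phase of the Moyal product. -/
theorem moyalPhase_two_eq_inner (θ : Matrix (Fin 4) (Fin 4) ℝ) (ζ : Points 2) :
    moyalPhase θ ζ = 2 * Real.pi *
      inner ℝ (Points.point 0 ζ) (-(Real.pi • act θ (Points.point 1 ζ))) := by
  rw [moyalPhase_two, PiLp.inner_apply, Finset.mul_sum]
  refine Finset.sum_congr rfl fun μ _ => ?_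
  simp only [act, PiLp.neg_apply, PiLp.smul_apply, smul_eq_mul, RCLike.inner_apply, conj_trivial,
    Finset.mul_sum, Finset.sum_mul, ← Finset.sum_neg_distrib]
  refine Finset.sum_congr rfl fun ν _ => ?_
  ring

/-- The support of the inverse Fourier transform of a Moyal kernel. -/
theorem exists_of_fourierInv_moyalKernel_ne_zero {θ : Matrix (Fin 4) (Fin 4) ℝ}
    {f β : 𝓢(Spacetime, ℂ)} {z : Points 2}
    (hz : (𝓕⁻ (moyalKernel θ f β) : 𝓢(Points 2, ℂ)) z ≠ 0) :
    ∃ R, β R ≠ 0 ∧ f (Points.point 0 z - Real.pi • act θ R) ≠ 0 := by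
  by_contra hc
  push Not at hc
  refine hz ?_
  rw [SchwartzMap.fourierInv_coe, Real.fourierInv_eq']
  -- Written this way, the Moyal phase only shifts the argument at which the integral over `w.1`
  -- inverts the Fourier transform of `f`. The result is a superposition over `R` of multiples of `β
  -- R * f (x₁ - π θ R)`.
  set Φ : Spacetime × Points 1 → ℂ := fun w =>
    (Complex.exp (((2 * Real.pi * inner ℝ w.2 (Points.tail z) : ℝ) : ℂ) * Complex.I) *
      β (Points.point 0 w.2)) *
    (Complex.exp (((2 * Real.pi * inner ℝ w.1 (Points.point 0 z -
      Real.pi • act θ (Points.point 0 w.2)) : ℝ) : ℂ) * Complex.I) * 𝓕 f w.1)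
  have hΦ : ∫ v : Points 2, Complex.exp (((2 * Real.pi * inner ℝ v z : ℝ) : ℂ) * Complex.I) •
      moyalKernel θ f β v = ∫ v : Points 2, Φ (Points.point 0 v, Points.tail v) := by
    congr 1
    funext v
    rw [moyalKernel_apply, moyalPhase_two_eq_inner, inner_split, smul_eq_mul]
    have h1 : Points.point 0 (Points.tail v) = Points.point 1 v := rfl
    simp only [Φ]
    rw [h1, sub_eq_add_neg, inner_add_right, ← inner_add_right]
    have h2 : Complex.exp (((2 * Real.pi * (inner ℝ (Points.point 0 v) (Points.point 0 z) +
          inner ℝ (Points.tail v) (Points.tail z)) : ℝ) : ℂ) * Complex.I) *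
        Complex.exp (((2 * Real.pi * inner ℝ (Points.point 0 v)
          (-(Real.pi • act θ (Points.point 1 v))) : ℝ) : ℂ) * Complex.I) =
        Complex.exp (((2 * Real.pi * inner ℝ (Points.tail v) (Points.tail z) : ℝ) : ℂ) *
          Complex.I) *
        Complex.exp (((2 * Real.pi * inner ℝ (Points.point 0 v) (Points.point 0 z +
          -(Real.pi • act θ (Points.point 1 v))) : ℝ) : ℂ) * Complex.I) := by
      rw [← Complex.exp_add, ← Complex.exp_add, inner_add_right]
      congr 1
      push_cast
      ring
    linear_combination (𝓕 f (Points.point 0 v) * β (Points.point 1 v)) * h2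
  rw [hΦ, integral_split Φ]
  by_cases hint : Integrable Φ
  · rw [Measure.volume_eq_prod] at hint ⊢
    rw [integral_prod_symm _ hint]
    refine (integral_congr_ae (Eventually.of_forall fun t => ?_)).trans (integral_zero _ _)
    simp only [Φ]
    rw [integral_const_mul]
    have h3 : ∫ p, Complex.exp (((2 * Real.pi * inner ℝ p (Points.point 0 z -
        Real.pi • act θ (Points.point 0 t)) : ℝ) : ℂ) * Complex.I) * 𝓕 f p =
        f (Points.point 0 z - Real.pi • act θ (Points.point 0 t)) := by
      have h4 : f = 𝓕⁻ (𝓕 f) := (FourierTransform.fourierInv_fourier_eq f).symm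
      conv_rhs => rw [h4, SchwartzMap.fourierInv_coe, Real.fourierInv_eq']
      rfl
    rw [h3]
    by_cases hβ : β (Points.point 0 t) = 0
    · rw [hβ, mul_zero, zero_mul]
    · rw [hc _ hβ, mul_zero]
  -- A non-integrable function has integral zero by convention, so integrability of `Φ` need not be
  -- established.
  · exact integral_undef hint

/-- A continuous linear map vanishes at a Moyal kernel if it vanishes at the kernels `û ⊗ b`, where
the support of `u` is close to that of the inverse Fourier transform. -/
theorem clm_moyalKernel_eq_zero {G : Type*} [AddCommGroup G] [Module ℂ G] [TopologicalSpace G]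
    [T2Space G] (θ : Matrix (Fin 4) (Fin 4) ℝ) (f β : 𝓢(Spacetime, ℂ)) {δ : ℝ} (hδ : 0 < δ)
    (L : 𝓢(Points 2, ℂ) →L[ℂ] G)
    (hL : ∀ u b : 𝓢(Spacetime, ℂ), (∀ x ∈ tsupport u, ∃ x₁ R, f x₁ ≠ 0 ∧ β R ≠ 0 ∧
      ‖x - (x₁ + Real.pi • act θ R)‖ ≤ δ) → L (pairTensor (𝓕 u) b) = 0) :
    L (moyalKernel θ f β) = 0 := by
  have hδ' : 0 < δ / 2 := by positivity
  set k : 𝓢(Points 2, ℂ) := 𝓕⁻ (moyalKernel θ f β)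
  have hk : FourierTransform.fourierCLM ℂ 𝓢(Points 2, ℂ) k = moyalKernel θ f β := by
    change 𝓕 (𝓕⁻ (moyalKernel θ f β)) = _
    rw [FourierTransform.fourier_fourierInv_eq]
  have h := (frameIndexEquiv 2).hasSum_iff.2 ((hasSum_dilate_frame k hδ'.ne').mapL
    (L.comp (FourierTransform.fourierCLM ℂ 𝓢(Points 2, ℂ))))
  rw [ContinuousLinearMap.comp_apply, hk] at h
  refine h.unique ((congrArg (fun w => HasSum w (0 : G)) (funext fun m => ?_)).mpr hasSum_zero)
  rw [Function.comp_apply, map_smul, frameFun_frameIndexEquiv, dilate_prodFun, prodFun_two]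
  -- A nonzero coefficient means that the cell meets the support of `k`, which consists of points
  -- displaced as in `exists_of_fourierInv_moyalKernel_ne_zero`; the other cells do not contribute.
  by_cases hc : ∫ x, k ((δ / 2) • x) * frameDual (frameIndexEquiv 2 m) x = 0
  · rw [hc, zero_smul]
  · obtain ⟨z, hz, hz'⟩ := exists_of_frameCoeff_ne_zero hδ'.ne' hc
    obtain ⟨R, hR, hR'⟩ := exists_of_fourierInv_moyalKernel_ne_zero hz
    rw [ContinuousLinearMap.comp_apply]
    have h1 : ∀ a b, FourierTransform.fourierCLM ℂ 𝓢(Points 2, ℂ) (pairTensor a b) =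
      pairTensor (𝓕 a) (𝓕 b) := fourier_pairTensor
    rw [h1, hL, smul_zero]
    intro x hx
    refine ⟨_, R, hR', hR, ?_⟩
    rw [sub_add_cancel]
    have h2 := norm_sub_le_of_frame (z := Points.point 0 z) hδ'
      (abs_le_of_mem_tsupport_dilate hδ'.ne' hx) fun i =>
        ((hz' (0, i)).trans (by norm_num)).le
    linarith

end Support

/-! ### Commutation of deformed fields -/

section Swap

/-- The exchange of the first two points. -/
def swapPoints (n : ℕ) : Points (n + 2) ≃ₗᵢ[ℝ] Points (n + 2) :=
  LinearIsometryEquiv.piLpCongrLeft 2 ℝ ℝ ((Equiv.swap 0 1).prodCongr (Equiv.refl _))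

theorem swapPoints_apply {n : ℕ} (x : Points (n + 2)) (j : Fin (n + 2)) (μ : Fin 4) :
    swapPoints n x (j, μ) = x (Equiv.swap 0 1 j, μ) := rfl

theorem point_zero_swapPoints {n : ℕ} (x : Points (n + 2)) :
    Points.point 0 (swapPoints n x) = Points.point 0 (Points.tail x) := by
  ext μ
  rw [Points.point_apply, swapPoints_apply, Equiv.swap_apply_left]
  rfl

theorem point_zero_tail_swapPoints {n : ℕ} (x : Points (n + 2)) :
    Points.point 0 (Points.tail (swapPoints n x)) = Points.point 0 x := by
  ext μ
  rw [Points.point_apply, Points.tail_apply, swapPoints_apply]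
  simp only [Fin.succ_zero_eq_one, Equiv.swap_apply_right]
  rfl

theorem tail_tail_swapPoints {n : ℕ} (x : Points (n + 2)) :
    Points.tail (Points.tail (swapPoints n x)) = Points.tail (Points.tail x) := by
  ext ⟨j, μ⟩
  rw [Points.tail_apply, Points.tail_apply, swapPoints_apply, Equiv.swap_apply_of_ne_of_ne]
  · rfl
  · exact Fin.succ_ne_zero _
  · simp [Fin.ext_iff]

theorem sumPoints_swapPoints {n : ℕ} (x : Points (n + 2)) :
    sumPoints (n + 2) (swapPoints n x) = sumPoints (n + 2) x := by
  rw [sumPoints_succ, sumPoints_succ, sumPoints_succ, sumPoints_succ (Points.tail x),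
    point_zero_swapPoints, point_zero_tail_swapPoints, tail_tail_swapPoints]
  abel

/-- The exchange of the first two arguments. -/
def swapCLM (n : ℕ) : 𝓢(Points (n + 2), ℂ) →L[ℂ] 𝓢(Points (n + 2), ℂ) :=
  SchwartzMap.compCLMOfContinuousLinearEquiv ℂ (swapPoints n).toContinuousLinearEquiv

theorem swapCLM_apply {n : ℕ} (F : 𝓢(Points (n + 2), ℂ)) (x : Points (n + 2)) :
    swapCLM n F x = F (swapPoints n x) := rfl

theorem fourier_swapCLM {n : ℕ} (F : 𝓢(Points (n + 2), ℂ)) : 𝓕 (swapCLM n F) = swapCLM n (𝓕 F) := by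
  ext ξ
  rw [swapCLM_apply, SchwartzMap.fourier_coe, SchwartzMap.fourier_coe]
  exact Real.fourier_comp_linearIsometry (swapPoints n) F ξ

theorem swapCLM_tensor {n : ℕ} (u u' : 𝓢(Spacetime, ℂ)) (G : 𝓢(Points n, ℂ)) :
    swapCLM n (tensor u (tensor u' G)) = tensor u' (tensor u G) := by
  ext x
  simp only [swapCLM_apply, tensor_apply, point_zero_swapPoints, point_zero_tail_swapPoints,
    tail_tail_swapPoints]
  ring

theorem swapCLM_momentumCut {n : ℕ} (b : 𝓢(Spacetime, ℂ)) (F : 𝓢(Points (n + 2), ℂ)) :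
    swapCLM n (momentumCut b F) = momentumCut b (swapCLM n F) := by
  refine fourierInv_injective ?_
  ext ξ
  rw [fourier_swapCLM, swapCLM_apply, fourier_momentumCut, fourier_momentumCut, fourier_swapCLM,
    swapCLM_apply, sumPoints_swapPoints]

theorem sum_antisymm {θ : Matrix (Fin 4) (Fin 4) ℝ} (hθ : θ.transpose = -θ) (c : ℝ)
    (p q : Spacetime) :
    ∑ μ, ∑ ν, (c * θ μ ν) * (p μ * q ν) = -∑ μ, ∑ ν, (c * θ μ ν) * (q μ * p ν) := by
  have h := sum_antisymm_eq_zero hθ c (p + q)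
  have h1 := sum_antisymm_eq_zero hθ c p
  have h2 := sum_antisymm_eq_zero hθ c q
  simp only [PiLp.add_apply, add_mul, mul_add, Finset.sum_add_distrib] at h
  linarith

/-- The two orders differ in which field sees the momentum of the other. The resulting phases `p₂ θ
p₁` and `-p₁ θ p₂` agree by antisymmetry, precisely because the two parameters are opposite. -/
theorem swapCLM_moyalTensor {n : ℕ} {θ : Matrix (Fin 4) (Fin 4) ℝ} (hθ : θ.transpose = -θ)
    (f₁ f₂ : 𝓢(Spacetime, ℂ)) (g : 𝓢(Points n, ℂ)) :
    swapCLM n (moyalTensor θ f₁ (moyalTensor (-θ) f₂ g)) =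
      moyalTensor (-θ) f₂ (moyalTensor θ f₁ g) := by
  refine fourierInv_injective ?_
  ext ξ
  rw [fourier_swapCLM, swapCLM_apply]
  simp only [fourier_moyalTensor, point_zero_swapPoints, point_zero_tail_swapPoints,
    tail_tail_swapPoints]
  have key : moyalPhase θ (swapPoints n ξ) + moyalPhase (-θ) (Points.tail (swapPoints n ξ)) =
      moyalPhase (-θ) ξ + moyalPhase θ (Points.tail ξ) := by
    simp only [moyalPhase_eq, point_zero_swapPoints, point_zero_tail_swapPoints,
      tail_tail_swapPoints, sumPoints_succ, PiLp.add_apply, mul_add, Finset.sum_add_distrib,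
      Matrix.neg_apply, mul_neg, neg_mul, Finset.sum_neg_distrib]
    have h := sum_antisymm hθ (2 * Real.pi ^ 2) (Points.point 0 (Points.tail ξ)) (Points.point 0 ξ)
    linarith
  have h := congrArg (fun t : ℝ => Complex.exp (t * Complex.I)) key
  simp only [Complex.ofReal_add, add_mul, Complex.exp_add] at h
  linear_combination (𝓕 f₁ (Points.point 0 (Points.tail ξ)) * 𝓕 f₂ (Points.point 0 ξ) *
    𝓕 g (Points.tail (Points.tail ξ))) * h

/-- Multiplication with `χ(R)` in the second variable. -/
def mulSecond (χ : 𝓢(Spacetime, ℂ)) : 𝓢(Points 2, ℂ) →L[ℂ] 𝓢(Points 2, ℂ) :=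
  SchwartzMap.smulLeftCLM ℂ fun ζ => χ (Points.point 1 ζ)

theorem mulSecond_apply (χ : 𝓢(Spacetime, ℂ)) (κ : 𝓢(Points 2, ℂ)) (ζ : Points 2) :
    mulSecond χ κ ζ = χ (Points.point 1 ζ) * κ ζ := by
  have h : (fun ζ : Points 2 => χ (Points.point 1 ζ)).HasTemperateGrowth :=
    χ.hasTemperateGrowth.comp (Points.point 1).hasTemperateGrowth
  rw [mulSecond, SchwartzMap.smulLeftCLM_apply_apply h, smul_eq_mul]

theorem mulSecond_pairTensor (χ a b : 𝓢(Spacetime, ℂ)) :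
    mulSecond χ (pairTensor a b) = pairTensor a (mulCLM χ b) := by
  ext ζ
  rw [mulSecond_apply, pairTensor_apply, pairTensor_apply, mulCLM_apply]
  ring

/-- Inserting `χ` does not change the kernel, but it confines the momentum of every product into
which the kernel is decomposed afterwards. -/
theorem mulSecond_moyalKernel {χ β : 𝓢(Spacetime, ℂ)} (h : ∀ R, β R ≠ 0 → χ R = 1)
    (θ : Matrix (Fin 4) (Fin 4) ℝ) (f : 𝓢(Spacetime, ℂ)) :
    mulSecond χ (moyalKernel θ f β) = moyalKernel θ f β := by
  ext ζ
  rw [mulSecond_apply, moyalKernel_apply]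
  by_cases hβ : β (Points.point 1 ζ) = 0
  · rw [hβ, mul_zero, mul_zero, mul_zero]
  · rw [h _ hβ, one_mul]

theorem exists_schwartz_bump (c : Spacetime) {η : ℝ} (hη : 0 < η) :
    ∃ χ : 𝓢(Spacetime, ℂ), (∀ x, ‖x - c‖ ≤ η → χ x = 1) ∧ ∀ x, χ x ≠ 0 → ‖x - c‖ ≤ 2 * η := by
  let B : ContDiffBump c := ⟨η, 2 * η, hη, by linarith⟩
  refine ⟨HasCompactSupport.toSchwartzMap (f := fun x => (B x : ℂ))
    (B.hasCompactSupport.comp_left (g := fun t : ℝ => (t : ℂ)) Complex.ofReal_zero)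
    (Complex.ofRealCLM.contDiff.comp B.contDiff), fun x hx => ?_, fun x hx => ?_⟩
  · change (B x : ℂ) = 1
    rw [B.one_of_mem_closedBall (by rwa [mem_closedBall_iff_norm]), Complex.ofReal_one]
  · change (B x : ℂ) ≠ 0 at hx
    have h1 : x ∈ Function.support B := by
      rw [Function.mem_support]
      exact_mod_cast hx
    rw [B.support_eq, mem_ball_iff_norm] at h1
    exact h1.le

/-- The action of a matrix as a linear map. -/
def actCLM (θ : Matrix (Fin 4) (Fin 4) ℝ) : Spacetime →L[ℝ] Spacetime :=
  LinearMap.toContinuousLinearMap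
    { toFun := act θ
      map_add' := fun x y => by
        ext μ
        simp [act, mul_add, Finset.sum_add_distrib]
      map_smul' := fun c x => by
        ext μ
        simp only [act, PiLp.smul_apply, smul_eq_mul, RingHom.id_apply, Finset.mul_sum]
        exact Finset.sum_congr rfl fun ν _ => by ring }

theorem actCLM_apply (θ : Matrix (Fin 4) (Fin 4) ℝ) (x : Spacetime) : actCLM θ x = act θ x := rfl

theorem act_neg_left (θ : Matrix (Fin 4) (Fin 4) ℝ) (x : Spacetime) : act (-θ) x = -act θ x := by
  ext μ
  simp [act]

end Swap

/-! ### Vanishing of the bracket for stably spacelike supports -/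

namespace WightmanTheory

variable {K : ℕ} {H : Type*} [NormedAddCommGroup H] [InnerProductSpace ℂ H] [CompleteSpace H]
  (T : WightmanTheory K H)

theorem Psi_tensor_eq_zero {n : ℕ} {k : Fin n → Fin K} {g : 𝓢(Points n, ℂ)} (h : T.Psi n k g = 0)
    (j : Fin K) (u : 𝓢(Spacetime, ℂ)) : T.Psi (n + 1) (Fin.cons j k) (tensor u g) = 0 := by
  have := T.sum_Psi_tensor_eq_zero (Finset.univ : Finset Unit) (fun _ => 1) (fun _ => n)
    (fun _ => k) (fun _ => g) (by simpa using h) j u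
  simpa using this

/-- The distribution `[φ_k, φ_l]_± Ψ_m`. -/
def bracketDistribution (s : ℤˣ) (k l : Fin K) (n : ℕ) (m : Fin n → Fin K) :
    𝓢(Points (n + 2), ℂ) →L[ℂ] H :=
  T.Psi (n + 2) (Fin.cons k (Fin.cons l m)) +
    ((s : ℤ) : ℂ) • (T.Psi (n + 2) (Fin.cons l (Fin.cons k m))).comp (swapCLM n)

theorem bracketDistribution_apply (s : ℤˣ) (k l : Fin K) {n : ℕ} (m : Fin n → Fin K)
    (F : 𝓢(Points (n + 2), ℂ)) : T.bracketDistribution s k l n m F =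
      T.Psi (n + 2) (Fin.cons k (Fin.cons l m)) F +
        s • T.Psi (n + 2) (Fin.cons l (Fin.cons k m)) (swapCLM n F) := by
  rw [Units.smul_def, ← Int.cast_smul_eq_zsmul ℂ]
  rfl

/-- The total momentum is symmetric under the exchange of the fields, so one operator can be pulled
out to the left of both terms. -/
theorem bracketDistribution_momentumCut (s : ℤˣ) (k l : Fin K) {n : ℕ} (m : Fin n → Fin K)
    (b : 𝓢(Spacetime, ℂ)) (F : 𝓢(Points (n + 2), ℂ)) :
    T.bracketDistribution s k l n m (momentumCut b F) =
      T.spectralOp b (T.bracketDistribution s k l n m F) := by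
  rw [bracketDistribution_apply, bracketDistribution_apply, swapCLM_momentumCut, Psi_momentumCut,
    Psi_momentumCut, map_add]
  simp only [Units.smul_def, map_zsmul]

theorem bracketDistribution_tensor_of_spacelike {s : ℤˣ} {k l : Fin K}
    (hloc : T.SpacelikeCommute s k l) {n : ℕ} (m : Fin n → Fin K) {u u' : 𝓢(Spacetime, ℂ)}
    (h : ∀ x ∈ tsupport u, ∀ x' ∈ tsupport u', minkowski (x - x') (x - x') < 0)
    (G : 𝓢(Points n, ℂ)) : T.bracketDistribution s k l n m (tensor u (tensor u' G)) = 0 := by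
  have h0 : (T.bracketDistribution s k l n m).comp ((tensorRight u).comp (tensorRight u')) = 0 := by
    refine clm_ext_prodFun fun f => ?_
    simp only [ContinuousLinearMap.comp_apply, tensorRight_apply]
    rw [bracketDistribution_apply, swapCLM_tensor]
    simp only [← prodFun_cons, Psi_prodFun, monomial_cons]
    have h1 := hloc u u' (fun x hx x' hx' => h x hx x' hx') (monomial T.φ T.vacuum n m f)
    have h2 := congrArg (fun v : T.dom => (v : H)) h1
    exact h2
  have := congrArg (fun L => L G) h0
  simpa only [ContinuousLinearMap.comp_apply, tensorRight_apply, zero_apply] using this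

/-- Both terms act on the same vector `Ψ(G)`. This covers momentum cuts that miss the spectrum,
where no locality is available. -/
theorem bracketDistribution_tensor_of_Psi {s : ℤˣ} {k l : Fin K} {n : ℕ} {m : Fin n → Fin K}
    {G : 𝓢(Points n, ℂ)} (hG : T.Psi n m G = 0) (u u' : 𝓢(Spacetime, ℂ)) :
    T.bracketDistribution s k l n m (tensor u (tensor u' G)) = 0 := by
  rw [bracketDistribution_apply, swapCLM_tensor,
    T.Psi_tensor_eq_zero (T.Psi_tensor_eq_zero hG _ _),
    T.Psi_tensor_eq_zero (T.Psi_tensor_eq_zero hG _ _), smul_zero, add_zero]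

/-- The supports of `f₁` and `f₂` remain spacelike after the displacements that are due to `θ` and
`-θ`, and after small displacements. -/
def StablySpacelike (θ : Matrix (Fin 4) (Fin 4) ℝ) (f₁ f₂ : 𝓢(Spacetime, ℂ)) : Prop :=
  ∃ δ > 0, ∀ x₁ x₂ R Q e : Spacetime, f₁ x₁ ≠ 0 → f₂ x₂ ≠ 0 → -R ∈ forwardCone → -Q ∈ forwardCone →
    ‖e‖ ≤ δ → minkowski (x₁ - x₂ + Real.pi • act θ (R + Q) + e)
      (x₁ - x₂ + Real.pi • act θ (R + Q) + e) < 0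

theorem exists_bracketDistribution_kernel_eq_zero {s : ℤˣ} {k l : Fin K}
    (hloc : T.SpacelikeCommute s k l) {θ : Matrix (Fin 4) (Fin 4) ℝ} {f₁ f₂ : 𝓢(Spacetime, ℂ)}
    (hsep : StablySpacelike θ f₁ f₂) {n : ℕ} (m : Fin n → Fin K) (g : 𝓢(Points n, ℂ)) :
    ∃ η > 0, ∀ (β γ : 𝓢(Spacetime, ℂ)) (R₀ Q₀ : Spacetime), (∀ R, β R ≠ 0 → ‖R - R₀‖ ≤ η) →
      (∀ Q, γ Q ≠ 0 → ‖Q - Q₀‖ ≤ η) →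
      T.bracketDistribution s k l n m (twist (pairTotal (n + 1)) point_zero_pairTotal
        (twist (pairTail n) point_zero_pairTail g (moyalKernel (-θ) f₂ γ))
          (moyalKernel θ f₁ β)) = 0 := by
  obtain ⟨δ, hδ, hsep⟩ := hsep
  set c : ℝ := ‖Real.pi • actCLM θ‖
  have hc : 0 ≤ c := norm_nonneg _
  have hbound : ∀ v, ‖Real.pi • act θ v‖ ≤ c * ‖v‖ := fun v => (Real.pi • actCLM θ).le_opNorm v
  set η : ℝ := δ / (2 * (1 + 3 * c))
  have hη : 0 < η := by positivity
  have hηδ : 2 * ((1 + 3 * c) * η) = δ := by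
    simp only [η]
    field_simp
  refine ⟨η, hη, fun β γ R₀ Q₀ hβ hγ => ?_⟩
  obtain ⟨χ, hχ1, hχ2⟩ := exists_schwartz_bump R₀ hη
  obtain ⟨χ', hχ1', hχ2'⟩ := exists_schwartz_bump Q₀ hη
  set Y := twist (pairTail n) point_zero_pairTail g (moyalKernel (-θ) f₂ γ) with hY
  rw [← mulSecond_moyalKernel (fun R hR => hχ1 R (hβ R hR))]
  refine clm_moyalKernel_eq_zero θ f₁ β hη (((T.bracketDistribution s k l n m).comp
    (twist (pairTotal (n + 1)) point_zero_pairTotal Y)).comp (mulSecond χ)) fun u b hu => ?_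
  rw [ContinuousLinearMap.comp_apply, ContinuousLinearMap.comp_apply, mulSecond_pairTensor,
    twist_pairTotal, bracketDistribution_momentumCut]
  -- Either the cutoff misses the spectrum and the operator on the left is zero, or it contains a
  -- spectral value `R`, which is within `3 * η` of every momentum in the support of `β`. The same
  -- alternative is used below for `Q` and `γ`.
  by_cases hR : ∀ R, -R ∈ forwardCone → χ R = 0
  · rw [T.spectralOp_eq_zero fun ξ hξ => by rw [mulCLM_apply, hR ξ hξ, mul_zero]]
    rfl
  push Not at hR
  obtain ⟨R, hRC, hR⟩ := hR
  suffices hZ : T.bracketDistribution s k l n m (tensor u Y) = 0 by rw [hZ, map_zero]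
  rw [hY, ← mulSecond_moyalKernel (fun Q hQ => hχ1' Q (hγ Q hQ)), ← tensorRight_apply]
  refine clm_moyalKernel_eq_zero (-θ) f₂ γ hη (((T.bracketDistribution s k l n m).comp
    ((tensorRight u).comp (twist (pairTail n) point_zero_pairTail g))).comp (mulSecond χ'))
    fun u' b' hu' => ?_
  rw [ContinuousLinearMap.comp_apply, ContinuousLinearMap.comp_apply,
    ContinuousLinearMap.comp_apply, mulSecond_pairTensor, twist_pairTail, tensorRight_apply]
  by_cases hQ : ∀ Q, -Q ∈ forwardCone → χ' Q = 0
  · refine T.bracketDistribution_tensor_of_Psi ?_ _ _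
    rw [Psi_momentumCut, T.spectralOp_eq_zero fun ξ hξ => by rw [mulCLM_apply, hQ ξ hξ, mul_zero]]
    rfl
  push Not at hQ
  obtain ⟨Q, hQC, hQ⟩ := hQ
  refine T.bracketDistribution_tensor_of_spacelike hloc m (fun x hx x' hx' => ?_) _
  obtain ⟨x₁, R₁, hx₁, hR₁, h1⟩ := hu x hx
  obtain ⟨x₂, Q₁, hx₂, hQ₁, h2⟩ := hu' x' hx'
  have hclose : ∀ {a b c : Spacetime}, ‖a - c‖ ≤ η → ‖b - c‖ ≤ 2 * η → ‖a - b‖ ≤ 3 * η := by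
    intro a b c ha hb
    have := norm_sub_le_norm_sub_add_norm_sub a c b
    rw [norm_sub_rev c b] at this
    linarith
  have hRR := hclose (hβ R₁ hR₁) (hχ2 R hR)
  have hQQ := hclose (hγ Q₁ hQ₁) (hχ2' Q hQ)
  -- `e` collects the errors from the cells and from the replacement of `R₁`, `Q₁` by the spectral
  -- values `R`, `Q`; only for the latter does the displacement point into the wedge.
  set e : Spacetime := (x - (x₁ + Real.pi • act θ R₁)) - (x' - (x₂ + Real.pi • act (-θ) Q₁)) +
    Real.pi • act θ (R₁ - R) + Real.pi • act θ (Q₁ - Q)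
  have he : ‖e‖ ≤ δ := by
    have h3 := hbound (R₁ - R)
    have h4 := hbound (Q₁ - Q)
    have h5 : c * ‖R₁ - R‖ ≤ c * (3 * η) := by gcongr
    have h6 : c * ‖Q₁ - Q‖ ≤ c * (3 * η) := by gcongr
    refine (norm_add_le_of_le (norm_add_le_of_le (norm_sub_le_of_le h1 h2) (h3.trans h5))
      (h4.trans h6)).trans ?_
    linarith
  have hxx : x - x' = x₁ - x₂ + Real.pi • act θ (R + Q) + e := by
    simp only [e, act_neg_left]
    simp only [← actCLM_apply, map_add, map_sub, smul_add, smul_sub, smul_neg]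
    abel
  rw [hxx]
  exact hsep x₁ x₂ R Q e hx₁ hx₂ hRC hQC he

theorem bracketDistribution_moyalTensor_eq_zero {s : ℤˣ} {k l : Fin K}
    (hloc : T.SpacelikeCommute s k l) {θ : Matrix (Fin 4) (Fin 4) ℝ} (hθ : θ.transpose = -θ)
    {f₁ f₂ : 𝓢(Spacetime, ℂ)} (hsep : StablySpacelike θ f₁ f₂) {n : ℕ} (m : Fin n → Fin K)
    (g : 𝓢(Points n, ℂ)) :
    T.bracketDistribution s k l n m (moyalTensor θ f₁ (moyalTensor (-θ) f₂ g)) = 0 := by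
  obtain ⟨η, hη, h⟩ := T.exists_bracketDistribution_kernel_eq_zero hloc hsep m g
  set Z := T.bracketDistribution s k l n m
  -- Linearity removes the restriction to small supports, first for `γ` and then for `β`. Cutoffs
  -- tending to `1` then restore the full phases, first in the inner and then in the outer Moyal
  -- product.
  have h1 : ∀ (β : 𝓢(Spacetime, ℂ)) (R₀ : Spacetime), (∀ R, β R ≠ 0 → ‖R - R₀‖ ≤ η) → ∀ γ,
      Z (twist (pairTotal (n + 1)) point_zero_pairTotal
        (twist (pairTail n) point_zero_pairTail g (moyalKernel (-θ) f₂ γ))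
          (moyalKernel θ f₁ β)) = 0 := by
    intro β R₀ hβ γ
    rw [← twistRight_apply]
    refine clm_eq_zero_of_small_support (Z.comp ((twistRight (pairTotal (n + 1))
      point_zero_pairTotal (moyalKernel θ f₁ β)).comp ((twist (pairTail n) point_zero_pairTail
        g).comp (moyalKernel (-θ) f₂)))) hη (fun γ Q₀ hγ => ?_) γ
    simp only [ContinuousLinearMap.comp_apply, twistRight_apply]
    exact h β γ R₀ Q₀ hβ hγ
  have h2 : ∀ β γ, Z (twist (pairTotal (n + 1)) point_zero_pairTotal
        (twist (pairTail n) point_zero_pairTail g (moyalKernel (-θ) f₂ γ))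
          (moyalKernel θ f₁ β)) = 0 := fun β γ =>
    clm_eq_zero_of_small_support (Z.comp ((twist (pairTotal (n + 1)) point_zero_pairTotal
      (twist (pairTail n) point_zero_pairTail g (moyalKernel (-θ) f₂ γ))).comp
        (moyalKernel θ f₁))) hη (fun β R₀ hβ => h1 β R₀ hβ γ) β
  have h3 : ∀ β, Z (twist (pairTotal (n + 1)) point_zero_pairTotal (moyalTensor (-θ) f₂ g)
      (moyalKernel θ f₁ β)) = 0 := fun β => by
    have hlim := ((Z.comp (twistRight (pairTotal (n + 1)) point_zero_pairTotal
      (moyalKernel θ f₁ β))).continuous.tendsto _).comp (tendsto_twist_moyalKernel (pairTail n)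
        point_zero_pairTail (-θ) (moyalPhase_pairTail _) f₂ g)
    rw [ContinuousLinearMap.comp_apply, twistRight_apply] at hlim
    refine tendsto_nhds_unique hlim (tendsto_const_nhds.congr fun i => ?_)
    rw [Function.comp_apply, ContinuousLinearMap.comp_apply, twistRight_apply, h2]
  have hlim := (Z.continuous.tendsto _).comp (tendsto_twist_moyalKernel (pairTotal (n + 1))
        point_zero_pairTotal θ (moyalPhase_pairTotal hθ) f₁ (moyalTensor (-θ) f₂ g))
  refine tendsto_nhds_unique hlim (tendsto_const_nhds.congr fun i => ?_)
  rw [Function.comp_apply, h3]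

end WightmanTheory

/-- `f ⊗_θ g` as a continuous linear map in `f`. -/
def moyalTensorLeft {n : ℕ} (θ : Matrix (Fin 4) (Fin 4) ℝ) (g : 𝓢(Points n, ℂ)) :
    𝓢(Spacetime, ℂ) →L[ℂ] 𝓢(Points (n + 1), ℂ) :=
  (FourierTransform.fourierInvCLM ℂ 𝓢(Points (n + 1), ℂ)).comp
    ((SchwartzMap.smulLeftCLM ℂ
      fun ξ : Points (n + 1) => Complex.exp (moyalPhase θ ξ * Complex.I)).comp
      ((tensorLeft (𝓕 g)).comp (FourierTransform.fourierCLM ℂ 𝓢(Spacetime, ℂ))))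

theorem moyalTensorLeft_apply {n : ℕ} (θ : Matrix (Fin 4) (Fin 4) ℝ) (f : 𝓢(Spacetime, ℂ))
    (g : 𝓢(Points n, ℂ)) : moyalTensorLeft θ g f = moyalTensor θ f g := rfl

/-- A translation by `ε • w` is multiplication of the Fourier transform by a phase dilated by `ε`.
-/
theorem tendsto_compSubConst (f : 𝓢(Spacetime, ℂ)) (w : Spacetime) :
    Tendsto (fun ε : ℝ => SchwartzMap.compSubConstCLM ℂ (ε • w) f) (𝓝 0) (𝓝 f) := by
  have h := tendsto_smulLeft_dilate boundedDerivs_exp (by simp)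
    ((-2 * Real.pi) • innerSL ℝ w) (𝓕 f)
  have h' := ((FourierTransform.fourierInvCLM ℂ 𝓢(Spacetime, ℂ)).continuous.tendsto _).comp h
  have h0 : (FourierTransform.fourierInvCLM ℂ 𝓢(Spacetime, ℂ)) (𝓕 f) = f := by
    change 𝓕⁻ (𝓕 f) = _
    rw [FourierTransform.fourierInv_fourier_eq]
  rw [h0] at h'
  refine h'.congr fun ε => fourierInv_injective ?_
  change 𝓕 (𝓕⁻ (SchwartzMap.smulLeftCLM ℂ _ (𝓕 f))) = _
  rw [FourierTransform.fourier_fourierInv_eq]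
  ext ξ
  rw [SchwartzMap.smulLeftCLM_apply_apply (boundedDerivs_exp.hasTemperateGrowth_comp _ _),
    fourier_compSubConst, smul_eq_mul, real_inner_smul_left, smul_apply, innerSL_apply_apply,
    smul_eq_mul, smul_eq_mul]
  congr 3
  push_cast
  ring

namespace WightmanTheory

variable {K : ℕ} {H : Type*} [NormedAddCommGroup H] [InnerProductSpace ℂ H] [CompleteSpace H]
  (T : WightmanTheory K H)

/-- Deformed fields with opposite deformation parameters (anti)commute if the supports of the test
functions can be made stably spacelike by arbitrarily small translations. -/
theorem bracket_deformedField_eq_zero {s : ℤˣ} {k l : Fin K} (hloc : T.SpacelikeCommute s k l)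
    {θ : Matrix (Fin 4) (Fin 4) ℝ} (hθ : θ.transpose = -θ) {f₁ f₂ : 𝓢(Spacetime, ℂ)}
    (w : Spacetime)
    (hsep : ∀ ε > (0 : ℝ), StablySpacelike θ (SchwartzMap.compSubConstCLM ℂ (ε • w) f₁) f₂)
    (Ψ : T.domain) : bracket s (T.deformedField θ k f₁) (T.deformedField (-θ) l f₂) Ψ = 0 := by
  have hpsi : ∀ (n : ℕ) (m : Fin n → Fin K) (g : 𝓢(Points n, ℂ)),
      bracket s (T.deformedField θ k f₁) (T.deformedField (-θ) l f₂) (T.psi n m g) = 0 := by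
    intro n m g
    have hA := T.isDeformedField_deformedField θ k f₁
    have hB := T.isDeformedField_deformedField (-θ) l f₂
    have h0 : T.bracketDistribution s k l n m (moyalTensor θ f₁ (moyalTensor (-θ) f₂ g)) = 0 := by
      have hlim := (((T.bracketDistribution s k l n m).comp (moyalTensorLeft θ
        (moyalTensor (-θ) f₂ g))).continuous.tendsto _).comp
          ((tendsto_compSubConst f₁ w).mono_left (nhdsWithin_le_nhds (s := Set.Ioi 0)))
      refine tendsto_nhds_unique hlim (tendsto_const_nhds.congr' ?_)
      filter_upwards [self_mem_nhdsWithin] with ε hε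
      exact (T.bracketDistribution_moyalTensor_eq_zero hloc hθ (hsep ε hε) m g).symm
    rw [bracketDistribution_apply, swapCLM_moyalTensor hθ] at h0
    refine Subtype.ext ?_
    rw [bracket, LinearMap.add_apply, Module.End.mul_apply, LinearMap.smul_apply,
      Module.End.mul_apply, hA, hB, hA, hB]
    exact h0
  obtain ⟨v, hv⟩ := Ψ
  refine Submodule.span_induction (p := fun v hv => bracket s (T.deformedField θ k f₁)
    (T.deformedField (-θ) l f₂) ⟨v, hv⟩ = 0) ?_ ?_ ?_ ?_ hv
  · rintro _ ⟨n, m, g, rfl⟩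
    exact hpsi n m g
  · exact map_zero _
  · intro a b ha hb h1 h2
    have := map_add (bracket s (T.deformedField θ k f₁) (T.deformedField (-θ) l f₂))
      (⟨a, ha⟩ : T.domain) ⟨b, hb⟩
    rw [h1, h2, add_zero] at this
    exact this
  · intro c a ha h1
    have := map_smul (bracket s (T.deformedField θ k f₁) (T.deformedField (-θ) l f₂)) c
      (⟨a, ha⟩ : T.domain)
    rw [h1, smul_zero] at this
    exact this

end WightmanTheory

/-! ### The Lorentz group -/

section Lorentz

theorem metric_mul_metric : metric * metric = 1 := by
  rw [metric, Matrix.diagonal_mul_diagonal, ← Matrix.diagonal_one]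
  congr 1
  ext i
  fin_cases i <;> simp

theorem metric_transpose : metric.transpose = metric := Matrix.diagonal_transpose _

theorem det_metric : metric.det = -1 := by
  rw [metric, Matrix.det_diagonal, Fin.prod_univ_four]
  simp

/-- The inverse `η Λᵀ η` of a Lorentz transformation. -/
def lorentzInv (Λ : Matrix (Fin 4) (Fin 4) ℝ) : Matrix (Fin 4) (Fin 4) ℝ :=
  metric * Λ.transpose * metric

variable {Λ Λ' : Matrix (Fin 4) (Fin 4) ℝ}

theorem lorentzInv_mul (h : Λ.transpose * metric * Λ = metric) : lorentzInv Λ * Λ = 1 := by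
  rw [lorentzInv, Matrix.mul_assoc, Matrix.mul_assoc, ← Matrix.mul_assoc Λ.transpose, h,
    metric_mul_metric]

theorem mul_lorentzInv (h : Λ.transpose * metric * Λ = metric) : Λ * lorentzInv Λ = 1 :=
  mul_eq_one_comm.1 (lorentzInv_mul h)

theorem mul_metric_mul_transpose (h : Λ.transpose * metric * Λ = metric) :
    Λ * metric * Λ.transpose = metric := by
  have h1 := mul_lorentzInv h
  rw [lorentzInv] at h1
  calc Λ * metric * Λ.transpose = Λ * (metric * Λ.transpose * metric) * metric := by
        simp only [Matrix.mul_assoc, metric_mul_metric, Matrix.mul_one]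
    _ = metric := by rw [h1, Matrix.one_mul]

theorem transpose_mem_properLorentz (h : Λ ∈ properLorentz) : Λ.transpose ∈ properLorentz := by
  obtain ⟨h1, h2, h3⟩ := h
  refine ⟨?_, ?_, h3⟩
  · rw [Matrix.transpose_transpose]
    exact mul_metric_mul_transpose h1
  · rw [Matrix.det_transpose, h2]

theorem lorentzInv_mem_properLorentz (h : Λ ∈ properLorentz) : lorentzInv Λ ∈ properLorentz := by
  obtain ⟨h1, h2, h3⟩ := h
  refine ⟨?_, ?_, ?_⟩
  · have h4 := mul_metric_mul_transpose h1
    rw [lorentzInv, Matrix.transpose_mul, Matrix.transpose_mul, Matrix.transpose_transpose,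
      metric_transpose]
    calc metric * (Λ * metric) * metric * (metric * Λ.transpose * metric) =
        metric * (Λ * (metric * (metric * metric)) * Λ.transpose) * metric := by
          simp only [Matrix.mul_assoc]
      _ = metric := by
        rw [metric_mul_metric, Matrix.mul_one, h4, metric_mul_metric, Matrix.one_mul]
  · rw [lorentzInv, Matrix.det_mul, Matrix.det_mul, Matrix.det_transpose, h2, det_metric]
    norm_num
  · have : lorentzInv Λ 0 0 = Λ 0 0 := by
      simp [lorentzInv, metric, Matrix.mul_diagonal, Matrix.diagonal_mul]
    rwa [this]

theorem sq_apply_zero_column (h : Λ.transpose * metric * Λ = metric) :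
    Λ 0 0 ^ 2 = 1 + (Λ 1 0 ^ 2 + Λ 2 0 ^ 2 + Λ 3 0 ^ 2) := by
  have h1 := congrFun (congrFun h 0) 0
  simp [metric, Matrix.mul_apply, Fin.sum_univ_four, Matrix.diagonal_apply] at h1
  linarith

theorem sq_apply_zero_row (h : Λ.transpose * metric * Λ = metric) :
    Λ 0 0 ^ 2 = 1 + (Λ 0 1 ^ 2 + Λ 0 2 ^ 2 + Λ 0 3 ^ 2) :=
  sq_apply_zero_column (Λ := Λ.transpose) (by
    rw [Matrix.transpose_transpose]; exact mul_metric_mul_transpose h)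

/-- By Cauchy–Schwarz, the time components dominate in the product of a timelike and a causal
vector. This gives both the stability of `0 < Λ 0 0` under products and the invariance of the
forward cone. -/
theorem abs_inner_lt {a₀ a₁ a₂ a₃ b₀ b₁ b₂ b₃ : ℝ} (ha₀ : 0 < a₀) (hb₀ : 0 < b₀)
    (ha : a₁ ^ 2 + a₂ ^ 2 + a₃ ^ 2 < a₀ ^ 2) (hb : b₁ ^ 2 + b₂ ^ 2 + b₃ ^ 2 ≤ b₀ ^ 2) :
    |a₁ * b₁ + a₂ * b₂ + a₃ * b₃| < a₀ * b₀ := by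
  refine abs_lt_of_sq_lt_sq ?_ (by positivity)
  have h1 : (a₁ * b₁ + a₂ * b₂ + a₃ * b₃) ^ 2 ≤
      (a₁ ^ 2 + a₂ ^ 2 + a₃ ^ 2) * (b₁ ^ 2 + b₂ ^ 2 + b₃ ^ 2) := by
    nlinarith [sq_nonneg (a₁ * b₂ - a₂ * b₁), sq_nonneg (a₁ * b₃ - a₃ * b₁),
      sq_nonneg (a₂ * b₃ - a₃ * b₂)]
  have h2 : (a₁ ^ 2 + a₂ ^ 2 + a₃ ^ 2) * (b₁ ^ 2 + b₂ ^ 2 + b₃ ^ 2) ≤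
      (a₁ ^ 2 + a₂ ^ 2 + a₃ ^ 2) * b₀ ^ 2 := by gcongr
  have h3 : (a₁ ^ 2 + a₂ ^ 2 + a₃ ^ 2) * b₀ ^ 2 < a₀ ^ 2 * b₀ ^ 2 := by gcongr
  calc _ ≤ _ := h1.trans h2
    _ < a₀ ^ 2 * b₀ ^ 2 := h3
    _ = _ := by ring

theorem mul_mem_properLorentz (h : Λ ∈ properLorentz) (h' : Λ' ∈ properLorentz) :
    Λ * Λ' ∈ properLorentz := by
  obtain ⟨h1, h2, h3⟩ := h
  obtain ⟨h1', h2', h3'⟩ := h'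
  refine ⟨?_, ?_, ?_⟩
  · rw [Matrix.transpose_mul]
    calc Λ'.transpose * Λ.transpose * metric * (Λ * Λ') =
        Λ'.transpose * (Λ.transpose * metric * Λ) * Λ' := by simp only [Matrix.mul_assoc]
      _ = metric := by rw [h1, h1']
  · rw [Matrix.det_mul, h2, h2', one_mul]
  · rw [Matrix.mul_apply, Fin.sum_univ_four]
    have := abs_lt.1 (abs_inner_lt h3 h3' (by linarith [sq_apply_zero_row h1])
      (by linarith [sq_apply_zero_column h1']) :
      |Λ 0 1 * Λ' 1 0 + Λ 0 2 * Λ' 2 0 + Λ 0 3 * Λ' 3 0| < _)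
    linarith [this.1]

theorem act_mul (x : Spacetime) : act (Λ * Λ') x = act Λ (act Λ' x) := by
  ext μ
  simp only [act, Matrix.mul_apply, Finset.sum_mul, Finset.mul_sum]
  rw [Finset.sum_comm]
  exact Finset.sum_congr rfl fun ν _ => Finset.sum_congr rfl fun ρ _ => by ring

theorem minkowski_eq_dotProduct (x y : Spacetime) :
    minkowski x y = (x : Fin 4 → ℝ) ⬝ᵥ (metric.mulVec (y : Fin 4 → ℝ)) := by
  simp [minkowski, metric, dotProduct, Fin.sum_univ_four, Matrix.mulVec_diagonal]
  ring

theorem minkowski_act (h : Λ.transpose * metric * Λ = metric) (x y : Spacetime) :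
    minkowski (act Λ x) (act Λ y) = minkowski x y := by
  have h1 : ∀ z : Spacetime, ((act Λ z : Spacetime) : Fin 4 → ℝ) = Λ.mulVec (z : Fin 4 → ℝ) :=
    fun z => rfl
  rw [minkowski_eq_dotProduct, minkowski_eq_dotProduct, h1, h1, Matrix.mulVec_mulVec,
    ← Matrix.vecMul_transpose, ← Matrix.dotProduct_mulVec, Matrix.mulVec_mulVec,
    ← Matrix.mul_assoc, h]

theorem act_mem_forwardCone (h : Λ ∈ properLorentz) {p : Spacetime} (hp : p ∈ forwardCone) :
    act Λ p ∈ forwardCone := by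
  obtain ⟨h1, h2, h3⟩ := h
  obtain ⟨hp1, hp2⟩ := hp
  refine ⟨by rwa [minkowski_act h1], ?_⟩
  have hp3 : p 1 ^ 2 + p 2 ^ 2 + p 3 ^ 2 ≤ p 0 ^ 2 := by
    rw [minkowski] at hp1
    nlinarith
  simp only [act, Fin.sum_univ_four]
  rcases hp2.eq_or_lt with h0 | h0
  · rw [← h0] at hp3 ⊢
    have h4 : p 1 = 0 := by nlinarith [sq_nonneg (p 1), sq_nonneg (p 2), sq_nonneg (p 3)]
    have h5 : p 2 = 0 := by nlinarith [sq_nonneg (p 1), sq_nonneg (p 2), sq_nonneg (p 3)]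
    have h6 : p 3 = 0 := by nlinarith [sq_nonneg (p 1), sq_nonneg (p 2), sq_nonneg (p 3)]
    rw [h4, h5, h6]
    simp
  · have := abs_lt.1 (abs_inner_lt h3 h0 (by linarith [sq_apply_zero_row h1]) hp3 :
      |Λ 0 1 * p 1 + Λ 0 2 * p 2 + Λ 0 3 * p 3| < _)
    linarith [this.1]

/-! ### The orbit of the reference noncommutativity -/

/-- The antisymmetric matrix with electric part `e` and magnetic part `b`. -/
def electromagnetic (e₁ e₂ e₃ b₁ b₂ b₃ : ℝ) : Matrix (Fin 4) (Fin 4) ℝ :=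
  !![0, e₁, e₂, e₃; -e₁, 0, b₃, -b₂; -e₂, -b₃, 0, b₁; -e₃, b₂, -b₁, 0]

/-- The rotation in the plane of the first two space coordinates. -/
def rotation₁₂ (c s : ℝ) : Matrix (Fin 4) (Fin 4) ℝ :=
  !![1, 0, 0, 0; 0, c, -s, 0; 0, s, c, 0; 0, 0, 0, 1]

/-- The rotation in the plane of the first and the third space coordinate. -/
def rotation₁₃ (c s : ℝ) : Matrix (Fin 4) (Fin 4) ℝ :=
  !![1, 0, 0, 0; 0, c, 0, -s; 0, 0, 1, 0; 0, s, 0, c]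

/-- The rotation in the plane of the last two space coordinates. -/
def rotation₂₃ (c s : ℝ) : Matrix (Fin 4) (Fin 4) ℝ :=
  !![1, 0, 0, 0; 0, 1, 0, 0; 0, 0, c, -s; 0, 0, s, c]

/-- The boost in the direction of the last space coordinate. -/
def boost₃ (c s : ℝ) : Matrix (Fin 4) (Fin 4) ℝ :=
  !![c, 0, 0, s; 0, 1, 0, 0; 0, 0, 1, 0; s, 0, 0, c]

theorem rotation₁₂_mem {c s : ℝ} (h : c ^ 2 + s ^ 2 = 1) : rotation₁₂ c s ∈ properLorentz := by
  refine ⟨?_, ?_, by simp [rotation₁₂]⟩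
  · ext i j
    fin_cases i <;> fin_cases j <;>
      simp [rotation₁₂, metric, Matrix.mul_apply, Fin.sum_univ_four, Matrix.diagonal_apply] <;>
      linarith
  · simp [rotation₁₂, Matrix.det_succ_row_zero, Fin.sum_univ_succ, Fin.succAbove]
    linarith

theorem rotation₁₃_mem {c s : ℝ} (h : c ^ 2 + s ^ 2 = 1) : rotation₁₃ c s ∈ properLorentz := by
  refine ⟨?_, ?_, by simp [rotation₁₃]⟩
  · ext i j
    fin_cases i <;> fin_cases j <;>
      simp [rotation₁₃, metric, Matrix.mul_apply, Fin.sum_univ_four, Matrix.diagonal_apply] <;>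
      linarith
  · simp [rotation₁₃, Matrix.det_succ_row_zero, Fin.sum_univ_succ, Fin.succAbove]
    linarith

theorem rotation₂₃_mem {c s : ℝ} (h : c ^ 2 + s ^ 2 = 1) : rotation₂₃ c s ∈ properLorentz := by
  refine ⟨?_, ?_, by simp [rotation₂₃]⟩
  · ext i j
    fin_cases i <;> fin_cases j <;>
      simp [rotation₂₃, metric, Matrix.mul_apply, Fin.sum_univ_four, Matrix.diagonal_apply] <;>
      linarith
  · simp [rotation₂₃, Matrix.det_succ_row_zero, Fin.sum_univ_succ, Fin.succAbove]
    linarith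

theorem boost₃_mem {c s : ℝ} (h : c ^ 2 - s ^ 2 = 1) (hc : 0 < c) : boost₃ c s ∈ properLorentz := by
  refine ⟨?_, ?_, by simpa [boost₃] using hc⟩
  · ext i j
    fin_cases i <;> fin_cases j <;>
      simp [boost₃, metric, Matrix.mul_apply, Fin.sum_univ_four, Matrix.diagonal_apply] <;>
      linarith
  · simp [boost₃, Matrix.det_succ_row_zero, Fin.sum_univ_succ, Fin.succAbove]
    linarith

theorem rotation₁₂_electromagnetic {c s : ℝ} (h : c ^ 2 + s ^ 2 = 1) (e₁ e₂ e₃ b₁ b₂ b₃ : ℝ) :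
    rotation₁₂ c s * electromagnetic e₁ e₂ e₃ b₁ b₂ b₃ * (rotation₁₂ c s).transpose =
      electromagnetic (c * e₁ - s * e₂) (s * e₁ + c * e₂) e₃ (c * b₁ - s * b₂) (s * b₁ + c * b₂)
        b₃ := by
  ext i j
  fin_cases i <;> fin_cases j <;>
    simp [rotation₁₂, electromagnetic, Matrix.mul_apply, Fin.sum_univ_four] <;>
    first | ring1 | linear_combination b₃ * h | linear_combination -b₃ * h

theorem rotation₁₃_electromagnetic {c s : ℝ} (h : c ^ 2 + s ^ 2 = 1) (e₁ e₂ e₃ b₁ b₂ b₃ : ℝ) :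
    rotation₁₃ c s * electromagnetic e₁ e₂ e₃ b₁ b₂ b₃ * (rotation₁₃ c s).transpose =
      electromagnetic (c * e₁ - s * e₃) e₂ (s * e₁ + c * e₃) (c * b₁ - s * b₃) b₂
        (s * b₁ + c * b₃) := by
  ext i j
  fin_cases i <;> fin_cases j <;>
    simp [rotation₁₃, electromagnetic, Matrix.mul_apply, Fin.sum_univ_four] <;>
    first | ring1 | linear_combination b₂ * h | linear_combination -b₂ * h

theorem rotation₂₃_electromagnetic {c s : ℝ} (h : c ^ 2 + s ^ 2 = 1) (e₁ e₂ e₃ b₁ b₂ b₃ : ℝ) :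
    rotation₂₃ c s * electromagnetic e₁ e₂ e₃ b₁ b₂ b₃ * (rotation₂₃ c s).transpose =
      electromagnetic e₁ (c * e₂ - s * e₃) (s * e₂ + c * e₃) b₁ (c * b₂ - s * b₃)
        (s * b₂ + c * b₃) := by
  ext i j
  fin_cases i <;> fin_cases j <;>
    simp [rotation₂₃, electromagnetic, Matrix.mul_apply, Fin.sum_univ_four] <;>
    first | ring1 | linear_combination b₁ * h | linear_combination -b₁ * h

theorem boost₃_thetaRef {c s : ℝ} (κe κm : ℝ) :
    boost₃ c s * thetaRef κe κm * (boost₃ c s).transpose =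
      electromagnetic (c * κe) (-(s * κm)) 0 (c * κm) (s * κe) 0 := by
  ext i j
  fin_cases i <;> fin_cases j <;>
    simp [boost₃, thetaRef, electromagnetic, Matrix.mul_apply, Fin.sum_univ_four] <;>
    ring

end Lorentz

section Orbit

/-- A permutation is encoded by the image of `0` and a permutation of the remaining points. The
expansion lets the `ε`-invariant be evaluated on matrix entries as a multiple of the scalar product
of the electric and magnetic parts. -/
theorem sum_perm_four (f : Fin 4 → Fin 4 → Fin 4 → Fin 4 → ℝ) :
    ∑ σ : Equiv.Perm (Fin 4), ((Equiv.Perm.sign σ : ℤ) : ℝ) * f (σ 0) (σ 1) (σ 2) (σ 3) =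
      f 0 1 2 3 + -f 0 1 3 2 + (-f 0 2 1 3 + f 0 2 3 1) + (-f 0 3 2 1 + f 0 3 1 2) +
          (-f 1 0 2 3 + f 1 0 3 2 + (f 1 2 0 3 + -f 1 2 3 0) + (f 1 3 2 0 + -f 1 3 0 2)) +
        (-f 2 1 0 3 + f 2 1 3 0 + (f 2 0 1 3 + -f 2 0 3 1) + (f 2 3 0 1 + -f 2 3 1 0)) +
      (-f 3 1 2 0 + f 3 1 0 2 + (f 3 2 1 0 + -f 3 2 0 1) + (f 3 0 2 1 + -f 3 0 1 2)) := by
  have h : ∀ (p : Fin 4) (e : Equiv.Perm (Fin 3)),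
      f (Equiv.Perm.decomposeFin.symm (p, e) 0) (Equiv.Perm.decomposeFin.symm (p, e) 1)
        (Equiv.Perm.decomposeFin.symm (p, e) 2) (Equiv.Perm.decomposeFin.symm (p, e) 3) =
      f p (Equiv.swap 0 p (e 0).succ) (Equiv.swap 0 p (e 1).succ) (Equiv.swap 0 p (e 2).succ) := by
    intro p e
    rw [show (1 : Fin 4) = Fin.succ 0 from rfl, show (2 : Fin 4) = Fin.succ 1 from rfl,
      show (3 : Fin 4) = Fin.succ 2 from rfl]
    simp only [Equiv.Perm.decomposeFin_symm_apply_zero, Equiv.Perm.decomposeFin_symm_apply_succ]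
  have h3 : ∀ g : Equiv.Perm (Fin 3) → ℝ, ∑ e, g e = ∑ p : Fin 3, ∑ q : Fin 2,
      g (Equiv.Perm.decomposeFin.symm (p, Equiv.Perm.decomposeFin.symm (q, 1))) := by
    intro g
    rw [← Equiv.sum_comp Equiv.Perm.decomposeFin.symm, Fintype.sum_prod_type]
    refine Finset.sum_congr rfl fun p _ => ?_
    rw [← Equiv.sum_comp Equiv.Perm.decomposeFin.symm, Fintype.sum_prod_type]
    refine Finset.sum_congr rfl fun q _ => ?_
    simp
  have e1 : ∀ p q, (Equiv.Perm.decomposeFin.symm (p, Equiv.Perm.decomposeFin.symm (q, 1)) :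
      Equiv.Perm (Fin 3)) 0 = p := by decide
  have e2 : ∀ p q, (Equiv.Perm.decomposeFin.symm (p, Equiv.Perm.decomposeFin.symm (q, 1)) :
      Equiv.Perm (Fin 3)) 1 = Equiv.swap 0 p q.succ := by decide
  have e3 : ∀ p q, (Equiv.Perm.decomposeFin.symm (p, Equiv.Perm.decomposeFin.symm (q, 1)) :
      Equiv.Perm (Fin 3)) 2 = Equiv.swap 0 p (Equiv.swap 0 q 1).succ := by decide
  rw [← Equiv.sum_comp Equiv.Perm.decomposeFin.symm, Fintype.sum_prod_type]
  simp only [h, h3, Equiv.Perm.decomposeFin.symm_sign, Fin.sum_univ_four, Fin.sum_univ_three,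
    Fin.sum_univ_two, e1, e2, e3]
  simp [Equiv.swap_apply_def, Fin.ext_iff]

/-- The elements of `Σ` in terms of their electric and magnetic parts. -/
theorem exists_electromagnetic {κe κm : ℝ} {θ : Matrix (Fin 4) (Fin 4) ℝ}
    (hθ : θ ∈ noncommutativities κe κm) :
    ∃ e₁ e₂ e₃ b₁ b₂ b₃, θ = electromagnetic e₁ e₂ e₃ b₁ b₂ b₃ ∧
      e₁ ^ 2 + e₂ ^ 2 + e₃ ^ 2 - (b₁ ^ 2 + b₂ ^ 2 + b₃ ^ 2) = κe ^ 2 - κm ^ 2 ∧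
      e₁ * b₁ + e₂ * b₂ + e₃ * b₃ = κe * κm := by
  obtain ⟨h1, h2, h3⟩ := hθ
  have h4 : θ = electromagnetic (θ 0 1) (θ 0 2) (θ 0 3) (θ 2 3) (-θ 1 3) (θ 1 2) := by
    have h5 : ∀ i j, θ j i = -θ i j := fun i j => by
      have := congrFun (congrFun h1 i) j
      simpa using this
    ext i j
    fin_cases i <;> fin_cases j <;> simp [electromagnetic]
    · linarith [h5 0 0]
    · exact h5 0 1
    · linarith [h5 1 1]
    · exact h5 0 2
    · exact h5 1 2
    · linarith [h5 2 2]
    · exact h5 0 3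
    · exact h5 1 3
    · exact h5 2 3
    · linarith [h5 3 3]
  refine ⟨_, _, _, _, _, _, h4, ?_, ?_⟩
  · rw [h4] at h2
    simp [Fin.sum_univ_four, electromagnetic, metric, Matrix.diagonal_mul,
      Matrix.mul_diagonal] at h2
    linarith
  · rw [sum_perm_four fun a b c d => (metric * θ * metric) a b * (metric * θ * metric) c d, h4] at h3
    simp [electromagnetic, metric, Matrix.diagonal_mul, Matrix.mul_diagonal] at h3
    linarith

/-- The orbit of the reference noncommutativity. -/
def referenceOrbit (κe κm : ℝ) : Set (Matrix (Fin 4) (Fin 4) ℝ) :=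
  {θ | ∃ Λ ∈ properLorentz, θ = Λ * thetaRef κe κm * Λ.transpose}

theorem conj_mem_referenceOrbit {κe κm : ℝ} {θ Λ : Matrix (Fin 4) (Fin 4) ℝ}
    (hθ : θ ∈ referenceOrbit κe κm) (hΛ : Λ ∈ properLorentz) :
    Λ * θ * Λ.transpose ∈ referenceOrbit κe κm := by
  obtain ⟨Λ', hΛ', rfl⟩ := hθ
  refine ⟨Λ * Λ', mul_mem_properLorentz hΛ hΛ', ?_⟩
  rw [Matrix.transpose_mul]
  simp only [Matrix.mul_assoc]

theorem exists_polar (x y : ℝ) : ∃ c s r : ℝ, c ^ 2 + s ^ 2 = 1 ∧ x = c * r ∧ y = s * r := by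
  refine ⟨Real.cos (Complex.arg (x + y * Complex.I)), Real.sin (Complex.arg (x + y * Complex.I)),
    ‖(x + y * Complex.I : ℂ)‖, Real.cos_sq_add_sin_sq _, ?_, ?_⟩
  · rw [mul_comm, Complex.norm_mul_cos_arg]
    simp
  · rw [mul_comm, Complex.norm_mul_sin_arg]
    simp

/-- Put `F = e + i b`, `z = F₁ + i F₂` and `y = F₁ - i F₂`. The invariants say `z y = (κe + i κm)²`,
while the reference element has `z = y = κe + i κm`. A boost along the third axis multiplies `z` by
`ρ` and `y` by `1 / ρ`, and a rotation about it multiplies them by opposite phases. So `w = z / (κe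
+ i κm)` prescribes the Lorentz transformation; the reference value is nonzero since `κe`, `κm` do
not both vanish. -/
theorem electromagnetic_planar_mem {κe κm : ℝ} (hκ : κe ≠ 0 ∨ κm ≠ 0) {e₁ e₂ b₁ b₂ : ℝ}
    (h1 : e₁ ^ 2 + e₂ ^ 2 - (b₁ ^ 2 + b₂ ^ 2) = κe ^ 2 - κm ^ 2)
    (h2 : e₁ * b₁ + e₂ * b₂ = κe * κm) :
    electromagnetic e₁ e₂ 0 b₁ b₂ 0 ∈ referenceOrbit κe κm := by
  set c₀ : ℂ := ⟨κe, κm⟩ with hc₀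
  set z : ℂ := ⟨e₁ - b₂, b₁ + e₂⟩ with hz
  set y : ℂ := ⟨e₁ + b₂, b₁ - e₂⟩ with hy
  have hc₀' : c₀ ≠ 0 := by
    intro h
    rw [Complex.ext_iff] at h
    rcases hκ with h' | h'
    · exact h' h.1
    · exact h' h.2
  have hzy : z * y = c₀ ^ 2 := by
    rw [Complex.ext_iff, sq, Complex.mul_re, Complex.mul_im, Complex.mul_re, Complex.mul_im]
    simp only [hc₀, hz, hy]
    constructor <;> linarith
  have hz0 : z ≠ 0 := by
    intro h
    rw [h, zero_mul] at hzy
    exact pow_ne_zero 2 hc₀' hzy.symm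
  set w : ℂ := z / c₀ with hw
  have hw0 : w ≠ 0 := div_ne_zero hz0 hc₀'
  set ρ : ℝ := ‖w‖
  have hρ : 0 < ρ := norm_pos_iff.2 hw0
  set c : ℝ := Real.cos w.arg
  set s : ℝ := Real.sin w.arg
  have hcs : c ^ 2 + s ^ 2 = 1 := Real.cos_sq_add_sin_sq _
  have hwρ : w = ⟨ρ * c, ρ * s⟩ := by
    rw [Complex.ext_iff]
    exact ⟨(Complex.norm_mul_cos_arg w).symm, (Complex.norm_mul_sin_arg w).symm⟩
  have hz' : z = c₀ * w := by rw [hw]; field_simp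
  have hy' : y * w = c₀ := by
    have : z * y = z * (c₀ / w) := by
      rw [hzy, hz']
      field_simp
    rw [mul_left_cancel₀ hz0 this]
    field_simp
  rw [hwρ, Complex.ext_iff, Complex.mul_re, Complex.mul_im] at hz' hy'
  simp only [hc₀, hz, hy] at hz' hy'
  obtain ⟨hz1, hz2⟩ := hz'
  obtain ⟨hy1, hy2⟩ := hy'
  have hU : e₁ + b₂ = (κe * c + κm * s) / ρ := by
    rw [eq_div_iff hρ.ne']
    linear_combination c * hy1 + s * hy2 - (e₁ + b₂) * ρ * hcs
  have hV : b₁ - e₂ = (κm * c - κe * s) / ρ := by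
    rw [eq_div_iff hρ.ne']
    linear_combination c * hy2 - s * hy1 - (b₁ - e₂) * ρ * hcs
  -- The boost with `c - s = ρ` and `c + s = 1 / ρ`.
  have hboost : boost₃ ((ρ + 1 / ρ) / 2) ((1 / ρ - ρ) / 2) ∈ properLorentz :=
    boost₃_mem (by field_simp; ring) (by positivity)
  have hmem : boost₃ ((ρ + 1 / ρ) / 2) ((1 / ρ - ρ) / 2) * thetaRef κe κm *
      (boost₃ ((ρ + 1 / ρ) / 2) ((1 / ρ - ρ) / 2)).transpose ∈ referenceOrbit κe κm :=
    ⟨_, hboost, rfl⟩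
  rw [boost₃_thetaRef] at hmem
  have hmem' := conj_mem_referenceOrbit hmem (rotation₁₂_mem hcs)
  rw [rotation₁₂_electromagnetic hcs] at hmem'
  convert hmem' using 1
  congr 1 <;> field_simp at hU hV ⊢ <;> nlinarith

/-- The set `Σ` is contained in the orbit of the reference noncommutativity. -/
theorem noncommutativities_subset_referenceOrbit {κe κm : ℝ} (hκ : κe ≠ 0 ∨ κm ≠ 0) :
    noncommutativities κe κm ⊆ referenceOrbit κe κm := by
  intro θ hθ
  obtain ⟨e₁, e₂, e₃, b₁, b₂, b₃, rfl, h1, h2⟩ := exists_electromagnetic hθ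
  -- Two rotations bring the electric part to the first axis; a third one, fixing that axis, brings
  -- the magnetic part into the plane of the first two axes. They are undone in reverse order below.
  obtain ⟨c, s, r, hcs, rfl, rfl⟩ := exists_polar e₁ e₂
  obtain ⟨c', s', r', hcs', hr, rfl⟩ := exists_polar r e₃
  set β₁ := c * b₁ + s * b₂ with hβ₁
  set β₂ := c * b₂ - s * b₁ with hβ₂
  set γ₁ := c' * β₁ + s' * b₃ with hγ₁
  set γ₃ := c' * b₃ - s' * β₁ with hγ₃
  obtain ⟨c'', s'', t, hcs'', ht, ht'⟩ := exists_polar β₂ γ₃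
  have hβ : b₁ ^ 2 + b₂ ^ 2 = β₁ ^ 2 + β₂ ^ 2 := by
    rw [hβ₁, hβ₂]
    linear_combination (-(b₁ ^ 2 + b₂ ^ 2)) * hcs
  have hγ : β₁ ^ 2 + b₃ ^ 2 = γ₁ ^ 2 + γ₃ ^ 2 := by
    rw [hγ₁, hγ₃]
    linear_combination (-(β₁ ^ 2 + b₃ ^ 2)) * hcs'
  have hδ : β₂ ^ 2 + γ₃ ^ 2 = t ^ 2 := by
    rw [ht, ht']
    linear_combination t ^ 2 * hcs''
  have hmem := electromagnetic_planar_mem hκ (e₁ := r') (e₂ := 0) (b₁ := γ₁) (b₂ := t)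
    (by
      have h3 : (c * r) ^ 2 + (s * r) ^ 2 = r ^ 2 := by linear_combination r ^ 2 * hcs
      have h4 : r ^ 2 + (s' * r') ^ 2 = r' ^ 2 := by
        rw [hr]
        linear_combination r' ^ 2 * hcs'
      linarith)
    (by
      rw [← h2, hγ₁, hβ₁, hr]
      ring)
  have hmem1 := conj_mem_referenceOrbit hmem (rotation₂₃_mem hcs'')
  rw [rotation₂₃_electromagnetic hcs''] at hmem1
  have hmem2 := conj_mem_referenceOrbit hmem1 (rotation₁₃_mem hcs')
  rw [rotation₁₃_electromagnetic hcs'] at hmem2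
  have hmem3 := conj_mem_referenceOrbit hmem2 (rotation₁₂_mem hcs)
  rw [rotation₁₂_electromagnetic hcs] at hmem3
  convert hmem3 using 1
  simp only [mul_zero, sub_zero, add_zero, ← ht, ← ht']
  rw [← hr]
  have hb1 : c' * γ₁ - s' * γ₃ = β₁ := by
    rw [hγ₁, hγ₃]
    linear_combination β₁ * hcs'
  have hb3 : s' * γ₁ + c' * γ₃ = b₃ := by
    rw [hγ₁, hγ₃]
    linear_combination b₃ * hcs'
  rw [hb1, hb3]
  congr 1
  · rw [hβ₁, hβ₂]
    linear_combination -b₁ * hcs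
  · rw [hβ₁, hβ₂]
    linear_combination -b₂ * hcs

end Orbit

/-! ### Wedges -/

section Wedge

theorem minkowski_smul (c : ℝ) (x : Spacetime) :
    minkowski (c • x) (c • x) = c ^ 2 * minkowski x x := by
  simp only [minkowski, PiLp.smul_apply, smul_eq_mul]
  ring

theorem minkowski_nonpos_of_limit {d v : Spacetime}
    (h : ∀ ε > (0 : ℝ), minkowski (d + ε • v) (d + ε • v) < 0) : minkowski d d ≤ 0 := by
  have hc : Continuous fun ε : ℝ => minkowski (d + ε • v) (d + ε • v) := by
    simp only [minkowski, PiLp.add_apply, PiLp.smul_apply, smul_eq_mul]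
    fun_prop
  have hlim := (hc.tendsto 0).mono_left (nhdsWithin_le_nhds (s := Set.Ioi 0))
  rw [zero_smul, add_zero] at hlim
  refine le_of_tendsto hlim ?_
  filter_upwards [self_mem_nhdsWithin] with ε hε
  exact (h ε hε).le

theorem act_apply (Λ : Matrix (Fin 4) (Fin 4) ℝ) (x : Spacetime) (μ : Fin 4) :
    act Λ x μ = ∑ ν, Λ μ ν * x ν := rfl

/-- Limits of the spacelike separation of two wedges. -/
theorem minkowski_sub_act_nonpos {M : Matrix (Fin 4) (Fin 4) ℝ} {a : Spacetime}
    (h : ∀ w ∈ standardWedge, ∀ w' ∈ standardWedge,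
      minkowski (a + w - act M w') (a + w - act M w') < 0)
    {ℓ ℓ' : Spacetime} (hℓ : |ℓ 0| ≤ ℓ 1) (hℓ' : |ℓ' 0| ≤ ℓ' 1) :
    minkowski (ℓ - act M ℓ') (ℓ - act M ℓ') ≤ 0 := by
  set e : Spacetime := !₂[0, 1, 0, 0]
  -- The wedge points are `ε⁻¹ • (ℓ + ε • e)`: the shift by `ε • e` moves boundary points into the
  -- open wedge, and the rescaling makes the offset `a` disappear in the limit.
  refine minkowski_nonpos_of_limit (v := a + e - act M e) fun ε hε => ?_
  have hmem : ∀ {x : Spacetime}, |x 0| ≤ x 1 → ε⁻¹ • (x + ε • e) ∈ standardWedge := by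
    intro x hx
    change |(ε⁻¹ • (x + ε • e)) 0| < (ε⁻¹ • (x + ε • e)) 1
    simp only [PiLp.smul_apply, PiLp.add_apply, smul_eq_mul, e]
    simp only [Matrix.cons_val_zero, Matrix.cons_val_one, mul_zero, add_zero, mul_one]
    rw [abs_mul, abs_of_pos (inv_pos.2 hε)]
    have : 0 < ε⁻¹ := inv_pos.2 hε
    gcongr
    linarith
  have h1 := h _ (hmem hℓ) _ (hmem hℓ')
  have h2 : ℓ - act M ℓ' + ε • (a + e - act M e) =
      ε • (a + ε⁻¹ • (ℓ + ε • e) - act M (ε⁻¹ • (ℓ' + ε • e))) := by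
    simp only [← actCLM_apply, map_smul, map_add, smul_add, smul_sub, smul_smul,
      mul_inv_cancel₀ hε.ne', inv_mul_cancel₀ hε.ne', one_smul]
    abel
  rw [h2, minkowski_smul]
  exact mul_neg_of_pos_of_neg (by positivity) h1

/-- A Lorentz transformation that maps the standard wedge to a wedge in the causal complement of
the standard wedge exchanges the lightlike boundary directions. -/
theorem exists_lightlike_of_spacelike {M : Matrix (Fin 4) (Fin 4) ℝ} (hM : M ∈ properLorentz)
    {a : Spacetime} (h : ∀ w ∈ standardWedge, ∀ w' ∈ standardWedge,
      minkowski (a + w - act M w') (a + w - act M w') < 0) :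
    ∃ u v : ℝ, 0 < u ∧ 0 < v ∧ u * v = 1 ∧ M = !![(u + v) / 2, (u - v) / 2, 0, 0;
      (v - u) / 2, -(u + v) / 2, 0, 0; 0, 0, M 2 2, M 2 3; 0, 0, M 3 2, M 3 3] := by
  have hrow := sq_apply_zero_row hM.1
  have hentry : ∀ i j, M 0 i * M 0 j - M 1 i * M 1 j - M 2 i * M 2 j - M 3 i * M 3 j =
      metric i j := fun i j => by
    have := congrFun (congrFun hM.1 i) j
    rw [← this]
    simp [metric, Matrix.mul_apply, Fin.sum_univ_four, Matrix.diagonal_apply]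
    ring
  have h00 := hentry 0 0
  have h01 := hentry 0 1
  have h02 := hentry 0 2
  have h03 := hentry 0 3
  have h11 := hentry 1 1
  have h12 := hentry 1 2
  have h13 := hentry 1 3
  simp [metric] at h00 h01 h02 h03 h11 h12 h13
  have hpos := hM.2.2
  have hlt : |M 0 1| < M 0 0 := by
    refine abs_lt_of_sq_lt_sq ?_ hpos.le
    nlinarith [sq_nonneg (M 0 2), sq_nonneg (M 0 3)]
  obtain ⟨hlt1, hlt2⟩ := abs_lt.1 hlt
  -- For lightlike `ℓ`, `ℓ'` the inequality says `ℓ · M ℓ' ≥ 0`. Here one of `ℓ`, `M ℓ'` points to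
  -- the future and the other to the past, so `ℓ · M ℓ' ≤ 0` as well; equality forces them to be
  -- parallel. Concretely, the bounds `hv1`, `hu1` exhaust the null conditions and leave no
  -- transverse components.
  have hA := minkowski_sub_act_nonpos h (ℓ := !₂[1, 1, 0, 0]) (ℓ' := !₂[-1, 1, 0, 0])
    (by simp) (by simp)
  have hB := minkowski_sub_act_nonpos h (ℓ := !₂[-1, 1, 0, 0]) (ℓ' := !₂[1, 1, 0, 0])
    (by simp) (by simp)
  simp [minkowski, act_apply, Fin.sum_univ_four] at hA hB
  obtain ⟨u, hu⟩ : ∃ u, u = M 0 0 + M 0 1 := ⟨_, rfl⟩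
  obtain ⟨v, hv⟩ : ∃ v, v = M 0 0 - M 0 1 := ⟨_, rfl⟩
  have hu0 : 0 < u := by linarith
  have hv0 : 0 < v := by linarith
  have hvnull : v ^ 2 = (M 1 0 - M 1 1) ^ 2 + (M 2 0 - M 2 1) ^ 2 + (M 3 0 - M 3 1) ^ 2 := by
    rw [hv]; linear_combination h00 + h11 - 2 * h01
  have hunull : u ^ 2 = (M 1 0 + M 1 1) ^ 2 + (M 2 0 + M 2 1) ^ 2 + (M 3 0 + M 3 1) ^ 2 := by
    rw [hu]; linear_combination h00 + h11 + 2 * h01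
  have hv1 : v ≤ M 1 0 - M 1 1 := by rw [hv] at hvnull ⊢; linarith
  have hu1 : u ≤ -(M 1 0 + M 1 1) := by rw [hu] at hunull ⊢; linarith
  have hv2 := pow_le_pow_left₀ hv0.le hv1 2
  have hu2 := pow_le_pow_left₀ hu0.le hu1 2
  rw [neg_sq] at hu2
  have s1 := sq_nonneg (M 2 0 - M 2 1)
  have s2 := sq_nonneg (M 3 0 - M 3 1)
  have s3 := sq_nonneg (M 2 0 + M 2 1)
  have s4 := sq_nonneg (M 3 0 + M 3 1)
  have a1 : M 2 0 - M 2 1 = 0 :=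
    (pow_eq_zero_iff two_ne_zero).1 (by linarith only [s1, s2, hv2, hvnull])
  have a2 : M 3 0 - M 3 1 = 0 :=
    (pow_eq_zero_iff two_ne_zero).1 (by linarith only [s1, s2, hv2, hvnull])
  have a3 : M 2 0 + M 2 1 = 0 :=
    (pow_eq_zero_iff two_ne_zero).1 (by linarith only [s3, s4, hu2, hunull])
  have a4 : M 3 0 + M 3 1 = 0 :=
    (pow_eq_zero_iff two_ne_zero).1 (by linarith only [s3, s4, hu2, hunull])
  have a5 : M 1 0 - M 1 1 = v := by
    rw [a1, a2] at hvnull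
    exact (pow_left_inj₀ (hv0.le.trans hv1) hv0.le two_ne_zero).1 (by linarith only [hvnull])
  have a6 : M 1 0 + M 1 1 = -u := by
    rw [a3, a4] at hunull
    have : -(M 1 0 + M 1 1) = u := (pow_left_inj₀ (hu0.le.trans hu1) hu0.le two_ne_zero).1
      (by linarith only [hunull])
    linarith only [this]
  have m20 : M 2 0 = 0 := by linarith
  have m21 : M 2 1 = 0 := by linarith
  have m30 : M 3 0 = 0 := by linarith
  have m31 : M 3 1 = 0 := by linarith
  have m00 : M 0 0 = (u + v) / 2 := by rw [hu, hv]; ring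
  have m01 : M 0 1 = (u - v) / 2 := by rw [hu, hv]; ring
  have m10 : M 1 0 = (v - u) / 2 := by linarith
  have m11 : M 1 1 = -(u + v) / 2 := by linarith
  have huv : u * v = 1 := by
    rw [m20, m30, m00, m10] at h00
    linear_combination h00
  rw [m20, m30] at h02 h03
  rw [m21, m31] at h12 h13
  -- The last two columns are orthogonal to the first two, which span the plane of the first two
  -- coordinates. The nonzero determinant makes their components in this plane vanish.
  have hdet : M 0 1 * M 1 0 - M 0 0 * M 1 1 = 1 := by
    rw [m00, m01, m10, m11]
    linear_combination huv
  have m02 : M 0 2 = 0 := by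
    linear_combination (-M 1 1) * h02 + M 1 0 * h12 - M 0 2 * hdet
  have m12 : M 1 2 = 0 := by
    linear_combination (-M 0 1) * h02 + M 0 0 * h12 - M 1 2 * hdet
  have m03 : M 0 3 = 0 := by
    linear_combination (-M 1 1) * h03 + M 1 0 * h13 - M 0 3 * hdet
  have m13 : M 1 3 = 0 := by
    linear_combination (-M 0 1) * h03 + M 0 0 * h13 - M 1 3 * hdet
  refine ⟨u, v, hu0, hv0, huv, ?_⟩
  ext i j
  fin_cases i <;> fin_cases j <;> simp <;> first | assumption | linarith only [m11]

/-- Conjugation multiplies an antisymmetric `2 × 2` block by the determinant of the transformation.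
Exchanging the light rays has determinant `-1` on the first block; as `M` is proper, its determinant
on the transverse block is `-1` too. -/
theorem conj_thetaRef_eq_neg {M : Matrix (Fin 4) (Fin 4) ℝ} (hdet : M.det = 1) {u v : ℝ}
    (huv : u * v = 1) (hM : M = !![(u + v) / 2, (u - v) / 2, 0, 0;
      (v - u) / 2, -(u + v) / 2, 0, 0; 0, 0, M 2 2, M 2 3; 0, 0, M 3 2, M 3 3]) (κe κm : ℝ) :
    M * thetaRef κe κm * M.transpose = -thetaRef κe κm := by
  set p := M 2 2
  set q := M 2 3
  set r := M 3 2
  set t := M 3 3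
  have h1 : p * t - q * r = -1 := by
    rw [hM] at hdet
    simp [Matrix.det_succ_row_zero, Fin.sum_univ_succ, Fin.succAbove] at hdet
    have : (p * t - q * r) * (u * v) = -1 := by linarith
    rwa [huv, mul_one] at this
  rw [hM]
  ext i j
  fin_cases i <;> fin_cases j <;>
    simp [thetaRef, Matrix.mul_apply, Fin.sum_univ_four] <;>
    first | ring1 | linear_combination κe * huv | linear_combination -κe * huv |
      linear_combination κm * h1 | linear_combination -κm * h1

/-- Otherwise `t = |a₀| - a₁` is positive, and `w`, `w'` can be chosen with `w = (0, t/2, -a₂, -a₃)`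
and `M w' = (0, -t/2, 0, 0)`. Then `a + w - M w' = (a₀, |a₀|, 0, 0)` is lightlike, not spacelike. -/
theorem mem_closedWedge_of_spacelike {M : Matrix (Fin 4) (Fin 4) ℝ} {a : Spacetime}
    (h : ∀ w ∈ standardWedge, ∀ w' ∈ standardWedge,
      minkowski (a + w - act M w') (a + w - act M w') < 0) {u v : ℝ} (hu : 0 < u) (hv : 0 < v)
    (huv : u * v = 1) (hM : M = !![(u + v) / 2, (u - v) / 2, 0, 0;
      (v - u) / 2, -(u + v) / 2, 0, 0; 0, 0, M 2 2, M 2 3; 0, 0, M 3 2, M 3 3]) :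
    |a 0| ≤ a 1 := by
  by_contra hc
  push Not at hc
  set t : ℝ := |a 0| - a 1
  have ht : 0 < t := by simp only [t]; linarith
  have h1 := h !₂[0, t / 2, -a 2, -a 3] (by
      change |(!₂[0, t / 2, -a 2, -a 3] : Spacetime) 0| < (!₂[0, t / 2, -a 2, -a 3] : Spacetime) 1
      simpa using ht)
    !₂[(v - u) / 2 * (t / 2), (u + v) / 2 * (t / 2), 0, 0] (by
      change |(v - u) / 2 * (t / 2)| < (u + v) / 2 * (t / 2)
      rw [abs_mul, abs_of_pos (show 0 < t / 2 by positivity)]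
      gcongr
      rw [abs_lt]
      constructor <;> linarith)
  rw [hM] at h1
  simp [minkowski, act_apply, Fin.sum_univ_four] at h1
  have h2 : a 0 - ((u + v) / 2 * ((v - u) / 2 * (t / 2)) + (u - v) / 2 * ((u + v) / 2 * (t / 2))) =
      a 0 := by ring
  have h3 : a 1 + t / 2 - ((v - u) / 2 * ((v - u) / 2 * (t / 2)) +
      (-v + -u) / 2 * ((u + v) / 2 * (t / 2))) = |a 0| := by
    have : a 1 + t / 2 - ((v - u) / 2 * ((v - u) / 2 * (t / 2)) +
      (-v + -u) / 2 * ((u + v) / 2 * (t / 2))) = a 1 + t / 2 + (u * v) * (t / 2) := by ring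
    rw [this, huv]
    simp only [t]
    ring
  rw [h2, h3, abs_mul_abs_self] at h1
  linarith

/-- The first two components of `θ₁ P` are `κe P₁` and `-κe P₀`, and `|P₁| ≤ -P₀` on the backward
cone. The parameter `κm` enters only the transverse components, on which wedge membership does not
depend. -/
theorem act_thetaRef_mem_closedWedge {κe κm : ℝ} {P : Spacetime} (hP : -P ∈ forwardCone) {σ : ℝ}
    (hσ : 0 ≤ σ * κe) : |(σ • act (thetaRef κe κm) P) 0| ≤ (σ • act (thetaRef κe κm) P) 1 := by
  obtain ⟨h1, h2⟩ := hP
  simp only [minkowski, PiLp.neg_apply] at h1 h2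
  have h3 : |P 1| ≤ -P 0 := by
    refine abs_le_of_sq_le_sq ?_ h2
    nlinarith [sq_nonneg (P 2), sq_nonneg (P 3)]
  have h4 : (σ • act (thetaRef κe κm) P) 0 = σ * κe * P 1 := by
    simp [act_apply, thetaRef, Fin.sum_univ_four]
    ring
  have h5 : (σ • act (thetaRef κe κm) P) 1 = σ * κe * (-P 0) := by
    simp [act_apply, thetaRef, Fin.sum_univ_four]
    ring
  rw [h4, h5, abs_mul, abs_of_nonneg hσ]
  gcongr

end Wedge

/-! ### Wedge-locality of the deformed fields -/

namespace WightmanTheory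

variable {K : ℕ} {H : Type*} [NormedAddCommGroup H] [InnerProductSpace ℂ H] [CompleteSpace H]
  (T : WightmanTheory K H)

/-- Test functions whose supports are separated by a closed wedge become stably spacelike by
translations into the wedge. -/
theorem stablySpacelike_translate {κe κm : ℝ} {Λ : Matrix (Fin 4) (Fin 4) ℝ}
    (hΛ : Λ ∈ properLorentz) {σ : ℝ} (hσ : σ * σ = 1) (hσκ : 0 ≤ σ * κe) {f₁ f₂ : 𝓢(Spacetime, ℂ)}
    (h : ∀ x₁ ∈ tsupport f₁, ∀ x₂ ∈ tsupport f₂,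
      |(σ • act (lorentzInv Λ) (x₁ - x₂)) 0| ≤ (σ • act (lorentzInv Λ) (x₁ - x₂)) 1)
    {ε : ℝ} (hε : 0 < ε) :
    StablySpacelike (Λ * thetaRef κe κm * Λ.transpose)
      (SchwartzMap.compSubConstCLM ℂ (ε • σ • act Λ !₂[0, 1, 0, 0]) f₁) f₂ := by
  set e₁ : Spacetime := !₂[0, 1, 0, 0]
  set c : ℝ := ‖actCLM (lorentzInv Λ)‖
  have hc : 0 ≤ c := norm_nonneg _
  -- After the transformation by `lorentzInv Λ`, errors of this size have components below `ε / 2`,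
  -- while the translation contributes `ε` to `x₁ - |x₀|`.
  refine ⟨ε / (2 * (c + 1)), by positivity, fun x₁ x₂ R Q e hx₁ hx₂ hR hQ he => ?_⟩
  set θ := Λ * thetaRef κe κm * Λ.transpose
  set a : Spacetime := σ • act (lorentzInv Λ) ((x₁ - ε • σ • act Λ e₁) - x₂)
  have ha : |a 0| ≤ a 1 := h _ (subset_tsupport _ hx₁) _ (subset_tsupport _ hx₂)
  have hcone : ∀ {S : Spacetime}, -S ∈ forwardCone → |(σ • act (thetaRef κe κm)
      (act Λ.transpose S)) 0| ≤ (σ • act (thetaRef κe κm) (act Λ.transpose S)) 1 := by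
    intro S hS
    refine act_thetaRef_mem_closedWedge ?_ hσκ
    have := act_mem_forwardCone (transpose_mem_properLorentz hΛ) hS
    rwa [← actCLM_apply, map_neg, actCLM_apply] at this
  set r : Spacetime := σ • act (thetaRef κe κm) (act Λ.transpose R)
  set q : Spacetime := σ • act (thetaRef κe κm) (act Λ.transpose Q)
  have hr : |r 0| ≤ r 1 := hcone hR
  have hq : |q 0| ≤ q 1 := hcone hQ
  set d : Spacetime := σ • act (lorentzInv Λ) e
  have hσ1 : |σ| = 1 := by
    have : |σ| * |σ| = 1 := by rw [abs_mul_abs_self, hσ]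
    nlinarith [abs_nonneg σ]
  have hd : ∀ i, |d i| < ε / 2 := fun i => by
    have h1 : ‖d i‖ ≤ ‖d‖ := PiLp.norm_apply_le d i
    have h2 : ‖d‖ ≤ c * ‖e‖ := by
      simp only [d]
      rw [norm_smul, Real.norm_eq_abs, hσ1, one_mul]
      exact (actCLM (lorentzInv Λ)).le_opNorm e
    have h3 : c * ‖e‖ ≤ c * (ε / (2 * (c + 1))) := by gcongr
    have h4 : c * (ε / (2 * (c + 1))) < ε / 2 := by
      rw [mul_div_assoc', div_lt_div_iff₀ (by positivity) (by positivity)]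
      nlinarith
    rw [Real.norm_eq_abs] at h1
    linarith
  have hinv : ∀ z, act (lorentzInv Λ) (act Λ z) = z := fun z => by
    rw [← act_mul, lorentzInv_mul hΛ.1, WightmanTheory.act_one]
  set z : Spacetime := x₁ - x₂ + Real.pi • act θ (R + Q) + e
  have hz : σ • act (lorentzInv Λ) z = a + ε • e₁ + Real.pi • (r + q) + d := by
    have h1 : act θ (R + Q) = act Λ (act (thetaRef κe κm) (act Λ.transpose (R + Q))) := by
      rw [← act_mul, ← act_mul]
    simp only [z, a, r, q, d, h1]
    simp only [← actCLM_apply, map_add, map_sub, map_smul]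
    simp only [actCLM_apply, hinv, smul_add, smul_sub]
    rw [smul_comm σ ε, smul_smul σ σ, hσ, one_smul, smul_comm σ Real.pi, smul_comm σ Real.pi]
    abel
  have hmink : minkowski z z = minkowski (σ • act (lorentzInv Λ) z) (σ • act (lorentzInv Λ) z) := by
    rw [minkowski_smul, minkowski_act (lorentzInv_mem_properLorentz hΛ).1, sq, hσ, one_mul]
  rw [hmink, hz]
  set y : Spacetime := a + ε • e₁ + Real.pi • (r + q) + d
  have hy0 : y 0 = a 0 + Real.pi * (r 0 + q 0) + d 0 := by simp [y, e₁]; ring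
  have hy1 : y 1 = a 1 + ε + Real.pi * (r 1 + q 1) + d 1 := by simp [y, e₁]; ring
  have hy : |y 0| < y 1 := by
    rw [hy0, hy1]
    have h1 := abs_lt.1 (hd 0)
    have h2 := abs_lt.1 (hd 1)
    have h3 := abs_le.1 ha
    have h4 := abs_le.1 hr
    have h5 := abs_le.1 hq
    have hpi := Real.pi_pos
    have h6 : Real.pi * (r 0 + q 0) ≤ Real.pi * (r 1 + q 1) := by gcongr <;> linarith
    have h7 : Real.pi * -(r 0 + q 0) ≤ Real.pi * (r 1 + q 1) := by gcongr; linarith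
    rw [abs_lt]
    constructor <;> linarith
  have hy' := sq_lt_sq' (abs_lt.1 hy).1 (abs_lt.1 hy).2
  rw [minkowski]
  nlinarith [sq_nonneg (y 2), sq_nonneg (y 3)]

theorem deformedField_zero (θ : Matrix (Fin 4) (Fin 4) ℝ) (j : Fin K) :
    T.deformedField θ j 0 = 0 := by
  refine LinearMap.ext fun Ψ => ?_
  obtain ⟨v, hv⟩ := Ψ
  refine Submodule.span_induction (p := fun v hv => T.deformedField θ j 0 ⟨v, hv⟩ = 0) ?_ ?_ ?_ ?_ hv
  · rintro _ ⟨n, m, g, rfl⟩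
    refine (T.isDeformedField_deformedField θ j 0 n m g).trans (Subtype.ext ?_)
    change T.Psi _ _ (moyalTensor θ 0 g) = 0
    rw [← moyalTensorLeft_apply, map_zero, map_zero]
  · exact map_zero _
  · intro a b ha hb h1 h2
    have := map_add (T.deformedField θ j 0) (⟨a, ha⟩ : T.domain) ⟨b, hb⟩
    rw [h1, h2, add_zero] at this
    exact this
  · intro c a ha h1
    have := map_smul (T.deformedField θ j 0) c (⟨a, ha⟩ : T.domain)
    rw [h1, smul_zero] at this
    exact this

/-- Wedge-locality of the deformed fields. -/
theorem bracket_deformedField_eq_zero_of_wedge {s : ℤˣ} {k l : Fin K}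
    (hloc : T.SpacelikeCommute s k l) {κe κm : ℝ} (hκ : κe ≠ 0 ∨ κm ≠ 0)
    {θ θ' : Matrix (Fin 4) (Fin 4) ℝ} (hθ : θ ∈ noncommutativities κe κm)
    (hθ' : θ' ∈ noncommutativities κe κm) {f₁ f₂ : 𝓢(Spacetime, ℂ)}
    (h : tsupport f₁ + wedge κe κm θ ⊆ causalComplement (tsupport f₂ + wedge κe κm θ'))
    (Ψ : T.domain) : bracket s (T.deformedField θ k f₁) (T.deformedField θ' l f₂) Ψ = 0 := by
  -- If a support is empty, the hypothesis is void and gives no relation between `θ` and `θ'`; but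
  -- then the deformed field is zero.
  by_cases hf₁ : f₁ = 0
  · rw [hf₁, deformedField_zero, bracket, zero_mul, mul_zero, smul_zero, add_zero]
    rfl
  by_cases hf₂ : f₂ = 0
  · rw [hf₂, deformedField_zero, bracket, zero_mul, mul_zero, smul_zero, add_zero]
    rfl
  have hne : ∀ {f : 𝓢(Spacetime, ℂ)}, f ≠ 0 → ∃ x, x ∈ tsupport f := by
    intro f hf
    by_contra hc
    push Not at hc
    refine hf (SchwartzMap.ext fun x => ?_)
    by_contra hx
    exact hc x (subset_tsupport _ hx)
  obtain ⟨y₁, hy₁⟩ := hne hf₁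
  obtain ⟨y₂, hy₂⟩ := hne hf₂
  obtain ⟨Λ, hΛ, hΛθ⟩ := noncommutativities_subset_referenceOrbit hκ hθ
  obtain ⟨Λ', hΛ', hΛθ'⟩ := noncommutativities_subset_referenceOrbit hκ hθ'
  set σ : ℝ := if 0 ≤ κe then 1 else -1 with hσ'
  have hσ : σ * σ = 1 := by
    rw [hσ']
    split_ifs <;> norm_num
  have hσκ : 0 ≤ σ * κe := by
    rw [hσ']
    split_ifs with h0
    · simpa using h0
    · push Not at h0
      linarith
  set M := lorentzInv Λ * Λ'
  have hM : M ∈ properLorentz := mul_mem_properLorentz (lorentzInv_mem_properLorentz hΛ) hΛ'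
  have hΛM : Λ * M = Λ' := by
    rw [← Matrix.mul_assoc, mul_lorentzInv hΛ.1, Matrix.one_mul]
  have hact : ∀ z, act Λ (act (lorentzInv Λ) z) = z := fun z => by
    rw [← act_mul, mul_lorentzInv hΛ.1, act_one]
  -- The hypothesis, pulled back by `σ Λ⁻¹` to the frame of the standard wedge. One pair of support
  -- points determines the shape of `M`; all pairs are needed for the location of `x₁ - x₂`.
  have hsp : ∀ x₁ ∈ tsupport f₁, ∀ x₂ ∈ tsupport f₂, ∀ w ∈ standardWedge, ∀ w' ∈ standardWedge,
      minkowski (σ • act (lorentzInv Λ) (x₁ - x₂) + w - act M w')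
        (σ • act (lorentzInv Λ) (x₁ - x₂) + w - act M w') < 0 := by
    intro x₁ hx₁ x₂ hx₂ w hw w' hw'
    have h1 := h (Set.add_mem_add hx₁ ⟨Λ, hΛ, hΛθ, w, hw, rfl⟩) _
      (Set.add_mem_add hx₂ ⟨Λ', hΛ', hΛθ', w', hw', rfl⟩)
    rw [← hσ'] at h1
    have h2 : act Λ (σ • act (lorentzInv Λ) (x₁ - x₂) + w - act M w') =
        σ • (x₁ + σ • act Λ w - (x₂ + σ • act Λ' w')) := by
      rw [← actCLM_apply, map_sub, map_add, map_smul, actCLM_apply, actCLM_apply, actCLM_apply, hact,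
        ← act_mul, hΛM]
      simp only [smul_sub, smul_add, smul_smul, hσ, one_smul]
      abel
    rw [← minkowski_act hΛ.1, h2, minkowski_smul, sq, hσ, one_mul]
    exact h1
  obtain ⟨u, v, hu, hv, huv, hMe⟩ := exists_lightlike_of_spacelike hM (hsp y₁ hy₁ y₂ hy₂)
  have hneg : θ' = -θ := by
    have h1 := conj_thetaRef_eq_neg hM.2.1 huv hMe κe κm
    rw [hΛθ, hΛθ', ← hΛM, Matrix.transpose_mul]
    calc Λ * M * thetaRef κe κm * (M.transpose * Λ.transpose) =
        Λ * (M * thetaRef κe κm * M.transpose) * Λ.transpose := by simp only [Matrix.mul_assoc]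
      _ = _ := by rw [h1, Matrix.mul_neg, Matrix.neg_mul]
  rw [hneg]
  refine T.bracket_deformedField_eq_zero hloc hθ.1 (σ • act Λ !₂[0, 1, 0, 0]) (fun ε hε => ?_) Ψ
  rw [hΛθ]
  exact stablySpacelike_translate hΛ hσ hσκ (fun x₁ hx₁ x₂ hx₂ =>
    mem_closedWedge_of_spacelike (hsp x₁ hx₁ x₂ hx₂) hu hv huv hMe) hε

end WightmanTheory

end MoyalQFT

end

open MoyalQFT in
theorem mainTheorem1 {K : ℕ} {H : Type*} [NormedAddCommGroup H] [InnerProductSpace ℂ H]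
    [CompleteSpace H] (T : WightmanTheory K H) (κe κm : ℝ) (hκ : κe ≠ 0 ∨ κm ≠ 0)
    (k l : Fin K) (s : ℤˣ) (hloc : T.SpacelikeCommute s k l) :
    -- the vector-valued distributions `Ψⁿ_m` and the deformed fields are well defined
    (∀ (n : ℕ) (m : Fin n → Fin K), T.IsVectorDistribution n m (T.Psi n m)) ∧
    (∀ θ ∈ noncommutativities κe κm, ∀ (j : Fin K) (f : 𝓢(Spacetime, ℂ)),
      T.IsDeformedField θ j f (T.deformedField θ j f)) ∧
    -- wedge-locality
    (∀ θ ∈ noncommutativities κe κm, ∀ θ' ∈ noncommutativities κe κm,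
      ∀ f₁ f₂ : 𝓢(Spacetime, ℂ),
        tsupport f₁ + wedge κe κm θ ⊆ causalComplement (tsupport f₂ + wedge κe κm θ') →
        ∀ Ψ : T.domain, bracket s (T.deformedField θ k f₁) (T.deformedField θ' l f₂) Ψ = 0) := by
  exact ⟨T.isVectorDistribution_Psi, fun θ _ j f => T.isDeformedField_deformedField θ j f,
    fun θ hθ θ' hθ' f₁ f₂ h Ψ => T.bracket_deformedField_eq_zero_of_wedge hloc hκ hθ hθ' h Ψ⟩
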